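/- Setting. Let $d\ge 1$ and let $\Omega\subset\mathbb{R}^d$ be open and bounded with Lipschitz boundary. Let $\Gamma\subset\Omega$ be a finite set of labeled points which meets every connected component of $\Omega$ (if $\Omega$ is connected this just says $\Gamma\neq\emptyset$), and let $g:\Gamma\to\mathbb{R}$. Let $0<\sigma\le 1$ and let $\rho\in C^{1,\sigma}(\overline\Omega)$ be a probability density on $\Omega$ which is bounded above and below by positive constants; let $\mu$ be the measure $\rho\,dx$ on $\Omega$. Let $\eta:[0,\infty)\to[0,\infty)$ be nonincreasing and continuous at $0$, with $\eta(t)\ge 1$ for $0\le t\le 1$ and $\eta(t)=0$ for $t>2$, and put $\eta_\varepsilon(v)=\varepsilon^{-d}\eta(|v|/\varepsilon)$. Let $R=\min\{|x-y| : x,y\in\Gamma,\ x\ne y\}$ (with $R=\infty$ if $\Gamma$ is a single point), let $r_0>0$, $\alpha\ge 0$, and let $\gamma\in C^\infty(\overline\Omega\setminus\Gamma)$ satisfy $\gamma\ge 1$ on $\Omega$ and $\gamma(x)=1+\left(r_0/\operatorname{dist}(x,\Gamma)\right)^{\alpha}$ whenever $\operatorname{dist}(x,\Gamma)\le R/4$;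 put $\gamma=\infty$ on $\Gamma$. For $\zeta>1$ let $\gamma_\zeta=\min\{\gamma,\zeta\}$. For $n\ge 1$ let $x_1,\dots,x_n$ be independent random points with distribution $\mu$, let $\mathcal{X}_n=\{x_1,\dots,x_n\}\cup\Gamma$, and for $u:\mathcal{X}_n\to\mathbb{R}$ let \[ \mathcal{L}_{n,\varepsilon,\zeta}u(x)=\frac{1}{2n\varepsilon^2}\sum_{y\in\mathcal{X}_n}\bigl(\gamma_\zeta(x)+\gamma_\zeta(y)\bigr)\eta_\varepsilon(x-y)\bigl(u(y)-u(x)\bigr). \] The graph problem is to find $u:\mathcal{X}_n\to\mathbb{R}$ with $\mathcal{L}_{n,\varepsilon,\zeta}u=0$ on $\mathcal{X}_n\setminus\Gamma$ and $u=g$ on $\Gamma$. Theorem (Hölder estimate). Assume $\alpha>d-2$ and $0<\beta<\alpha+2-d$. Then there are constants $C,c>0$, independent of $n$, $\varepsilon$ and $\zeta$, such that for all $n$, all $0<\varepsilon\le 1$ with $n\varepsilon^d\ge 1$, all $\zeta\ge 1+\varepsilon^{-\alpha}$ and each $z\in\Gamma$, the following holds with probability at least $1-C\exp\left(-cn\varepsilon^{d+4}+\log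 n\right)$: the graph problem has a unique solution $u$, and \[ |u(x)-u(z)|\le C|x-z|^{\beta}+Cn^{1/2}\varepsilon^{1+\alpha/2}\qquad\text{for all } x\in\mathcal{X}_n . \] -/

import Mathlib

open MeasureTheory ProbabilityTheory
open scoped NNReal ENNReal ContDiff

noncomputable section

/-- `Ω` has a Lipschitz boundary: near every boundary point, in suitable orthonormal coordinates
with last axis `ν`, the set `Ω` is the region strictly above the graph of a Lipschitz function on
the hyperplane orthogonal to `ν`. -/
def HasLipschitzBoundary {d : ℕ} (Ω : Set (EuclideanSpace ℝ (Fin d))) : Prop :=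
  ∀ p ∈ frontier Ω, ∃ ν : EuclideanSpace ℝ (Fin d), ‖ν‖ = 1 ∧
    ∃ (L : ℝ≥0) (f : (Submodule.span ℝ {ν})ᗮ → ℝ), LipschitzWith L f ∧
      ∃ r : ℝ, 0 < r ∧ ∀ y ∈ Metric.ball p r,
        (y ∈ Ω ↔ f ((Submodule.span ℝ {ν})ᗮ.orthogonalProjectionOnto y) < inner ℝ ν y)

/-- `ρ` belongs to `C^{1,σ}` up to the boundary of `Ω` (its gradient is uniformly `σ`-Hölder
on `Ω`) and lies between two positive constants on `Ω`. -/
structure IsHolderDensity {d : ℕ} (Ω : Set (EuclideanSpace ℝ (Fin d))) (σ : ℝ≥0)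
    (ρ : EuclideanSpace ℝ (Fin d) → ℝ) : Prop where
  contDiffOn : ContDiffOn ℝ 1 ρ Ω
  holder_gradient : ∃ K : ℝ≥0, HolderOnWith K σ (fderiv ℝ ρ) Ω
  bounds : ∃ m M : ℝ, 0 < m ∧ ∀ x ∈ Ω, m ≤ ρ x ∧ ρ x ≤ M

/-- The measure on `Ω` with Lebesgue density `ρ`. -/
def densityMeasure {d : ℕ} (Ω : Set (EuclideanSpace ℝ (Fin d)))
    (ρ : EuclideanSpace ℝ (Fin d) → ℝ) : Measure (EuclideanSpace ℝ (Fin d)) :=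
  (volume.restrict Ω).withDensity fun x => ENNReal.ofReal (ρ x)

/-- The conditions on the kernel profile; only its values on `[0, ∞)` matter. -/
structure IsKernelProfile (η : ℝ → ℝ) : Prop where
  nonneg : ∀ t, 0 ≤ t → 0 ≤ η t
  antitone : AntitoneOn η (Set.Ici 0)
  continuous_zero : ContinuousWithinAt η (Set.Ici 0) 0
  one_le : ∀ t, 0 ≤ t → t ≤ 1 → 1 ≤ η t
  eq_zero : ∀ t, 2 < t → η t = 0

/-- The rescaled radial kernel `ε^{-d} η(|v| / ε)`. -/
def rescaledKernel {d : ℕ} (η : ℝ → ℝ) (ε : ℝ) (v : EuclideanSpace ℝ (Fin d)) : ℝ :=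
  1 / ε ^ d * η (‖v‖ / ε)

/-- `γ` is a smooth weight on `closure Ω \ Γ`, bounded below by `1` on `Ω`, and equal to
`1 + (r₀ / dist(x, Γ))^α` whenever `dist(x, Γ) ≤ R / 4`. Here `R` is the least distance between two
distinct points of `Γ`, namely `Set.einfsep Γ`, which is `∞` when `Γ` has just one point. -/
structure IsSingularWeight {d : ℕ} (Ω : Set (EuclideanSpace ℝ (Fin d)))
    (Γ : Finset (EuclideanSpace ℝ (Fin d))) (r₀ α : ℝ)
    (γ : EuclideanSpace ℝ (Fin d) → ℝ) : Prop where
  smooth : ContDiffOn ℝ ∞ γ (closure Ω \ Γ)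
  one_le : ∀ x ∈ Ω \ (Γ : Set (EuclideanSpace ℝ (Fin d))), 1 ≤ γ x
  eq_near : ∀ x ∈ closure Ω \ (Γ : Set (EuclideanSpace ℝ (Fin d))),
    Metric.infEDist x Γ ≤ Set.einfsep (Γ : Set (EuclideanSpace ℝ (Fin d))) / 4 →
      γ x = 1 + (r₀ / Metric.infDist x Γ) ^ α

open Classical in
/-- The truncated weight `min {γ, ζ}`, where `γ = ∞` at the points of `Γ`. -/
def truncatedWeight {d : ℕ} (Γ : Finset (EuclideanSpace ℝ (Fin d)))
    (γ : EuclideanSpace ℝ (Fin d) → ℝ) (ζ : ℝ) (x : EuclideanSpace ℝ (Fin d)) : ℝ :=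
  if x ∈ Γ then ζ else min (γ x) ζ

open Classical in
/-- The vertex set `{x₁, …, xₙ} ∪ Γ`. -/
def graphVertices {d n : ℕ} (Γ : Finset (EuclideanSpace ℝ (Fin d)))
    (x : Fin n → EuclideanSpace ℝ (Fin d)) : Finset (EuclideanSpace ℝ (Fin d)) :=
  Finset.univ.image x ∪ Γ

theorem mem_graphVertices_of_mem {d n : ℕ} {Γ : Finset (EuclideanSpace ℝ (Fin d))}
    (x : Fin n → EuclideanSpace ℝ (Fin d)) {z : EuclideanSpace ℝ (Fin d)} (hz : z ∈ Γ) :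
    z ∈ graphVertices Γ x :=
  Finset.mem_union_right _ hz

/-- The properly weighted graph Laplacian
`L u(a) = (1 / (2 n ε²)) ∑_b (γ_ζ(a) + γ_ζ(b)) η_ε(a - b) (u(b) - u(a))`,
where `b` runs over the vertex set. -/
def graphLaplacian {d n : ℕ} (Γ : Finset (EuclideanSpace ℝ (Fin d)))
    (η : ℝ → ℝ) (γ : EuclideanSpace ℝ (Fin d) → ℝ) (ε ζ : ℝ)
    (x : Fin n → EuclideanSpace ℝ (Fin d)) (u : graphVertices Γ x → ℝ)
    (a : graphVertices Γ x) : ℝ :=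
  1 / (2 * (n : ℝ) * ε ^ 2) *
    ∑ b : graphVertices Γ x,
      (truncatedWeight Γ γ ζ (a : EuclideanSpace ℝ (Fin d)) +
          truncatedWeight Γ γ ζ (b : EuclideanSpace ℝ (Fin d))) *
        rescaledKernel η ε ((a : EuclideanSpace ℝ (Fin d)) - (b : EuclideanSpace ℝ (Fin d))) *
        (u b - u a)

/-- `u` solves the graph learning problem: `L u = 0` at unlabeled vertices, `u = g` at labels. -/
structure IsGraphSolution {d n : ℕ} (Γ : Finset (EuclideanSpace ℝ (Fin d))) (g : Γ → ℝ)
    (η : ℝ → ℝ) (γ : EuclideanSpace ℝ (Fin d) → ℝ) (ε ζ : ℝ)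
    (x : Fin n → EuclideanSpace ℝ (Fin d)) (u : graphVertices Γ x → ℝ) : Prop where
  laplacian_eq_zero : ∀ a : graphVertices Γ x, (a : EuclideanSpace ℝ (Fin d)) ∉ Γ →
    graphLaplacian Γ η γ ε ζ x u a = 0
  eq_label : ∀ z : Γ, u ⟨z, mem_graphVertices_of_mem x z.2⟩ = g z

end

/-! The estimate splits the vertices by their distance r to the label z: r ≤ Kε, Kε < r < r₁ and r ≥
r₁, where K and r₁ are constants.

Near the label the energy is used. By Dirichlet's principle the solution has no more energy than a
Lipschitz extension of the labels. That extension can be taken constant near each label, so the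
singular weights do not contribute and the unnormalised energy is at most C n² ε²
(`exists_energy_le`). For r ≤ Kε the truncated weight is at least a multiple of ε^(-α). Two such
vertices at distance ≤ ε/2 share of order nε^d neighbours, joined to them by edges of weight of
order at least ε^(-α-d). The energy therefore forces their values to differ by at most C n^(1/2)
ε^(1+α/2) (`sq_sub_le_of_energy`). Boundedly many such steps reach z (`abs_sub_le_of_chain`); this
is the source of the additive error.

In the annulus |x-z|^β is a barrier. In the continuum, div(|x|^(-α) ∇|x|^β) = β(β+d-2-α)|x|^(β-α-2),
which is negative exactly because β < α+2-d. The constant part of γ and the variation of the density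
are perturbations of lower order for r ≤ r₁. On the graph the same sign holds in expectation at
every point of the annulus once K is large (`exists_barrierTerm_bounds`). An exponential moment
bound and a union over the samples make it hold at all sampled points simultaneously, with failure
probability C n exp(-c n ε^(d+2)) (`exists_barrier_event`).

For r ≥ r₁ the maximum principle bounds u by the labels, and a large multiple of r^β dominates. The
comparison principle applied to u and to -u joins the three regions (`abs_sub_le_of_barrier`).
Existence and uniqueness, as well as the maximum principle, need only that every vertex is connected
to a label; this follows from dense sampling and the assumption that Γ meets each component of Ω
(`exists_reflTransGen_label`). -/

/-! ### Weighted finite graphs -/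

/-- Green's identity on a finite weighted graph. -/
theorem graph_green {V : Type*} [Fintype V] (w : V → V → ℝ) (hw : ∀ a b, w a b = w b a)
    (u φ : V → ℝ) :
    ∑ a, ∑ b, w a b * (u b - u a) * (φ b - φ a) =
      -2 * ∑ a, φ a * ∑ b, w a b * (u b - u a) := by
  have h1 : ∑ a, ∑ b, w a b * (u b - u a) * φ b =
      - ∑ a, φ a * ∑ b, w a b * (u b - u a) := by
    rw [Finset.sum_comm, ← Finset.sum_neg_distrib]
    refine Finset.sum_congr rfl fun a _ => ?_
    rw [Finset.mul_sum, ← Finset.sum_neg_distrib]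
    refine Finset.sum_congr rfl fun b _ => ?_
    rw [hw b a]; ring
  have h2 : ∑ a, ∑ b, w a b * (u b - u a) * φ a =
      ∑ a, φ a * ∑ b, w a b * (u b - u a) := by
    refine Finset.sum_congr rfl fun a _ => ?_
    rw [Finset.mul_sum]
    exact Finset.sum_congr rfl fun b _ => by ring
  simp only [mul_sub, Finset.sum_sub_distrib] at h1 h2 ⊢
  linarith

theorem graph_green_eq_zero {V : Type*} [Fintype V] {w : V → V → ℝ}
    (hw : ∀ a b, w a b = w b a) {S : Set V} {u φ : V → ℝ}
    (hu : ∀ a ∉ S, ∑ b, w a b * (u b - u a) = 0) (hφ : ∀ a ∈ S, φ a = 0) :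
    ∑ a, ∑ b, w a b * (u b - u a) * (φ b - φ a) = 0 := by
  rw [graph_green w hw, Finset.sum_eq_zero, mul_zero]
  intro a _
  by_cases ha : a ∈ S
  · rw [hφ a ha, zero_mul]
  · rw [hu a ha, mul_zero]

/-- Dirichlet's principle. -/
theorem graph_energy_le {V : Type*} [Fintype V] {w : V → V → ℝ}
    (hw : ∀ a b, w a b = w b a) (hw0 : ∀ a b, 0 ≤ w a b) {S : Set V} {u G : V → ℝ}
    (hu : ∀ a ∉ S, ∑ b, w a b * (u b - u a) = 0) (hG : ∀ a ∈ S, G a = u a) :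
    ∑ a, ∑ b, w a b * (u b - u a) ^ 2 ≤ ∑ a, ∑ b, w a b * (G b - G a) ^ 2 := by
  have h0 := graph_green_eq_zero hw (φ := fun a => G a - u a) hu
    (fun a ha => by simp [hG a ha])
  have h1 : ∑ a, ∑ b, (w a b * (u b - u a) ^ 2 +
      2 * (w a b * (u b - u a) * ((G b - u b) - (G a - u a)))) ≤
      ∑ a, ∑ b, w a b * (G b - G a) ^ 2 := by
    refine Finset.sum_le_sum fun a _ => Finset.sum_le_sum fun b _ => ?_
    have := mul_nonneg (hw0 a b) (sq_nonneg ((G b - u b) - (G a - u a)))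
    nlinarith
  simp only [Finset.sum_add_distrib, ← Finset.mul_sum] at h1
  linarith

/-- Every summand of the energy is nonnegative, so each vanishes and φ does not change across an
edge of positive weight. Following a path into `S` gives the value 0. This one fact yields both
uniqueness and the maximum principle. -/
theorem graph_eq_zero_of_energy {V : Type*} [Fintype V] {w : V → V → ℝ}
    (hw0 : ∀ a b, 0 ≤ w a b) {S : Set V}
    (hconn : ∀ a, ∃ z ∈ S, Relation.ReflTransGen (fun a b => 0 < w a b) a z)
    {φ : V → ℝ} (hφ : ∀ a ∈ S, φ a = 0)
    (h : ∑ a, ∑ b, w a b * (φ b - φ a) ^ 2 ≤ 0) (a : V) : φ a = 0 := by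
  have hnn : ∀ a b, 0 ≤ w a b * (φ b - φ a) ^ 2 := fun a b =>
    mul_nonneg (hw0 a b) (sq_nonneg _)
  have hedge : ∀ a b, 0 < w a b → φ a = φ b := by
    intro a b hab
    have h1 : w a b * (φ b - φ a) ^ 2 ≤ 0 :=
      ((Finset.single_le_sum (f := fun b => w a b * (φ b - φ a) ^ 2)
        (fun b _ => hnn a b) (Finset.mem_univ b)).trans
        (Finset.single_le_sum (f := fun a => ∑ b, w a b * (φ b - φ a) ^ 2)
          (fun a _ => Finset.sum_nonneg fun b _ => hnn a b) (Finset.mem_univ a))).trans h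
    have h2 : (φ b - φ a) ^ 2 = 0 := by
      have := (mul_eq_zero.1 (le_antisymm h1 (hnn a b))).resolve_left hab.ne'
      exact this
    have := pow_eq_zero_iff (two_ne_zero) |>.1 h2
    linarith
  obtain ⟨z, hz, hp⟩ := hconn a
  rw [← hφ z hz]
  clear hz
  induction hp with
  | refl => rfl
  | tail _ hbc ih => exact ih.trans (hedge _ _ hbc)

/-- The Dirichlet problem is a square linear system, so injectivity is enough. A homogeneous
solution has zero energy by Green's identity. -/
theorem graph_existsUnique {V : Type*} [Fintype V] {w : V → V → ℝ}
    (hw : ∀ a b, w a b = w b a) (hw0 : ∀ a b, 0 ≤ w a b) {S : Set V}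
    (hconn : ∀ a, ∃ z ∈ S, Relation.ReflTransGen (fun a b => 0 < w a b) a z) (G : V → ℝ) :
    ∃! u : V → ℝ, (∀ a ∉ S, ∑ b, w a b * (u b - u a) = 0) ∧ ∀ a ∈ S, u a = G a := by
  classical
  let T : (V → ℝ) →ₗ[ℝ] (V → ℝ) :=
    { toFun := fun u a => if a ∈ S then u a else ∑ b, w a b * (u b - u a)
      map_add' := by
        intro u v
        ext a
        by_cases ha : a ∈ S
        · simp [ha]
        · simp only [ha, if_false, Pi.add_apply, ← Finset.sum_add_distrib]
          exact Finset.sum_congr rfl fun b _ => by ring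
      map_smul' := by
        intro c u
        ext a
        by_cases ha : a ∈ S
        · simp [ha]
        · simp only [ha, if_false, Pi.smul_apply, smul_eq_mul, RingHom.id_apply, Finset.mul_sum]
          exact Finset.sum_congr rfl fun b _ => by ring }
  have hT : ∀ u a, T u a = if a ∈ S then u a else ∑ b, w a b * (u b - u a) := fun _ _ => rfl
  have hinj : Function.Injective T := by
    rw [injective_iff_map_eq_zero]
    intro u hu
    have h1 : ∀ a ∉ S, ∑ b, w a b * (u b - u a) = 0 := fun a ha => by
      have := congrFun hu a
      simpa [hT, ha] using this
    have h2 : ∀ a ∈ S, u a = 0 := fun a ha => by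
      have := congrFun hu a
      simpa [hT, ha] using this
    ext a
    refine graph_eq_zero_of_energy hw0 hconn h2 ?_ a
    rw [← graph_green_eq_zero hw h1 h2]
    exact le_of_eq (Finset.sum_congr rfl fun a _ => Finset.sum_congr rfl fun b _ => by ring)
  obtain ⟨u, hu⟩ := (LinearMap.injective_iff_surjective.1 hinj) (fun a => if a ∈ S then G a else 0)
  refine ⟨u, ⟨fun a ha => ?_, fun a ha => ?_⟩, fun v hv => hinj ?_⟩
  · have := congrFun hu a
    simpa [hT, ha] using this
  · have := congrFun hu a
    simpa [hT, ha] using this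
  · rw [hu]
    ext a
    by_cases ha : a ∈ S
    · simp [hT, ha, hv.2 a ha]
    · simp [hT, ha, hv.1 a ha]

/-- The maximum principle on a graph connected to its boundary. -/
theorem graph_le_of_boundary_le {V : Type*} [Fintype V] {w : V → V → ℝ}
    (hw : ∀ a b, w a b = w b a) (hw0 : ∀ a b, 0 ≤ w a b) {S : Set V}
    (hconn : ∀ a, ∃ z ∈ S, Relation.ReflTransGen (fun a b => 0 < w a b) a z) {u : V → ℝ}
    (hu : ∀ a ∉ S, ∑ b, w a b * (u b - u a) = 0) {M : ℝ} (hM : ∀ a ∈ S, u a ≤ M) (a : V) :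
    u a ≤ M := by
  have h0 : ∀ a ∈ S, max (u a - M) 0 = 0 := fun a ha => max_eq_right (by linarith [hM a ha])
  -- The positive part φ of u - M vanishes on `S` and satisfies (φ b - φ a)² ≤ (u b - u a)(φ b - φ
  -- a), so Green's identity shows that its energy is zero.
  have h := graph_eq_zero_of_energy hw0 hconn (φ := fun a => max (u a - M) 0) h0 (by
    refine le_trans ?_ (graph_green_eq_zero hw hu h0).le
    refine Finset.sum_le_sum fun a _ => Finset.sum_le_sum fun b _ => ?_
    rw [mul_assoc]
    refine mul_le_mul_of_nonneg_left ?_ (hw0 a b)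
    rcases max_cases (u a - M) 0 with ⟨h1, h1'⟩ | ⟨h1, h1'⟩ <;>
      rcases max_cases (u b - M) 0 with ⟨h2, h2'⟩ | ⟨h2, h2'⟩ <;> rw [h1, h2] <;> nlinarith) a
  have := le_max_left (u a - M) 0
  linarith

theorem graph_abs_le_of_boundary {V : Type*} [Fintype V] {w : V → V → ℝ}
    (hw : ∀ a b, w a b = w b a) (hw0 : ∀ a b, 0 ≤ w a b) {S : Set V}
    (hconn : ∀ a, ∃ z ∈ S, Relation.ReflTransGen (fun a b => 0 < w a b) a z) {u : V → ℝ}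
    (hu : ∀ a ∉ S, ∑ b, w a b * (u b - u a) = 0) {M : ℝ} (hM : ∀ a ∈ S, |u a| ≤ M) (a : V) :
    |u a| ≤ M := by
  refine abs_le.2 ⟨?_, graph_le_of_boundary_le hw hw0 hconn hu
    (fun a ha => (le_abs_self _).trans (hM a ha)) a⟩
  have := graph_le_of_boundary_le hw hw0 hconn (u := fun a => - u a) (M := M) (fun a ha => by
    rw [← neg_eq_zero, ← Finset.sum_neg_distrib, ← hu a ha]
    exact Finset.sum_congr rfl fun b _ => by ring)
    (fun a ha => (neg_le_abs _).trans (hM a ha)) a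
  linarith

/-- Comparison with a strict supersolution on a set `D` of vertices. -/
theorem graph_comparison {V : Type*} [Fintype V] {w : V → V → ℝ}
    (hw0 : ∀ a b, 0 ≤ w a b) {D : Set V} {u v : V → ℝ}
    (hu : ∀ a ∈ D, ∑ b, w a b * (u b - u a) = 0)
    (hv : ∀ a ∈ D, ∑ b, w a b * (v b - v a) < 0) (huv : ∀ a ∉ D, u a ≤ v a) (a : V) :
    u a ≤ v a := by
  have : Nonempty V := ⟨a⟩
  obtain ⟨m, hm⟩ := Finite.exists_max fun a => u a - v a
  by_contra! hlt
  have hmD : m ∈ D := by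
    by_contra hmD
    have := hm a
    have := huv m hmD
    linarith
  -- At a maximum of u - v, every increment of u is at most that of v. Since the supersolution is
  -- strict, no connectivity is needed.
  have h1 : ∑ b, w m b * (u b - u m) ≤ ∑ b, w m b * (v b - v m) :=
    Finset.sum_le_sum fun b _ => mul_le_mul_of_nonneg_left (by linarith [hm b]) (hw0 m b)
  linarith [hu m hmD, hv m hmD]

/-! ### Geometry of Lipschitz domains -/

/-- A bounded Lipschitz domain contains, near each of its points, a ball of comparable radius. -/
theorem HasLipschitzBoundary.exists_ball_subset {d : ℕ} {Ω : Set (EuclideanSpace ℝ (Fin d))}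
    (hΩ : HasLipschitzBoundary Ω) (hopen : IsOpen Ω) (hbdd : Bornology.IsBounded Ω) :
    ∃ c : ℝ, 0 < c ∧ ∀ p ∈ Ω, ∀ t : ℝ, 0 < t → t ≤ 1 →
      ∃ y, Metric.ball y (c * t) ⊆ Metric.ball p t ∩ Ω := by
  -- The property with unspecified constants c and t₀ is stable under finite unions, so compactness
  -- of the closure reduces it to a neighbourhood of each point.
  have key : ∃ c t₀ : ℝ, 0 < c ∧ 0 < t₀ ∧ ∀ p ∈ closure Ω, p ∈ Ω → ∀ t : ℝ, 0 < t → t ≤ t₀ →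
      ∃ y, Metric.ball y (c * t) ⊆ Metric.ball p t ∩ Ω := by
    refine hbdd.isCompact_closure.induction_on (p := fun s => ∃ c t₀ : ℝ, 0 < c ∧ 0 < t₀ ∧
      ∀ p ∈ s, p ∈ Ω → ∀ t : ℝ, 0 < t → t ≤ t₀ →
      ∃ y, Metric.ball y (c * t) ⊆ Metric.ball p t ∩ Ω) ?_ ?_ ?_ ?_
    · exact ⟨1, 1, one_pos, one_pos, by simp⟩
    · rintro s s' hs ⟨c, t₀, hc, ht₀, h⟩
      exact ⟨c, t₀, hc, ht₀, fun p hp => h p (hs hp)⟩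
    · rintro s s' ⟨c, t₀, hc, ht₀, h⟩ ⟨c', t₀', hc', ht₀', h'⟩
      refine ⟨min c c', min t₀ t₀', lt_min hc hc', lt_min ht₀ ht₀', fun p hp hpΩ t ht htt => ?_⟩
      rcases hp with hp | hp
      · obtain ⟨y, hy⟩ := h p hp hpΩ t ht (htt.trans (min_le_left _ _))
        exact ⟨y, (Metric.ball_subset_ball
          (mul_le_mul_of_nonneg_right (min_le_left _ _) ht.le)).trans hy⟩
      · obtain ⟨y, hy⟩ := h' p hp hpΩ t ht (htt.trans (min_le_right _ _))
        exact ⟨y, (Metric.ball_subset_ball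
          (mul_le_mul_of_nonneg_right (min_le_right _ _) ht.le)).trans hy⟩
    · intro q hq
      by_cases hqΩ : q ∈ Ω
      · obtain ⟨r, hr, hrΩ⟩ := Metric.isOpen_iff.1 hopen q hqΩ
        refine ⟨Metric.ball q (r / 2), mem_nhdsWithin_of_mem_nhds
          (Metric.ball_mem_nhds q (half_pos hr)), 1, r / 2, one_pos, half_pos hr,
          fun p hp _ t _ ht => ⟨p, ?_⟩⟩
        rw [one_mul]
        refine Set.subset_inter subset_rfl (Set.Subset.trans ?_ hrΩ)
        refine Metric.ball_subset_ball' ?_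
        have := Metric.mem_ball.1 hp
        linarith
      · have hqf : q ∈ frontier Ω := by
          rw [hopen.frontier_eq]; exact ⟨hq, hqΩ⟩
        obtain ⟨ν, hν, K, f, hf, r, hr, hiff⟩ := hΩ q hqf
        have hK : (0 : ℝ) ≤ K := K.2
        -- Moving up by t/2 along ν gains height t/2 over the graph. A perturbation w changes the
        -- height and the Lipschitz function by at most (K+1)‖w‖ in total, whence the radius
        -- t/(2(K+1)).
        refine ⟨Metric.ball q (r / 2), mem_nhdsWithin_of_mem_nhds
          (Metric.ball_mem_nhds q (half_pos hr)), 1 / (2 * (K + 1)), r / 2, by positivity,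
          half_pos hr, fun p hp hpΩ t ht htr => ⟨p + (t / 2) • ν, fun y hy => ?_⟩⟩
        obtain ⟨w, rfl⟩ : ∃ w, y = p + (t / 2) • ν + w := ⟨y - (p + (t / 2) • ν), by abel⟩
        have hw : ‖w‖ < 1 / (2 * (K + 1)) * t := by simpa [dist_eq_norm] using hy
        have hw2 : (K + 1) * ‖w‖ < t / 2 := by
          calc (K + 1) * ‖w‖ < (K + 1) * (1 / (2 * (K + 1)) * t) :=
                mul_lt_mul_of_pos_left hw (by positivity)
            _ = t / 2 := by field_simp
        have hw3 : ‖w‖ < t / 2 := by nlinarith [norm_nonneg w]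
        have hpb : dist p q < r / 2 := hp
        have hdist : dist (p + (t / 2) • ν + w) p < t := by
          rw [dist_eq_norm, show p + (t / 2) • ν + w - p = (t / 2) • ν + w by abel]
          calc ‖(t / 2) • ν + w‖ ≤ ‖(t / 2) • ν‖ + ‖w‖ := norm_add_le _ _
            _ < t := by
              rw [norm_smul, hν, Real.norm_of_nonneg (by positivity)]; linarith
        refine ⟨hdist, (hiff _ ?_).2 ?_⟩
        · rw [Metric.mem_ball]
          linarith [dist_triangle (p + (t / 2) • ν + w) p q]
        · have h1 := (hiff p (Metric.mem_ball.2 (by linarith))).1 hpΩ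
          have hproj : (Submodule.span ℝ {ν})ᗮ.orthogonalProjectionOnto (p + (t / 2) • ν + w) -
              (Submodule.span ℝ {ν})ᗮ.orthogonalProjectionOnto p =
              (Submodule.span ℝ {ν})ᗮ.orthogonalProjectionOnto w := by
            have h0 : (Submodule.span ℝ {ν})ᗮ.orthogonalProjectionOnto ν = 0 := by
              exact Submodule.orthogonalProjectionOnto_eq_zero_iff.2
                (Submodule.le_orthogonal_orthogonal _ (Submodule.mem_span_singleton_self ν))
            rw [map_add, map_add, map_smul, h0]
            simp
          have h2 := hf.dist_le_mul
            ((Submodule.span ℝ {ν})ᗮ.orthogonalProjectionOnto (p + (t / 2) • ν + w))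
            ((Submodule.span ℝ {ν})ᗮ.orthogonalProjectionOnto p)
          rw [dist_eq_norm (E := (Submodule.span ℝ {ν})ᗮ), hproj, Real.dist_eq] at h2
          have h3 : ‖(Submodule.span ℝ {ν})ᗮ.orthogonalProjectionOnto w‖ ≤ ‖w‖ :=
            Submodule.norm_orthogonalProjectionOnto_apply_le _ w
          have h4 : |inner ℝ ν w| ≤ ‖w‖ := by
            simpa [hν] using abs_real_inner_le_norm ν w
          rw [inner_add_right, inner_add_right, inner_smul_right, real_inner_self_eq_norm_sq, hν]
          have h5 := mul_le_mul_of_nonneg_left h3 hK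
          have h6 := le_abs_self (f ((Submodule.span ℝ {ν})ᗮ.orthogonalProjectionOnto
            (p + (t / 2) • ν + w)) - f ((Submodule.span ℝ {ν})ᗮ.orthogonalProjectionOnto p))
          have h7 := neg_abs_le (inner ℝ ν w)
          nlinarith
  obtain ⟨c, t₀, hc, ht₀, h⟩ := key
  have hm : 0 < min 1 t₀ := lt_min one_pos ht₀
  refine ⟨c * min 1 t₀, mul_pos hc hm, fun p hp t ht ht1 => ?_⟩
  obtain ⟨y, hy⟩ := h p (subset_closure hp) hp (min 1 t₀ * t) (mul_pos hm ht)
    ((mul_le_of_le_one_right hm.le ht1).trans (min_le_right _ _))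
  refine ⟨y, ?_⟩
  rw [mul_assoc]
  exact hy.trans (Set.inter_subset_inter_left _
    (Metric.ball_subset_ball (mul_le_of_le_one_left ht.le (min_le_left _ _))))

/-! ### Mass of balls, nets and chains of sample points -/

theorem densityMeasure_apply {d : ℕ} {Ω : Set (EuclideanSpace ℝ (Fin d))}
    (ρ : EuclideanSpace ℝ (Fin d) → ℝ) {s : Set (EuclideanSpace ℝ (Fin d))}
    (hs : MeasurableSet s) :
    densityMeasure Ω ρ s = ∫⁻ x in s ∩ Ω, ENNReal.ofReal (ρ x) := by
  rw [densityMeasure, withDensity_apply _ hs, Measure.restrict_restrict hs]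

/-- The ball may leave Ω, but the Lipschitz boundary leaves inside it a ball of comparable radius
contained in Ω, where the density is at least m. -/
theorem exists_le_densityMeasure_ball {d : ℕ} {Ω : Set (EuclideanSpace ℝ (Fin d))}
    (hΩ : HasLipschitzBoundary Ω) (hopen : IsOpen Ω) (hbdd : Bornology.IsBounded Ω)
    {ρ : EuclideanSpace ℝ (Fin d) → ℝ} {m : ℝ} (hm : 0 < m) (hρ : ∀ x ∈ Ω, m ≤ ρ x)
    [IsProbabilityMeasure (densityMeasure Ω ρ)] :
    ∃ c : ℝ, 0 < c ∧ ∀ p ∈ Ω, ∀ t : ℝ, 0 < t → t ≤ 1 →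
      c * t ^ d ≤ (densityMeasure Ω ρ).real (Metric.ball p t) := by
  obtain ⟨c, hc, h⟩ := hΩ.exists_ball_subset hopen hbdd
  have hv : 0 < volume.real (Metric.ball (0 : EuclideanSpace ℝ (Fin d)) 1) :=
    ENNReal.toReal_pos (Metric.measure_ball_pos _ _ one_pos).ne' measure_ball_lt_top.ne
  refine ⟨m * (c ^ d * volume.real (Metric.ball (0 : EuclideanSpace ℝ (Fin d)) 1)),
    by positivity, fun p hp t ht ht1 => ?_⟩
  obtain ⟨y, hy⟩ := h p hp t ht ht1
  refine (ENNReal.ofReal_le_iff_le_toReal (measure_ne_top _ _)).1 ?_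
  rw [densityMeasure_apply _ measurableSet_ball]
  calc ENNReal.ofReal (m * (c ^ d * volume.real (Metric.ball (0 : EuclideanSpace ℝ (Fin d)) 1))
        * t ^ d)
      = ENNReal.ofReal m * volume (Metric.ball y (c * t)) := by
        rw [Measure.addHaar_ball_of_pos _ _ (by positivity), finrank_euclideanSpace_fin, mul_assoc,
          ENNReal.ofReal_mul hm.le]
        congr 1
        rw [show c ^ d * volume.real (Metric.ball (0 : EuclideanSpace ℝ (Fin d)) 1) * t ^ d =
          (c * t) ^ d * volume.real (Metric.ball (0 : EuclideanSpace ℝ (Fin d)) 1) by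
          rw [mul_pow]; ring, ENNReal.ofReal_mul (by positivity), Measure.real,
          ENNReal.ofReal_toReal measure_ball_lt_top.ne]
    _ = ∫⁻ _ in Metric.ball y (c * t), ENNReal.ofReal m := by
        rw [setLIntegral_const]
    _ ≤ ∫⁻ x in Metric.ball y (c * t), ENNReal.ofReal (ρ x) :=
        setLIntegral_mono' measurableSet_ball fun x hx =>
          ENNReal.ofReal_le_ofReal (hρ x (hy hx).2)
    _ ≤ ∫⁻ x in Metric.ball p t ∩ Ω, ENNReal.ofReal (ρ x) := lintegral_mono_set hy

theorem exists_densityMeasure_closedBall_le {d : ℕ} {Ω : Set (EuclideanSpace ℝ (Fin d))}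
    (hopen : IsOpen Ω) {ρ : EuclideanSpace ℝ (Fin d) → ℝ} {M : ℝ} (hM : 0 ≤ M)
    (hρ : ∀ x ∈ Ω, ρ x ≤ M) :
    ∃ C : ℝ, 0 < C ∧ ∀ p, ∀ t : ℝ, 0 < t →
      (densityMeasure Ω ρ).real (Metric.closedBall p t) ≤ C * t ^ d := by
  set v := volume.real (Metric.ball (0 : EuclideanSpace ℝ (Fin d)) 1) with hvdef
  have hv : 0 < v :=
    ENNReal.toReal_pos (Metric.measure_ball_pos _ _ one_pos).ne' measure_ball_lt_top.ne
  refine ⟨(M + 1) * v, by positivity, fun p t ht => ?_⟩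
  refine ENNReal.toReal_le_of_le_ofReal (by positivity) ?_
  rw [densityMeasure_apply _ measurableSet_closedBall]
  calc ∫⁻ x in Metric.closedBall p t ∩ Ω, ENNReal.ofReal (ρ x)
      ≤ ∫⁻ x in Metric.closedBall p t ∩ Ω, ENNReal.ofReal (M + 1) :=
        setLIntegral_mono' (measurableSet_closedBall.inter hopen.measurableSet) fun x hx =>
          ENNReal.ofReal_le_ofReal (by linarith [hρ x hx.2])
    _ ≤ ∫⁻ x in Metric.closedBall p t, ENNReal.ofReal (M + 1) :=
        lintegral_mono_set Set.inter_subset_left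
    _ = ENNReal.ofReal ((M + 1) * v * t ^ d) := by
        rw [setLIntegral_const, Measure.addHaar_closedBall _ _ ht.le, finrank_euclideanSpace_fin,
          mul_assoc, ENNReal.ofReal_mul (by positivity), mul_comm v,
          ENNReal.ofReal_mul (by positivity), hvdef, Measure.real,
          ENNReal.ofReal_toReal measure_ball_lt_top.ne]

/-- A measure that charges balls centred in `Ω` controls the size of nets of `Ω`. -/
theorem exists_net_of_le_measure_ball {E : Type*} [PseudoMetricSpace E] [MeasurableSpace E]
    [OpensMeasurableSpace E] (μ : Measure E) [IsProbabilityMeasure μ] {Ω : Set E} {t κ : ℝ}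
    (hκ : 0 < κ) (hμ : ∀ p ∈ Ω, κ ≤ μ.real (Metric.ball p (t / 2))) :
    ∃ T : Finset E, ↑T ⊆ Ω ∧ (∀ q ∈ Ω, ∃ p ∈ T, dist q p < t) ∧ (T.card : ℝ) ≤ 1 / κ := by
  classical
  let good : Finset E → Prop := fun T =>
    ↑T ⊆ Ω ∧ (T : Set E).Pairwise fun p q => t ≤ dist p q
  have hcard : ∀ T, good T → (T.card : ℝ) ≤ 1 / κ := by
    intro T hT
    rw [le_div_iff₀ hκ]
    have hdisj : (T : Set E).PairwiseDisjoint fun p => Metric.ball p (t / 2) := by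
      intro p hp q hq hpq
      refine Metric.ball_disjoint_ball ?_
      linarith [hT.2 hp hq hpq]
    calc (T.card : ℝ) * κ = ∑ p ∈ T, κ := by simp
      _ ≤ ∑ p ∈ T, μ.real (Metric.ball p (t / 2)) :=
        Finset.sum_le_sum fun p hp => hμ p (hT.1 hp)
      _ = μ.real (⋃ p ∈ T, Metric.ball p (t / 2)) :=
        (measureReal_biUnion_finset hdisj fun _ _ => Metric.isOpen_ball.measurableSet).symm
      _ ≤ 1 := measureReal_le_one
  have hne : {k | ∃ T, good T ∧ T.card = k}.Nonempty := ⟨0, ∅, ⟨by simp, by simp⟩, rfl⟩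
  have hbd : BddAbove {k | ∃ T, good T ∧ T.card = k} := by
    refine ⟨⌊1 / κ⌋₊, ?_⟩
    rintro k ⟨T, hT, rfl⟩
    exact Nat.le_floor (hcard T hT)
  obtain ⟨T, hT, hTk⟩ := Nat.sSup_mem hne hbd
  refine ⟨T, hT.1, fun q hq => ?_, hcard T hT⟩
  by_contra! hcon
  have hgood : good (insert q T) := by
    refine ⟨?_, ?_⟩
    · rw [Finset.coe_insert]
      exact Set.insert_subset hq hT.1
    · rw [Finset.coe_insert]
      refine hT.2.insert fun p hp _ => ⟨hcon p hp, ?_⟩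
      rw [dist_comm]; exact hcon p hp
  -- If q already lies in `T`, then t ≤ 0, the ball of radius t/2 is empty, and its mass cannot be
  -- at least κ > 0. Otherwise q enlarges a separated set of maximal cardinality.
  by_cases hqT : q ∈ T
  · have h1 := hcon q hqT
    rw [dist_self] at h1
    have h2 := hμ q hq
    rw [Metric.ball_eq_empty.2 (by linarith)] at h2
    simp at h2
    linarith
  · have := le_csSup hbd ⟨insert q T, hgood, rfl⟩
    rw [Finset.card_insert_of_notMem hqT, ← hTk] at this
    omega

/-- Vertices in one connected subset of a densely sampled set are linked by short steps. -/
theorem reflTransGen_of_dense {E V : Type*} [PseudoMetricSpace E] (pos : V → E) {Ω U : Set E}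
    {δ : ℝ} (hδ : 0 < δ) (hdense : ∀ q ∈ Ω, ∃ v, dist (pos v) q ≤ δ) (hU : IsPreconnected U)
    (hUΩ : U ⊆ Ω) {a b : V} (ha : pos a ∈ U) (hb : pos b ∈ U) :
    Relation.ReflTransGen (fun v v' => dist (pos v) (pos v') ≤ 4 * δ) a b := by
  -- The relation is placed on points of Ω: all vertices near p are linked to all vertices near q.
  -- It holds in both directions for nearby points and is transitive because some vertex lies near
  -- the middle point, so it spreads over a preconnected set.
  have := hU.induction₂' (fun p q => ∀ v v', dist (pos v) p ≤ δ → dist (pos v') q ≤ δ →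
    Relation.ReflTransGen (fun v v' => dist (pos v) (pos v') ≤ 4 * δ) v v') ?_ ?_ ha hb a b
    (by simp [hδ.le]) (by simp [hδ.le])
  · exact this
  · intro p hp
    filter_upwards [mem_nhdsWithin_of_mem_nhds (Metric.ball_mem_nhds p hδ)] with q hq
    have hq' : dist q p < δ := hq
    constructor
    · intro v v' hv hv'
      refine Relation.ReflTransGen.single ?_
      have h1 := dist_triangle4 (pos v) p q (pos v')
      rw [dist_comm p q, dist_comm q (pos v')] at h1
      linarith
    · intro v v' hv hv'
      refine Relation.ReflTransGen.single ?_
      have h1 := dist_triangle4 (pos v) q p (pos v')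
      rw [dist_comm p (pos v')] at h1
      linarith
  · intro p q s _ hq _ h1 h2 v v' hv hv'
    obtain ⟨y, hy⟩ := hdense q (hUΩ hq)
    exact (h1 v y hv hy).trans (h2 y v' hy hv')

/-! ### Exponential bounds for independent samples -/

/-- Uses exp t ≤ 1 + t + t² for |t| ≤ 1, followed by 1 + t ≤ exp t. A negative mean that outweighs
the second moment then gives exponential decay. -/
theorem integral_exp_le_of_abs_le_one {E : Type*} [MeasurableSpace E] (μ : Measure E)
    [IsProbabilityMeasure μ] {f : E → ℝ} (hf : Measurable f) (hb : ∀ y, |f y| ≤ 1) :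
    ∫ y, Real.exp (f y) ∂μ ≤ Real.exp (∫ y, f y ∂μ + ∫ y, f y ^ 2 ∂μ) := by
  have hi : Integrable f μ := Integrable.of_bound hf.aestronglyMeasurable 1
    (Filter.Eventually.of_forall hb)
  have hi2 : Integrable (fun y => f y ^ 2) μ :=
    Integrable.of_bound (hf.pow_const 2).aestronglyMeasurable 1
      (Filter.Eventually.of_forall fun y => by
        rw [norm_pow, Real.norm_eq_abs]; exact pow_le_one₀ (abs_nonneg _) (hb y))
  have hie : Integrable (fun y => Real.exp (f y)) μ :=
    Integrable.of_bound hf.exp.aestronglyMeasurable (Real.exp 1)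
      (Filter.Eventually.of_forall fun y => by
        rw [Real.norm_eq_abs, Real.abs_exp]
        exact Real.exp_le_exp.2 ((le_abs_self _).trans (hb y)))
  have h1 : ∫ y, Real.exp (f y) ∂μ ≤ ∫ y, (1 + (f y + f y ^ 2)) ∂μ := by
    refine integral_mono hie ((integrable_const 1).add (hi.add hi2)) fun y => ?_
    have := (abs_le.1 (Real.abs_exp_sub_one_sub_id_le (hb y))).2
    change Real.exp (f y) ≤ 1 + (f y + f y ^ 2)
    linarith
  have h2 : ∫ y, (1 + (f y + f y ^ 2)) ∂μ = ∫ _, (1 : ℝ) ∂μ + (∫ y, f y ∂μ + ∫ y, f y ^ 2 ∂μ) := by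
    rw [← integral_add hi hi2]
    exact integral_add (integrable_const 1) (hi.add hi2)
  rw [h2] at h1
  simp only [integral_const, probReal_univ, smul_eq_mul, one_mul] at h1
  exact h1.trans (by linarith [Real.add_one_le_exp (∫ y, f y ∂μ + ∫ y, f y ^ 2 ∂μ)])

/-- Chernoff's method with exponent 1: scaling is left to the choice of f. Markov's inequality is
applied to the product of the independent factors exp(f(x_j)). -/
theorem measureReal_pi_sum_nonneg_le {E : Type*} [MeasurableSpace E] (μ : Measure E)
    [IsProbabilityMeasure μ] {f : E → ℝ} (hf : Measurable f) (hb : ∀ y, |f y| ≤ 1) (n : ℕ)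
    {κ : ℝ} (hκ : ∫ y, f y ∂μ + ∫ y, f y ^ 2 ∂μ ≤ -κ) :
    (Measure.pi fun _ : Fin n => μ).real {x | 0 ≤ ∑ j, f (x j)} ≤ Real.exp (-(n * κ)) := by
  have hie : Integrable (fun y => Real.exp (f y)) μ :=
    Integrable.of_bound hf.exp.aestronglyMeasurable (Real.exp 1)
      (Filter.Eventually.of_forall fun y => by
        rw [Real.norm_eq_abs, Real.abs_exp]
        exact Real.exp_le_exp.2 ((le_abs_self _).trans (hb y)))
  have hint : Integrable (fun x : Fin n → E => ∏ j, Real.exp (f (x j)))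
      (Measure.pi fun _ : Fin n => μ) := Integrable.fintype_prod fun _ => hie
  have h1 := mul_meas_ge_le_integral_of_nonneg (Filter.Eventually.of_forall fun x =>
    Finset.prod_nonneg fun j _ => (Real.exp_pos (f (x j))).le) hint 1
  rw [integral_fintype_prod_eq_pow (fun y => Real.exp (f y)), one_mul] at h1
  have hset : {x : Fin n → E | 0 ≤ ∑ j, f (x j)} = {x | 1 ≤ ∏ j, Real.exp (f (x j))} := by
    ext x
    simp only [Set.mem_ofPred_eq, ← Real.exp_sum, Real.one_le_exp_iff]
  rw [hset]
  refine h1.trans ?_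
  rw [Fintype.card_fin]
  calc (∫ y, Real.exp (f y) ∂μ) ^ n ≤ Real.exp (-κ) ^ n :=
        pow_le_pow_left₀ (integral_nonneg fun y => (Real.exp_pos _).le)
          ((integral_exp_le_of_abs_le_one μ hf hb).trans (Real.exp_le_exp.2 hκ)) n
    _ = Real.exp (-(n * κ)) := by rw [← Real.exp_nat_mul]; congr 1; ring

theorem measure_pi_le_of_slice_le {E : Type*} [MeasurableSpace E] (μ : Measure E)
    [IsProbabilityMeasure μ] {k : ℕ} (i : Fin (k + 1)) {B : Set (Fin (k + 1) → E)}
    (hB : MeasurableSet B) {c : ℝ≥0∞}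
    (h : ∀ a, (Measure.pi fun _ : Fin k => μ) {x | (i.insertNth a x : Fin (k + 1) → E) ∈ B} ≤ c) :
    (Measure.pi fun _ : Fin (k + 1) => μ) B ≤ c := by
  have hmp := (measurePreserving_piFinSuccAbove (fun _ : Fin (k + 1) => μ) i).symm
  rw [← hmp.measure_preimage_equiv, Measure.prod_apply
    ((MeasurableEquiv.piFinSuccAbove (fun _ : Fin (k + 1) => E) i).symm.measurable hB)]
  calc _ ≤ ∫⁻ _, c ∂μ := lintegral_mono fun a => h a
    _ = c := by simp

/-- The sum is centred at one of its own sample points. Freezing x_i = a makes the other n - 1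
points independent of the centre and the diagonal term zero; the lost factor accounts for exp κ. -/
theorem measureReal_pi_centered_sum_nonneg_le {E : Type*} [MeasurableSpace E] (μ : Measure E)
    [IsProbabilityMeasure μ] {f : E → E → ℝ} (hf : Measurable (Function.uncurry f)) {D : Set E}
    (hD : MeasurableSet D) {κ : ℝ}
    (h0 : ∀ a ∈ D, f a a = 0) (hb : ∀ a ∈ D, ∀ y, |f a y| ≤ 1)
    (hκ : ∀ a ∈ D, ∫ y, f a y ∂μ + ∫ y, f a y ^ 2 ∂μ ≤ -κ) (n : ℕ) (i : Fin n) :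
    (Measure.pi fun _ : Fin n => μ).real {x | x i ∈ D ∧ 0 ≤ ∑ j, f (x i) (x j)} ≤
      Real.exp κ * Real.exp (-(n * κ)) := by
  obtain ⟨k, rfl⟩ : ∃ k, n = k + 1 := ⟨n - 1, by have := i.pos; omega⟩
  have hm : MeasurableSet {x : Fin (k + 1) → E | x i ∈ D ∧ 0 ≤ ∑ j, f (x i) (x j)} := by
    have hs : Measurable fun x : Fin (k + 1) → E => ∑ j, f (x i) (x j) :=
      Finset.measurable_sum _ fun j _ =>
        hf.comp (f := fun x : Fin (k + 1) → E => (x i, x j))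
          ((measurable_pi_apply i).prodMk (measurable_pi_apply j))
    exact MeasurableSet.inter (s₁ := (fun x : Fin (k + 1) → E => x i) ⁻¹' D)
      (measurable_pi_apply i hD) (hs measurableSet_Ici)
  refine ENNReal.toReal_le_of_le_ofReal (by positivity)
    (measure_pi_le_of_slice_le μ i hm fun a => ?_)
  by_cases ha : a ∈ D
  · have hset : {x : Fin k → E | (i.insertNth a x : Fin (k + 1) → E) ∈
        {x : Fin (k + 1) → E | x i ∈ D ∧ 0 ≤ ∑ j, f (x i) (x j)}} =
        {x | 0 ≤ ∑ j, f a (x j)} := by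
      ext x
      simp only [Set.mem_ofPred_eq, Fin.insertNth_apply_same, ha, true_and,
        Fin.sum_univ_succAbove _ i, h0 a ha, zero_add, Fin.insertNth_apply_succAbove]
    rw [hset, ← ofReal_measureReal]
    refine ENNReal.ofReal_le_ofReal ((measureReal_pi_sum_nonneg_le μ
      (hf.comp measurable_prodMk_left) (hb a ha) k (hκ a ha)).trans (le_of_eq ?_))
    rw [← Real.exp_add]
    congr 1
    push_cast
    ring
  · have hset : {x : Fin k → E | (i.insertNth a x : Fin (k + 1) → E) ∈
        {x : Fin (k + 1) → E | x i ∈ D ∧ 0 ≤ ∑ j, f (x i) (x j)}} = ∅ := by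
      ext x
      simp [ha]
    rw [hset, measure_empty]
    exact zero_le

/-- The vertices form a set, so coinciding samples would merge. Excluding them lets sums over
vertices be written as sums over sample indices. -/
theorem ae_pi_injective {E : Type*} [MeasurableSpace E] [MeasurableSingletonClass E]
    [MeasurableEq E] (μ : Measure E) [IsProbabilityMeasure μ] [NullSingletonClass μ] (n : ℕ) :
    ∀ᵐ x ∂(Measure.pi fun _ : Fin n => μ), Function.Injective x := by
  have h : ∀ i j : Fin n, i ≠ j →
      ∀ᵐ x ∂(Measure.pi fun _ : Fin n => μ), x i ≠ x j := by
    intro i j hij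
    obtain ⟨k, rfl⟩ : ∃ k, n = k + 1 := ⟨n - 1, by have := i.pos; omega⟩
    obtain ⟨l, rfl⟩ := Fin.exists_succAbove_eq hij.symm
    rw [ae_iff]
    refine le_antisymm (measure_pi_le_of_slice_le μ i ?_ fun a => ?_) (zero_le)
    · simp only [ne_eq, not_not]
      exact measurableSet_eq_fun (measurable_pi_apply _) (measurable_pi_apply _)
    · have hset : {x : Fin k → E | (i.insertNth a x : Fin (k + 1) → E) ∈
          {x : Fin (k + 1) → E | ¬ x i ≠ x (i.succAbove l)}} = (fun x => x l) ⁻¹' ({a} : Set E) := by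
        ext x
        simp [eq_comm]
      rw [hset, (measurePreserving_eval (fun _ : Fin k => μ) l).measure_preimage
        (measurableSet_singleton a).nullMeasurableSet, measure_singleton]
  filter_upwards [ae_all_iff.2 fun i => ae_all_iff.2 fun j => (Filter.eventually_imp_distrib_left.2 (h i j))]
    with x hx i j hij
  by_contra hne
  exact hx i j hne hij

/-! ### Radial kernels -/

namespace IsKernelProfile

/-- The profile is constrained only on [0, ∞). Freezing it at its value at 0 on the negative axis
gives a function that is antitone on the line, hence measurable. -/
theorem measurable_comp_max {η : ℝ → ℝ} (hη : IsKernelProfile η) :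
    Measurable fun t => η (max t 0) := by
  have : Antitone fun t => η (max t 0) := fun a b hab =>
    hη.antitone (Set.mem_Ici.2 (le_max_right _ _)) (Set.mem_Ici.2 (le_max_right _ _)) (max_le_max_right 0 hab)
  exact this.measurable

theorem measurable_comp {η : ℝ → ℝ} (hη : IsKernelProfile η) {X : Type*} [MeasurableSpace X]
    {f : X → ℝ} (hf : Measurable f) (hf0 : ∀ x, 0 ≤ f x) : Measurable fun x => η (f x) := by
  have := hη.measurable_comp_max.comp hf
  simpa only [Function.comp_def, max_eq_left (hf0 _)] using this

theorem le_zero_value {η : ℝ → ℝ} (hη : IsKernelProfile η) {t : ℝ} (ht : 0 ≤ t) : η t ≤ η 0 :=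
  hη.antitone (Set.mem_Ici.2 le_rfl) ht ht

theorem one_le_zero_value {η : ℝ → ℝ} (hη : IsKernelProfile η) : 1 ≤ η 0 :=
  hη.one_le 0 le_rfl zero_le_one

end IsKernelProfile

theorem integrable_mul_continuous_of_bounded_support {d : ℕ}
    {w g : EuclideanSpace ℝ (Fin d) → ℝ} (hw : Measurable w) {b R : ℝ} (hb : ∀ h, |w h| ≤ b)
    (hR : ∀ h, R < ‖h‖ → w h = 0) (hg : Continuous g) : Integrable fun h => w h * g h := by
  have h1 : IntegrableOn g (Metric.closedBall 0 R) :=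
    hg.continuousOn.integrableOn_compact (isCompact_closedBall 0 R)
  have h2 : IntegrableOn (fun h => w h * g h) (Metric.closedBall 0 R) :=
    Integrable.bdd_mul h1 hw.aestronglyMeasurable (Filter.Eventually.of_forall hb)
  refine (integrableOn_iff_integrable_of_support_subset fun h hh => ?_).1 h2
  by_contra hcon
  rw [mem_closedBall_zero_iff, not_le] at hcon
  exact hh (by simp [hR h hcon])

theorem integral_eq_zero_of_odd {d : ℕ} {f : EuclideanSpace ℝ (Fin d) → ℝ}
    (hf : ∀ h, f (-h) = - f h) : ∫ h, f h = 0 := by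
  have h1 := integral_neg_eq_self f volume
  simp only [hf, integral_neg] at h1
  linarith

/-- The reflection exchanging a and b preserves both Lebesgue measure and the norm. -/
theorem integral_radial_inner_sq_eq {d : ℕ} (φ : ℝ → ℝ) {a b : EuclideanSpace ℝ (Fin d)}
    (hab : ‖a‖ = ‖b‖) :
    ∫ h : EuclideanSpace ℝ (Fin d), φ ‖h‖ * inner ℝ a h ^ 2 =
      ∫ h : EuclideanSpace ℝ (Fin d), φ ‖h‖ * inner ℝ b h ^ 2 := by
  set T := (ℝ ∙ (a - b))ᗮ.reflection with hT
  have hTa : T a = b := Submodule.reflection_sub hab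
  have h1 := T.measurePreserving.integral_comp T.toHomeomorph.measurableEmbedding
    (fun h => φ ‖h‖ * inner ℝ b h ^ 2)
  rw [← h1]
  refine integral_congr_ae (Filter.Eventually.of_forall fun h => ?_)
  change _ = φ ‖T h‖ * inner ℝ b (T h) ^ 2
  rw [T.norm_map, ← hTa, T.inner_map_map]

/-- By rotation invariance a may be replaced by ‖a‖ times any coordinate vector; averaging over the
d coordinates turns the squared inner product into ‖a‖²‖h‖²/d. -/
theorem integral_radial_inner_sq {d : ℕ} (hd : 1 ≤ d) (φ : ℝ → ℝ)
    (hφ : Measurable fun h : EuclideanSpace ℝ (Fin d) => φ ‖h‖) {B R : ℝ}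
    (hB : ∀ h : EuclideanSpace ℝ (Fin d), |φ ‖h‖| ≤ B) (hR : ∀ t, R < t → φ t = 0)
    (a : EuclideanSpace ℝ (Fin d)) :
    ∫ h : EuclideanSpace ℝ (Fin d), φ ‖h‖ * inner ℝ a h ^ 2 =
      ‖a‖ ^ 2 / d * ∫ h : EuclideanSpace ℝ (Fin d), φ ‖h‖ * ‖h‖ ^ 2 := by
  have hd' : (d : ℝ) ≠ 0 := by positivity
  have h1 : ∀ i : Fin d, ∫ h : EuclideanSpace ℝ (Fin d), φ ‖h‖ * inner ℝ a h ^ 2 =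
      ∫ h : EuclideanSpace ℝ (Fin d), φ ‖h‖ * (‖a‖ ^ 2 * h i ^ 2) := by
    intro i
    rw [integral_radial_inner_sq_eq φ (b := EuclideanSpace.single i ‖a‖) (by simp)]
    refine integral_congr_ae (Filter.Eventually.of_forall fun h => ?_)
    simp only [EuclideanSpace.inner_single_left]
    simp [mul_pow]
  have h2 : (d : ℝ) * ∫ h : EuclideanSpace ℝ (Fin d), φ ‖h‖ * inner ℝ a h ^ 2 =
      ∑ i : Fin d, ∫ h : EuclideanSpace ℝ (Fin d), φ ‖h‖ * (‖a‖ ^ 2 * h i ^ 2) := by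
    rw [← Finset.sum_congr rfl fun i _ => h1 i]
    simp
  rw [← integral_finsetSum _ fun i _ => integrable_mul_continuous_of_bounded_support hφ hB
    (fun h hh => hR _ hh) (by fun_prop)] at h2
  have h3 : ∀ h : EuclideanSpace ℝ (Fin d), ∑ i : Fin d, φ ‖h‖ * (‖a‖ ^ 2 * h i ^ 2) =
      ‖a‖ ^ 2 * (φ ‖h‖ * ‖h‖ ^ 2) := by
    intro h
    rw [EuclideanSpace.real_norm_sq_eq h, ← Finset.mul_sum, ← Finset.mul_sum]
    ring
  simp only [h3, integral_const_mul] at h2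
  field_simp
  linarith

/-- The second moment form of a radial kernel bounds the mean of a concave quadratic function of
the relative increment of the squared distance. -/
theorem integral_radial_quadratic_le {d : ℕ} (hd : 1 ≤ d) (φ : ℝ → ℝ)
    (hφ : Measurable fun h : EuclideanSpace ℝ (Fin d) => φ ‖h‖) {B R : ℝ}
    (hB : ∀ h : EuclideanSpace ℝ (Fin d), |φ ‖h‖| ≤ B) (hR : ∀ t, R < t → φ t = 0)
    (hφ0 : ∀ t, 0 ≤ t → 0 ≤ φ t) {a : EuclideanSpace ℝ (Fin d)} (ha : a ≠ 0) {p q : ℝ}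
    (hq : q ≤ 0) :
    ∫ h : EuclideanSpace ℝ (Fin d), φ ‖h‖ *
        (p * ((2 * inner ℝ a h + ‖h‖ ^ 2) / ‖a‖ ^ 2) +
          q / 4 * ((2 * inner ℝ a h + ‖h‖ ^ 2) / ‖a‖ ^ 2) ^ 2) ≤
      (p + q / d) / ‖a‖ ^ 2 * ∫ h : EuclideanSpace ℝ (Fin d), φ ‖h‖ * ‖h‖ ^ 2 := by
  have hr : 0 < ‖a‖ := norm_pos_iff.2 ha
  have hI : ∀ g : EuclideanSpace ℝ (Fin d) → ℝ, Continuous g →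
      Integrable fun h => φ ‖h‖ * g h := fun g hg =>
    integrable_mul_continuous_of_bounded_support hφ hB (fun h hh => hR _ hh) hg
  set r := ‖a‖ with hrdef
  have hodd1 : ∫ h : EuclideanSpace ℝ (Fin d), φ ‖h‖ * inner ℝ a h = 0 :=
    integral_eq_zero_of_odd fun h => by simp
  have hodd2 : ∫ h : EuclideanSpace ℝ (Fin d), φ ‖h‖ * (inner ℝ a h * ‖h‖ ^ 2) = 0 :=
    integral_eq_zero_of_odd fun h => by simp
  have hsq := integral_radial_inner_sq hd φ hφ hB hR a
  have h4 : 0 ≤ ∫ h : EuclideanSpace ℝ (Fin d), φ ‖h‖ * ‖h‖ ^ 4 :=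
    integral_nonneg fun h => mul_nonneg (hφ0 _ (norm_nonneg _)) (by positivity)
  -- Of the five moments, the two odd ones vanish, the two of second order combine to p + q/d, and
  -- the fourth-order one has the sign of q and is dropped.
  have e : ∀ h : EuclideanSpace ℝ (Fin d), φ ‖h‖ *
        (p * ((2 * inner ℝ a h + ‖h‖ ^ 2) / r ^ 2) +
          q / 4 * ((2 * inner ℝ a h + ‖h‖ ^ 2) / r ^ 2) ^ 2) =
      2 * p / r ^ 2 * (φ ‖h‖ * inner ℝ a h) + p / r ^ 2 * (φ ‖h‖ * ‖h‖ ^ 2) +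
      q / r ^ 4 * (φ ‖h‖ * inner ℝ a h ^ 2) + q / r ^ 4 * (φ ‖h‖ * (inner ℝ a h * ‖h‖ ^ 2)) +
      q / (4 * r ^ 4) * (φ ‖h‖ * ‖h‖ ^ 4) := by
    intro h
    field_simp
    ring
  simp only [e]
  rw [integral_add, integral_add, integral_add, integral_add]
  · simp only [integral_const_mul, hodd1, hodd2, hsq]
    have : q / (4 * r ^ 4) * ∫ h : EuclideanSpace ℝ (Fin d), φ ‖h‖ * ‖h‖ ^ 4 ≤ 0 :=
      mul_nonpos_of_nonpos_of_nonneg (div_nonpos_of_nonpos_of_nonneg hq (by positivity)) h4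
    have e2 : q / r ^ 4 * (r ^ 2 / d * ∫ h : EuclideanSpace ℝ (Fin d), φ ‖h‖ * ‖h‖ ^ 2) =
      q / d / r ^ 2 * ∫ h : EuclideanSpace ℝ (Fin d), φ ‖h‖ * ‖h‖ ^ 2 := by
      field_simp
    rw [e2, add_div, add_mul]
    linarith
  all_goals
    first
    | exact (hI _ (by fun_prop)).const_mul _
    | skip
  · exact ((hI _ (by fun_prop)).const_mul _).add ((hI _ (by fun_prop)).const_mul _)
  · exact (((hI _ (by fun_prop)).const_mul _).add ((hI _ (by fun_prop)).const_mul _)).add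
      ((hI _ (by fun_prop)).const_mul _)
  · exact ((((hI _ (by fun_prop)).const_mul _).add ((hI _ (by fun_prop)).const_mul _)).add
      ((hI _ (by fun_prop)).const_mul _)).add ((hI _ (by fun_prop)).const_mul _)

/-- Scaling of the second moment of the kernel. -/
theorem IsKernelProfile.exists_second_moment {η : ℝ → ℝ} (hη : IsKernelProfile η) {d : ℕ}
    (hd : 1 ≤ d) : ∃ I : ℝ, 0 < I ∧ ∀ ε : ℝ, 0 < ε →
      ∫ h : EuclideanSpace ℝ (Fin d), η (‖h‖ / ε) * ‖h‖ ^ 2 = ε ^ (d + 2) * I := by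
  refine ⟨∫ h : EuclideanSpace ℝ (Fin d), η ‖h‖ * ‖h‖ ^ 2, ?_, fun ε hε => ?_⟩
  · have : Nonempty (Fin d) := ⟨⟨0, hd⟩⟩
    have hm : Measurable fun h : EuclideanSpace ℝ (Fin d) => η ‖h‖ :=
      hη.measurable_comp measurable_norm fun _ => norm_nonneg _
    have hi : Integrable fun h : EuclideanSpace ℝ (Fin d) => η ‖h‖ * ‖h‖ ^ 2 :=
      integrable_mul_continuous_of_bounded_support (b := η 0) (R := 2) hm
        (fun h => by
          rw [abs_of_nonneg (hη.nonneg _ (norm_nonneg _))]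
          exact hη.le_zero_value (norm_nonneg _))
        (fun h hh => hη.eq_zero _ hh) (by fun_prop)
    rw [integral_pos_iff_support_of_nonneg
      (fun h => mul_nonneg (hη.nonneg _ (norm_nonneg _)) (by positivity)) hi]
    have hsub : Metric.ball (0 : EuclideanSpace ℝ (Fin d)) 1 \ {0} ⊆
        Function.support fun h : EuclideanSpace ℝ (Fin d) => η ‖h‖ * ‖h‖ ^ 2 := by
      rintro h ⟨hb, hne⟩
      have h1 : 1 ≤ η ‖h‖ := hη.one_le _ (norm_nonneg _) (mem_ball_zero_iff.1 hb).le
      have h2 : 0 < ‖h‖ := norm_pos_iff.2 hne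
      exact (mul_pos (by linarith) (by positivity)).ne'
    refine lt_of_lt_of_le ?_ (measure_mono hsub)
    rw [measure_sdiff_null (by simp)]
    exact Metric.measure_ball_pos _ _ one_pos
  · have h1 := Measure.integral_comp_inv_smul_of_nonneg volume
      (fun h : EuclideanSpace ℝ (Fin d) => η ‖h‖ * ‖h‖ ^ 2) hε.le
    rw [finrank_euclideanSpace_fin, smul_eq_mul] at h1
    rw [pow_add, mul_right_comm, ← h1, ← integral_mul_const]
    refine integral_congr_ae (Filter.Eventually.of_forall fun h => ?_)
    simp only [norm_smul, norm_inv, Real.norm_of_nonneg hε.le]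
    rw [inv_mul_eq_div, div_pow]
    field_simp

/-! ### The barrier -/

/-- Second order Taylor expansion of a real power at `1`. -/
theorem exists_abs_rpow_taylor_le (p : ℝ) {τ : ℝ} (hτ : 0 < τ) :
    ∃ s₀ : ℝ, 0 < s₀ ∧ s₀ ≤ 1 / 2 ∧ ∀ s : ℝ, |s| ≤ s₀ →
      |(1 + s) ^ p - 1 - p * s - p * (p - 1) / 2 * s ^ 2| ≤ τ * s ^ 2 := by
  have hd1 : HasDerivAt (fun s : ℝ => (1 + s) ^ (p - 1)) (p - 1) 0 := by
    have := ((hasDerivAt_id (0 : ℝ)).const_add 1).rpow_const (p := p - 1) (Or.inl (by simp))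
    simpa using this
  have hlo := hd1.isLittleO
  -- The derivative of the remainder is p times a term that is o(t) at 0. Dividing by |p| + 1
  -- absorbs the factor p, also when p = 0, and the mean value inequality then integrates the bound.
  have hc : 0 < τ / (|p| + 1) := by positivity
  obtain ⟨δ, hδ, hball⟩ := Metric.eventually_nhds_iff.1 (hlo.def hc)
  refine ⟨min (1 / 2) (δ / 2), by positivity, min_le_left _ _, fun s hs => ?_⟩
  have hs1 : |s| ≤ 1 / 2 := hs.trans (min_le_left _ _)
  have hs2 : |s| ≤ δ / 2 := hs.trans (min_le_right _ _)
  have hder : ∀ t ∈ Set.uIcc 0 s, HasDerivWithinAt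
      (fun s : ℝ => (1 + s) ^ p - 1 - p * s - p * (p - 1) / 2 * s ^ 2)
      (p * ((1 + t) ^ (p - 1) - 1 - (p - 1) * t)) (Set.uIcc 0 s) t := by
    intro t ht
    have ht1 : |t| ≤ |s| := by
      simpa using Set.abs_sub_left_of_mem_uIcc ht
    have hpos : (1 : ℝ) + t ≠ 0 := by
      have := neg_abs_le t
      linarith
    have h1 : HasDerivAt (fun s : ℝ => (1 + s) ^ p) (p * (1 + t) ^ (p - 1)) t := by
      have := ((hasDerivAt_id t).const_add 1).rpow_const (p := p) (Or.inl hpos)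
      simpa using this
    have h2 := ((h1.sub_const 1).sub ((hasDerivAt_id t).const_mul p)).sub
      (((hasDerivAt_id t).pow 2).const_mul (p * (p - 1) / 2))
    refine (h2.congr_deriv ?_).hasDerivWithinAt
    simp
    ring
  have hbound : ∀ t ∈ Set.uIcc 0 s, ‖p * ((1 + t) ^ (p - 1) - 1 - (p - 1) * t)‖ ≤ τ * |s| := by
    intro t ht
    have ht1 : |t| ≤ |s| := by
      simpa using Set.abs_sub_left_of_mem_uIcc ht
    have h1 := hball (y := t) (by rw [Real.dist_eq, sub_zero]; linarith)
    simp only [sub_zero, add_zero, Real.one_rpow, smul_eq_mul, Real.norm_eq_abs] at h1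
    rw [norm_mul, Real.norm_eq_abs, Real.norm_eq_abs, mul_comm (p - 1) t]
    calc |p| * |(1 + t) ^ (p - 1) - 1 - t * (p - 1)|
        ≤ |p| * (τ / (|p| + 1) * |s|) := by gcongr; exact h1.trans (by gcongr)
      _ = |p| / (|p| + 1) * (τ * |s|) := by ring
      _ ≤ 1 * (τ * |s|) := by
        gcongr
        rw [div_le_one (by positivity)]
        linarith
      _ = τ * |s| := one_mul _
  have hmv := (convex_uIcc (0 : ℝ) s).norm_image_sub_le_of_norm_hasDerivWithin_le hder hbound
    Set.left_mem_uIcc Set.right_mem_uIcc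
  simp only [add_zero, Real.one_rpow, sub_self, mul_zero, ne_eq, OfNat.ofNat_ne_zero,
    not_false_eq_true, zero_pow, sub_zero, Real.norm_eq_abs] at hmv
  rw [mul_assoc, abs_mul_abs_self, ← sq] at hmv
  exact hmv

/-- The increment of the barrier `|x - z|^β`, weighted by `γ`, as a function of the relative
increment `s` of the squared distance to `z`; here `a = r ^ α` and `b = r₀ ^ α`. -/
noncomputable def barrierProfile (α β a b s : ℝ) : ℝ :=
  (2 * a + b * (1 + (1 + s) ^ (-α / 2))) * ((1 + s) ^ (β / 2) - 1)

/-- The quadratic Taylor polynomial has linear coefficient β(a+b) and quadratic coefficient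
(β/4)(a(β-2) + b(β-2-α)). Averaging over directions, in the combination p d + q, leaves β(aα -
(a+b)θ) with θ = α+2-d-β > 0. The bad term aα comes from the constant part of γ: it is zero if α = 0
and small if a = r^α is small, hence the alternative on a. -/
theorem exists_barrierProfile_bounds {d : ℕ} (hd : 1 ≤ d) {α β b : ℝ} (hα : 0 ≤ α)
    (hβ : 0 < β) (hβα : β < α + 2 - d) (hb : 0 < b) :
    ∃ s₀ κ C a₀ : ℝ, 0 < s₀ ∧ s₀ ≤ 1 / 2 ∧ 0 < κ ∧ 0 < C ∧ 0 < a₀ ∧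
      ∀ a : ℝ, 0 ≤ a → a ≤ 1 → (α = 0 ∨ a ≤ a₀) →
        ∃ p q : ℝ, q ≤ 0 ∧ p + q / d ≤ -κ ∧ ∀ s : ℝ, |s| ≤ s₀ →
          barrierProfile α β a b s ≤ p * s + q / 4 * s ^ 2 ∧
          |barrierProfile α β a b s| ≤ C * |s| := by
  have hd0 : (0 : ℝ) < d := by exact_mod_cast hd
  set θ := α + 2 - d - β with hθ
  have hθ0 : 0 < θ := by linarith
  -- Three Taylor expansions contribute an error τ(2a+3b)s², that is, 4τ(2a+3b) = βθ(a/3 + b/2) to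
  -- q. This uses at most half of the margin βθ(a+b).
  set τ := β * θ / 24 with hτdef
  have hτ : 0 < τ := by positivity
  obtain ⟨s₁, hs₁, hs₁', h₁⟩ := exists_abs_rpow_taylor_le (β / 2) hτ
  obtain ⟨s₂, hs₂, hs₂', h₂⟩ := exists_abs_rpow_taylor_le ((β - α) / 2) hτ
  obtain ⟨s₃, hs₃, hs₃', h₃⟩ := exists_abs_rpow_taylor_le (-α / 2) hτ
  have lin : ∀ p s : ℝ, |s| ≤ 1 / 2 →
      |(1 + s) ^ p - 1 - p * s - p * (p - 1) / 2 * s ^ 2| ≤ τ * s ^ 2 →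
      |(1 + s) ^ p - 1| ≤ (|p| + |p * (p - 1) / 2| + τ) * |s| := by
    intro p s hs h
    have hsq : s ^ 2 ≤ |s| := by
      rw [← sq_abs]; nlinarith [abs_nonneg s]
    have e : (1 + s) ^ p - 1 = ((1 + s) ^ p - 1 - p * s - p * (p - 1) / 2 * s ^ 2) + p * s +
        p * (p - 1) / 2 * s ^ 2 := by ring
    calc |(1 + s) ^ p - 1|
        ≤ |(1 + s) ^ p - 1 - p * s - p * (p - 1) / 2 * s ^ 2| + |p * s| +
            |p * (p - 1) / 2 * s ^ 2| := by
          conv_lhs => rw [e]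
          exact abs_add_three _ _ _
      _ ≤ τ * |s| + |p| * |s| + |p * (p - 1) / 2| * |s| := by
          rw [abs_mul p s, abs_mul (p * (p - 1) / 2), abs_of_nonneg (sq_nonneg s)]
          gcongr
          exact h.trans (by gcongr)
      _ = _ := by ring
  set C₁ := |β / 2| + |β / 2 * (β / 2 - 1) / 2| + τ with hC₁
  set C₃ := |-α / 2| + |-α / 2 * (-α / 2 - 1) / 2| + τ with hC₃
  refine ⟨min s₁ (min s₂ s₃), b * β * θ / (4 * d), (2 + b * (2 + C₃)) * C₁,
    b * θ / (4 * (α + 1)), by positivity, (min_le_left _ _).trans hs₁', by positivity,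
    by positivity, by positivity, fun a ha ha1 hαa => ?_⟩
  set p := β * (a + b) with hp
  set q := β * (a * (β - 2) + b * (β - 2 - α)) + 4 * τ * (2 * a + 3 * b) with hq
  have haα : a * α ≤ b * θ / 4 := by
    rcases hαa with h | h
    · rw [h, mul_zero]; positivity
    · calc a * α ≤ b * θ / (4 * (α + 1)) * (α + 1) := by gcongr; linarith
        _ = b * θ / 4 := by field_simp
  have hpq : p * d + q ≤ -(b * β * θ / 4) := by
    have e : p * d + q = β * (a * α - a * θ * (2 / 3) - b * θ / 2) := by
      rw [hp, hq, hτdef, hθ]; ring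
    rw [e]
    have : 0 ≤ a * θ := by positivity
    nlinarith
  have hp0 : 0 ≤ p := by positivity
  have hq0 : q ≤ 0 := by
    have : 0 < b * β * θ / 4 := by positivity
    have : 0 ≤ p * d := by positivity
    linarith
  refine ⟨p, q, hq0, ?_, fun s hs => ?_⟩
  · have e : p + q / d = (p * d + q) / d := by field_simp
    rw [e, div_le_iff₀ hd0]
    refine hpq.trans (le_of_eq ?_)
    field_simp
  · have hsa : |s| ≤ s₁ := hs.trans (min_le_left _ _)
    have hsb : |s| ≤ s₂ := hs.trans ((min_le_right _ _).trans (min_le_left _ _))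
    have hsc : |s| ≤ s₃ := hs.trans ((min_le_right _ _).trans (min_le_right _ _))
    have hpos : 0 < 1 + s := by
      have := neg_abs_le s
      linarith
    have t₁ := h₁ s hsa
    have t₂ := h₂ s hsb
    have t₃ := h₃ s hsc
    have l₁ := lin _ s (hsa.trans hs₁') t₁
    have l₃ := lin _ s (hsa.trans hs₁') t₃
    constructor
    · have hmul : (1 + s) ^ (-α / 2) * (1 + s) ^ (β / 2) = (1 + s) ^ ((β - α) / 2) := by
        rw [← Real.rpow_add hpos]; congr 1; ring
      have e : barrierProfile α β a b s = (2 * a + b) * ((1 + s) ^ (β / 2) - 1) +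
          b * ((1 + s) ^ ((β - α) / 2) - 1) - b * ((1 + s) ^ (-α / 2) - 1) := by
        rw [barrierProfile, ← hmul]; ring
      rw [e]
      have u₁ := mul_le_mul_of_nonneg_left (abs_le.1 t₁).2 (show 0 ≤ 2 * a + b by positivity)
      have u₂ := mul_le_mul_of_nonneg_left (abs_le.1 t₂).2 hb.le
      have u₃ := mul_le_mul_of_nonneg_left (abs_le.1 t₃).1 hb.le
      rw [hp, hq]
      linarith
    · have hs1 : |s| ≤ 1 := by linarith
      have v : |2 * a + b * (1 + (1 + s) ^ (-α / 2))| ≤ 2 + b * (2 + C₃) := by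
        have w₀ : 0 < (1 + s) ^ (-α / 2) := Real.rpow_pos_of_pos hpos _
        rw [abs_of_nonneg (by positivity)]
        have w₁ : (1 + s) ^ (-α / 2) ≤ 1 + C₃ := by
          have w₂ := (le_abs_self _).trans l₃
          have w₃ : C₃ * |s| ≤ C₃ * 1 := mul_le_mul_of_nonneg_left hs1 (by positivity)
          linarith
        have := mul_le_mul_of_nonneg_left w₁ hb.le
        linarith
      rw [barrierProfile, abs_mul, mul_assoc]
      exact mul_le_mul v l₁ (abs_nonneg _) (by positivity)

/-! ### The normalised summand of the Laplacian of the barrier -/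

theorem integral_densityMeasure {d : ℕ} {Ω : Set (EuclideanSpace ℝ (Fin d))} (hopen : IsOpen Ω)
    {ρ : EuclideanSpace ℝ (Fin d) → ℝ} (hρ : ContinuousOn ρ Ω) (hρ0 : ∀ x ∈ Ω, 0 ≤ ρ x)
    (f : EuclideanSpace ℝ (Fin d) → ℝ) :
    ∫ y, f y ∂(densityMeasure Ω ρ) = ∫ y in Ω, ρ y * f y := by
  have hm : AEMeasurable (fun x => ENNReal.ofReal (ρ x)) (volume.restrict Ω) :=
    (hρ.aemeasurable hopen.measurableSet).ennreal_ofReal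
  rw [densityMeasure, integral_withDensity_eq_integral_toReal_smul₀ hm (by simp)]
  refine setIntegral_congr_fun hopen.measurableSet fun x hx => ?_
  simp [ENNReal.toReal_ofReal (hρ0 x hx)]

theorem integrableOn_of_integrable_densityMeasure {d : ℕ} {Ω : Set (EuclideanSpace ℝ (Fin d))}
    (hopen : IsOpen Ω) {ρ : EuclideanSpace ℝ (Fin d) → ℝ} (hρ : ContinuousOn ρ Ω)
    (hρ0 : ∀ x ∈ Ω, 0 ≤ ρ x) {f : EuclideanSpace ℝ (Fin d) → ℝ}
    (hf : Integrable f (densityMeasure Ω ρ)) : IntegrableOn (fun y => ρ y * f y) Ω := by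
  have hm : AEMeasurable (fun x => ENNReal.ofReal (ρ x)) (volume.restrict Ω) :=
    (hρ.aemeasurable hopen.measurableSet).ennreal_ofReal
  rw [densityMeasure, integrable_withDensity_iff_integrable_smul₀' hm (by simp)] at hf
  refine IntegrableOn.congr_fun hf (fun x hx => ?_) hopen.measurableSet
  simp [ENNReal.toReal_ofReal (hρ0 x hx)]

/-- The relative increment `(|y - z|² - |x - z|²) / |x - z|²`. -/
noncomputable def relIncrement {d : ℕ} (z x y : EuclideanSpace ℝ (Fin d)) : ℝ :=
  (2 * inner ℝ (x - z) (y - x) + ‖y - x‖ ^ 2) / ‖x - z‖ ^ 2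

theorem norm_sub_sq_eq_relIncrement {d : ℕ} {z x : EuclideanSpace ℝ (Fin d)} (hx : x ≠ z)
    (y : EuclideanSpace ℝ (Fin d)) : ‖y - z‖ ^ 2 = ‖x - z‖ ^ 2 * (1 + relIncrement z x y) := by
  have hr : 0 < ‖x - z‖ := norm_pos_iff.2 (sub_ne_zero.2 hx)
  have h1 : y - z = (x - z) + (y - x) := by abel
  rw [h1, norm_add_sq_real, relIncrement]
  field_simp
  ring

/-- The summand of the graph Laplacian of `|x - z|^β`, normalised to be of order one. -/
noncomputable def barrierTerm {d : ℕ} (η : ℝ → ℝ) (α β b ε : ℝ)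
    (z x y : EuclideanSpace ℝ (Fin d)) : ℝ :=
  ‖x - z‖ / ε * (η (‖y - x‖ / ε) * barrierProfile α β (‖x - z‖ ^ α) b (relIncrement z x y))

theorem measurable_barrierTerm {d : ℕ} {η : ℝ → ℝ} (hη : IsKernelProfile η) (α β b : ℝ) {ε : ℝ}
    (hε : 0 < ε) (z : EuclideanSpace ℝ (Fin d)) :
    Measurable (Function.uncurry (barrierTerm η α β b ε z)) := by
  have h1 : Measurable fun q : EuclideanSpace ℝ (Fin d) × EuclideanSpace ℝ (Fin d) =>
      η (‖q.2 - q.1‖ / ε) := hη.measurable_comp (by fun_prop) fun q => by positivity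
  have h2 : Measurable fun q : EuclideanSpace ℝ (Fin d) × EuclideanSpace ℝ (Fin d) =>
      relIncrement z q.1 q.2 := by
    have h3 : Measurable fun q : EuclideanSpace ℝ (Fin d) × EuclideanSpace ℝ (Fin d) =>
        (inner ℝ (q.1 - z) (q.2 - q.1) : ℝ) :=
      (by fun_prop : Continuous fun q : EuclideanSpace ℝ (Fin d) × EuclideanSpace ℝ (Fin d) =>
        (inner ℝ (q.1 - z) (q.2 - q.1) : ℝ)).measurable
    unfold relIncrement
    fun_prop
  have h3 : Measurable fun q : EuclideanSpace ℝ (Fin d) × EuclideanSpace ℝ (Fin d) =>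
      barrierProfile α β (‖q.1 - z‖ ^ α) b (relIncrement z q.1 q.2) := by
    unfold barrierProfile
    fun_prop
  exact ((by fun_prop : Measurable fun q : EuclideanSpace ℝ (Fin d) × EuclideanSpace ℝ (Fin d) =>
    ‖q.1 - z‖ / ε).mul (h1.mul h3))

theorem barrierTerm_self {d : ℕ} (η : ℝ → ℝ) (α β b ε : ℝ) (z x : EuclideanSpace ℝ (Fin d)) :
    barrierTerm η α β b ε z x x = 0 := by
  simp [barrierTerm, relIncrement, barrierProfile]

/-- The factor r^(α-β), with r = ‖x - z‖, removes the homogeneity, so that only r^α and the relative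
increment s remain in the profile. As s is of order ε/r, the further factor r/ε makes the summand
bounded. -/
theorem barrierTerm_eq {d : ℕ} (η : ℝ → ℝ) (α β ε : ℝ) {r₀ : ℝ} (hr₀ : 0 < r₀)
    {z x y : EuclideanSpace ℝ (Fin d)} (hx : x ≠ z) (hy : y ≠ z) :
    η (‖y - x‖ / ε) * ((1 + (r₀ / ‖x - z‖) ^ α + (1 + (r₀ / ‖y - z‖) ^ α)) *
      (‖y - z‖ ^ β - ‖x - z‖ ^ β)) * (‖x - z‖ ^ (α - β) * (‖x - z‖ / ε)) =
      barrierTerm η α β (r₀ ^ α) ε z x y := by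
  have hr : 0 < ‖x - z‖ := norm_pos_iff.2 (sub_ne_zero.2 hx)
  have hry : 0 < ‖y - z‖ := norm_pos_iff.2 (sub_ne_zero.2 hy)
  set s := relIncrement z x y with hs
  have hsq := norm_sub_sq_eq_relIncrement hx y
  rw [← hs] at hsq
  have hpos : 0 < 1 + s := by
    have : 0 < ‖x - z‖ ^ 2 * (1 + s) := by rw [← hsq]; positivity
    exact pos_of_mul_pos_right this (by positivity)
  have hpow : ∀ p : ℝ, ‖y - z‖ ^ p = ‖x - z‖ ^ p * (1 + s) ^ (p / 2) := by
    intro p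
    have e : ∀ t : ℝ, 0 ≤ t → t ^ p = (t ^ 2) ^ (p / 2) := by
      intro t ht
      rw [← Real.rpow_natCast, ← Real.rpow_mul ht]
      congr 1
      push_cast
      ring
    rw [e _ hry.le, hsq, Real.mul_rpow (by positivity) hpos.le, ← e _ hr.le]
  have h1 : ‖x - z‖ ^ (α - β) = ‖x - z‖ ^ α / ‖x - z‖ ^ β := Real.rpow_sub hr _ _
  have h2 : (1 + s) ^ (-α / 2) = ((1 + s) ^ (α / 2))⁻¹ := by
    rw [neg_div, Real.rpow_neg hpos.le]
  rw [barrierTerm, barrierProfile, ← hs, h1, h2, Real.div_rpow hr₀.le hr.le,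
    Real.div_rpow hr₀.le hry.le, hpow α, hpow β]
  have p1 : 0 < ‖x - z‖ ^ α := Real.rpow_pos_of_pos hr _
  have p2 : 0 < ‖x - z‖ ^ β := Real.rpow_pos_of_pos hr _
  have p3 : 0 < (1 + s) ^ (α / 2) := Real.rpow_pos_of_pos hpos _
  field_simp
  ring

set_option maxHeartbeats 400000 in
/-- Size, mean and variance of the normalised summand. The mean is strictly negative: `|x - z|^β`
is a strict supersolution near `z`. -/
theorem exists_barrierTerm_bounds {d : ℕ} (hd : 1 ≤ d) {Ω : Set (EuclideanSpace ℝ (Fin d))}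
    (hopen : IsOpen Ω) {ρ : EuclideanSpace ℝ (Fin d) → ℝ} (hρc : ContinuousOn ρ Ω)
    {m : ℝ} (hm : 0 < m) (hρm : ∀ x ∈ Ω, m ≤ ρ x) [IsProbabilityMeasure (densityMeasure Ω ρ)]
    {Cμ : ℝ} (hCμ : ∀ p, ∀ t : ℝ, 0 < t →
      (densityMeasure Ω ρ).real (Metric.closedBall p t) ≤ Cμ * t ^ d)
    {η : ℝ → ℝ} (hη : IsKernelProfile η) {z : EuclideanSpace ℝ (Fin d)} {R₀ : ℝ} (hR₀ : 0 < R₀)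
    (hball : Metric.ball z R₀ ⊆ Ω) {L : ℝ≥0} (hL : LipschitzOnWith L ρ (Metric.ball z R₀))
    {α β b : ℝ} (hα : 0 ≤ α) (hβ : 0 < β) (hβα : β < α + 2 - d) (hb : 0 < b) :
    ∃ K r₁ C κ : ℝ, 2 ≤ K ∧ 0 < r₁ ∧ r₁ ≤ R₀ / 4 ∧ 0 < C ∧ 0 < κ ∧
      ∀ ε : ℝ, 0 < ε → ∀ x, K * ε ≤ ‖x - z‖ → ‖x - z‖ ≤ r₁ →
        (∀ y, |barrierTerm η α β b ε z x y| ≤ C) ∧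
        ∫ y, barrierTerm η α β b ε z x y ∂(densityMeasure Ω ρ) ≤ -κ * ε ^ (d + 1) ∧
        ∫ y, barrierTerm η α β b ε z x y ^ 2 ∂(densityMeasure Ω ρ) ≤ C * ε ^ d := by
  obtain ⟨s₀, κ, C, a₀, hs₀, hs₀', hκ, hC, ha₀, hprof⟩ :=
    exists_barrierProfile_bounds hd hα hβ hβα hb
  obtain ⟨I, hI, hmom⟩ := hη.exists_second_moment hd
  have hη0 : 0 < η 0 := by linarith [hη.one_le_zero_value]
  have hL0 : (0 : ℝ) ≤ L := L.2
  have hCμ0 : 0 ≤ Cμ := by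
    have := hCμ z 1 one_pos
    rw [one_pow, mul_one] at this
    exact measureReal_nonneg.trans this
  obtain ⟨r₂, hr₂, hr₂a⟩ : ∃ r₂ : ℝ, 0 < r₂ ∧ ∀ r : ℝ, 0 < r → r ≤ r₂ → α = 0 ∨ r ^ α ≤ a₀ := by
    rcases hα.eq_or_lt with h | h
    · exact ⟨1, one_pos, fun _ _ _ => Or.inl h.symm⟩
    · refine ⟨a₀ ^ (1 / α), by positivity, fun r hr hr' => Or.inr ?_⟩
      calc r ^ α ≤ (a₀ ^ (1 / α)) ^ α := Real.rpow_le_rpow hr.le hr' h.le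
        _ = a₀ := by rw [← Real.rpow_mul ha₀.le, one_div, inv_mul_cancel₀ h.ne', Real.rpow_one]
  -- The four bounds keep neighbours inside the ball where ρ is Lipschitz, give r ≤ 1, make r^α
  -- small when α > 0, and let half of the negative drift absorb the error 3CLr from the variation
  -- of ρ.
  set r₁ := min (min (R₀ / 4) 1) (min r₂ (m * κ / (2 * (3 * C * L + 1)))) with hr₁
  have hr₁0 : 0 < r₁ := by positivity
  have hr₁R : r₁ ≤ R₀ / 4 := (min_le_left _ _).trans (min_le_left _ _)
  have hr₁1 : r₁ ≤ 1 := (min_le_left _ _).trans (min_le_right _ _)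
  have hr₁2 : r₁ ≤ r₂ := (min_le_right _ _).trans (min_le_left _ _)
  have hr₁m : r₁ ≤ m * κ / (2 * (3 * C * L + 1)) := (min_le_right _ _).trans (min_le_right _ _)
  set D := η 0 * (C * 6) with hD
  have hD0 : 0 < D := by positivity
  -- Interacting points satisfy ‖y - x‖ ≤ 2ε, hence |s| ≤ 6ε/r. The constant 6/s₀ brings this below
  -- s₀.
  refine ⟨6 / s₀, r₁, D + D ^ 2 * (Cμ * 2 ^ d), m * κ / 2 * I, ?_, hr₁0, hr₁R, by positivity,
    by positivity, fun ε hε x hKx hxr => ?_⟩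
  · rw [le_div_iff₀ hs₀]; linarith
  set r := ‖x - z‖ with hr
  have hr0 : 0 < r := lt_of_lt_of_le (by positivity) hKx
  have hr1 : r ≤ 1 := hxr.trans hr₁1
  have hxz : x - z ≠ 0 := norm_pos_iff.1 hr0
  obtain ⟨p, q, hq, hpq, hps⟩ := hprof (r ^ α) (by positivity) (Real.rpow_le_one hr0.le hr1 hα)
    (hr₂a r hr0 (hxr.trans hr₁2))
  have hεr : 6 * ε ≤ s₀ * r := by
    rw [div_mul_eq_mul_div, div_le_iff₀ hs₀] at hKx
    linarith
  have hεr2 : 2 * ε ≤ r := by nlinarith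
  have hs : ∀ y, ‖y - x‖ ≤ 2 * ε → |relIncrement z x y| ≤ 3 * ‖y - x‖ / r := by
    intro y hy
    rw [relIncrement, ← hr, abs_div, abs_of_pos (show 0 < r ^ 2 by positivity),
      div_le_div_iff₀ (by positivity) hr0]
    have h1 := abs_real_inner_le_norm (x - z) (y - x)
    rw [← hr] at h1
    have h2 : |2 * inner ℝ (x - z) (y - x) + ‖y - x‖ ^ 2| ≤ 2 * (r * ‖y - x‖) + ‖y - x‖ ^ 2 := by
      refine (abs_add_le _ _).trans ?_
      rw [abs_mul, abs_two, abs_of_nonneg (sq_nonneg ‖y - x‖)]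
      linarith
    have h3 : ‖y - x‖ ^ 2 ≤ r * ‖y - x‖ := by
      rw [sq]
      exact mul_le_mul_of_nonneg_right (hy.trans hεr2) (norm_nonneg _)
    calc |2 * inner ℝ (x - z) (y - x) + ‖y - x‖ ^ 2| * r ≤ 3 * (r * ‖y - x‖) * r := by
          gcongr; linarith
      _ = 3 * ‖y - x‖ * r ^ 2 := by ring
  have hs' : ∀ y, ‖y - x‖ ≤ 2 * ε → |relIncrement z x y| ≤ s₀ := by
    intro y hy
    refine (hs y hy).trans ?_
    rw [div_le_iff₀ hr0]
    linarith
  have hw : ∀ y, 0 ≤ η (‖y - x‖ / ε) := fun y => hη.nonneg _ (by positivity)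
  have hw' : ∀ y, η (‖y - x‖ / ε) ≤ η 0 := fun y => hη.le_zero_value (by positivity)
  have hw0 : ∀ y, 2 * ε < ‖y - x‖ → η (‖y - x‖ / ε) = 0 := fun y hy =>
    hη.eq_zero _ (by rw [lt_div_iff₀ hε]; exact hy)
  have hbd : ∀ y, |barrierTerm η α β b ε z x y| ≤ D := by
    intro y
    by_cases hy : ‖y - x‖ ≤ 2 * ε
    · rw [barrierTerm, ← hr, abs_mul, abs_mul, abs_of_nonneg (hw y),
        abs_of_pos (show 0 < r / ε by positivity)]
      have h1 := (hps _ (hs' y hy)).2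
      calc r / ε * (η (‖y - x‖ / ε) * |barrierProfile α β (r ^ α) b (relIncrement z x y)|)
          ≤ r / ε * (η 0 * (C * (3 * (2 * ε) / r))) := by
            gcongr
            · exact hw' y
            · refine h1.trans ?_
              gcongr
              refine (hs y hy).trans ?_
              gcongr
        _ = D := by rw [hD]; field_simp; ring
    · rw [barrierTerm, hw0 y (not_le.1 hy), zero_mul, mul_zero, abs_zero]
      exact hD0.le
  have hmeas : Measurable (barrierTerm η α β b ε z x) :=
    (measurable_barrierTerm hη α β b hε z).of_uncurry_left
  refine ⟨fun y => (hbd y).trans (le_add_of_nonneg_right (by positivity)), ?_, ?_⟩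
  · have hint : Integrable (barrierTerm η α β b ε z x) (densityMeasure Ω ρ) :=
      Integrable.of_bound hmeas.aestronglyMeasurable D (Filter.Eventually.of_forall hbd)
    have hρ0 : ∀ x ∈ Ω, 0 ≤ ρ x := fun x hx => hm.le.trans (hρm x hx)
    have hxb : x ∈ Metric.ball z R₀ := by
      rw [Metric.mem_ball, dist_eq_norm, ← hr]; linarith
    set φ : ℝ → ℝ := fun t => η (t / ε) with hφ
    have hφm : Measurable fun h : EuclideanSpace ℝ (Fin d) => φ ‖h‖ :=
      hη.measurable_comp (by fun_prop) fun h => by positivity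
    have hφb : ∀ h : EuclideanSpace ℝ (Fin d), |φ ‖h‖| ≤ η 0 := fun h => by
      rw [abs_of_nonneg (hη.nonneg _ (by positivity))]
      exact hη.le_zero_value (by positivity)
    have hφR : ∀ t, 2 * ε < t → φ t = 0 := fun t ht =>
      hη.eq_zero _ (by rw [lt_div_iff₀ hε]; exact ht)
    have hφI : ∀ g : EuclideanSpace ℝ (Fin d) → ℝ, Continuous g →
        Integrable fun h => φ ‖h‖ * g h := fun g hg =>
      integrable_mul_continuous_of_bounded_support hφm hφb (fun h hh => hφR _ hh) hg
    -- Majorant of the integrand with the density frozen at x and the profile replaced by its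
    -- quadratic bound. The last term pays for |ρ y - ρ x| ≤ L‖y - x‖ times a profile of size at
    -- most 3C‖y - x‖/r.
    set G : EuclideanSpace ℝ (Fin d) → ℝ := fun h =>
      r / ε * (ρ x * (φ ‖h‖ * (p * ((2 * inner ℝ (x - z) h + ‖h‖ ^ 2) / r ^ 2) +
          q / 4 * ((2 * inner ℝ (x - z) h + ‖h‖ ^ 2) / r ^ 2) ^ 2)) +
        3 * C * L / r * (φ ‖h‖ * ‖h‖ ^ 2)) with hG
    have hGI : Integrable G :=
      (((hφI _ (by fun_prop)).const_mul _).add ((hφI _ (by fun_prop)).const_mul _)).const_mul _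
    have hpt : ∀ y ∈ Ω, ρ y * barrierTerm η α β b ε z x y ≤ G (y - x) := by
      intro y _
      by_cases hy : ‖y - x‖ ≤ 2 * ε
      · have hyb : y ∈ Metric.ball z R₀ := by
          rw [Metric.mem_ball, dist_eq_norm]
          have : ‖y - z‖ ≤ ‖y - x‖ + r := by
            rw [hr, show y - z = (y - x) + (x - z) by abel]
            exact norm_add_le _ _
          linarith
        have hlip := hL.dist_le_mul y hyb x hxb
        rw [Real.dist_eq, dist_eq_norm] at hlip
        obtain ⟨h1, h2⟩ := hps _ (hs' y hy)
        have h3 : |barrierProfile α β (r ^ α) b (relIncrement z x y)| ≤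
            C * (3 * ‖y - x‖ / r) := h2.trans (by gcongr; exact hs y hy)
        have h4 : (ρ y - ρ x) * barrierProfile α β (r ^ α) b (relIncrement z x y) ≤
            L * ‖y - x‖ * (C * (3 * ‖y - x‖ / r)) := by
          refine (le_abs_self _).trans ?_
          rw [abs_mul]
          gcongr
        have h5 : ρ x * barrierProfile α β (r ^ α) b (relIncrement z x y) ≤
            ρ x * (p * relIncrement z x y + q / 4 * relIncrement z x y ^ 2) :=
          mul_le_mul_of_nonneg_left h1 (hρ0 x (hball hxb))
        have h6 : r / ε * η (‖y - x‖ / ε) *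
            (ρ y * barrierProfile α β (r ^ α) b (relIncrement z x y)) ≤
            r / ε * η (‖y - x‖ / ε) *
            (ρ x * (p * relIncrement z x y + q / 4 * relIncrement z x y ^ 2) +
              L * ‖y - x‖ * (C * (3 * ‖y - x‖ / r))) :=
          mul_le_mul_of_nonneg_left (by linarith) (mul_nonneg (by positivity) (hw y))
        calc ρ y * barrierTerm η α β b ε z x y
            = r / ε * η (‖y - x‖ / ε) *
              (ρ y * barrierProfile α β (r ^ α) b (relIncrement z x y)) := by
              rw [barrierTerm, ← hr]; ring
          _ ≤ _ := h6
          _ = G (y - x) := by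
              simp only [hG, hφ, relIncrement, ← hr]
              ring
      · have h0 := hw0 y (not_le.1 hy)
        have h1 : φ ‖y - x‖ = 0 := h0
        simp only [barrierTerm, hG, h0, h1, zero_mul, mul_zero, add_zero, le_refl]
    have hGy : Integrable fun y => G (y - x) := hGI.comp_sub_right x
    have hsupp : ∀ y, y ∉ Ω → G (y - x) = 0 := by
      intro y hy
      have h1 : φ ‖y - x‖ = 0 := by
        refine hφR _ ?_
        by_contra! hcon
        refine hy (hball ?_)
        rw [Metric.mem_ball, dist_eq_norm]
        have : ‖y - z‖ ≤ ‖y - x‖ + r := by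
          rw [hr, show y - z = (y - x) + (x - z) by abel]
          exact norm_add_le _ _
        linarith
      simp only [hG, h1, zero_mul, mul_zero, add_zero]
    rw [integral_densityMeasure hopen hρc hρ0]
    calc ∫ y in Ω, ρ y * barrierTerm η α β b ε z x y
        ≤ ∫ y in Ω, G (y - x) :=
          setIntegral_mono_on (integrableOn_of_integrable_densityMeasure hopen hρc hρ0 hint)
            hGy.integrableOn hopen.measurableSet hpt
      _ = ∫ y, G (y - x) := setIntegral_eq_integral_of_forall_compl_eq_zero hsupp
      _ = ∫ h, G h := integral_sub_right_eq_self G x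
      _ = r / ε * (ρ x * (∫ h : EuclideanSpace ℝ (Fin d),
            φ ‖h‖ * (p * ((2 * inner ℝ (x - z) h + ‖h‖ ^ 2) / r ^ 2) +
              q / 4 * ((2 * inner ℝ (x - z) h + ‖h‖ ^ 2) / r ^ 2) ^ 2)) +
            3 * C * L / r * ∫ h : EuclideanSpace ℝ (Fin d), φ ‖h‖ * ‖h‖ ^ 2) := by
          rw [hG, integral_const_mul, integral_add ((hφI _ (by fun_prop)).const_mul _)
            ((hφI _ (by fun_prop)).const_mul _), integral_const_mul, integral_const_mul]
      _ ≤ r / ε * (ρ x * ((p + q / d) / r ^ 2 * (ε ^ (d + 2) * I)) +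
            3 * C * L / r * (ε ^ (d + 2) * I)) := by
          have h1 := integral_radial_quadratic_le hd φ hφm hφb hφR
            (fun t ht => hη.nonneg _ (by positivity)) hxz (p := p) hq
          rw [← hr] at h1
          have h2 : ∫ h : EuclideanSpace ℝ (Fin d), φ ‖h‖ * ‖h‖ ^ 2 = ε ^ (d + 2) * I := hmom ε hε
          rw [h2] at h1 ⊢
          have := mul_le_mul_of_nonneg_left h1 (hρ0 x (hball hxb))
          gcongr
      _ = (ρ x * (p + q / d) + 3 * C * L * r) * (ε ^ (d + 1) * I / r) := by
          field_simp
          ring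
      _ ≤ -(m * κ / 2) * (ε ^ (d + 1) * I / r) := by
          refine mul_le_mul_of_nonneg_right ?_ (by positivity)
          have h1 : ρ x * (p + q / d) ≤ -(m * κ) := by
            have := hρm x (hball hxb)
            nlinarith
          have h2 : 3 * C * L * r ≤ m * κ / 2 := by
            have h3 := hxr.trans hr₁m
            rw [le_div_iff₀ (by positivity)] at h3
            nlinarith
          linarith
      _ ≤ -(m * κ / 2) * (ε ^ (d + 1) * I) := by
          have h1 : ε ^ (d + 1) * I ≤ ε ^ (d + 1) * I / r :=
            le_div_self (by positivity) hr0 hr1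
          have h2 : 0 < m * κ / 2 := by positivity
          nlinarith
      _ = -(m * κ / 2 * I) * ε ^ (d + 1) := by ring
  · have h1 : ∀ y, barrierTerm η α β b ε z x y ^ 2 ≤
        (Metric.closedBall x (2 * ε)).indicator (fun _ => D ^ 2) y := by
      intro y
      by_cases hy : ‖y - x‖ ≤ 2 * ε
      · rw [Set.indicator_of_mem (by rwa [Metric.mem_closedBall, dist_eq_norm])]
        rw [← sq_abs]
        exact pow_le_pow_left₀ (abs_nonneg _) (hbd y) 2
      · rw [Set.indicator_of_notMem (by rwa [Metric.mem_closedBall, dist_eq_norm]), barrierTerm,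
          hw0 y (not_le.1 hy)]
        simp
    calc ∫ y, barrierTerm η α β b ε z x y ^ 2 ∂(densityMeasure Ω ρ)
        ≤ ∫ y, (Metric.closedBall x (2 * ε)).indicator (fun _ => D ^ 2) y
            ∂(densityMeasure Ω ρ) :=
          integral_mono_of_nonneg (Filter.Eventually.of_forall fun y => sq_nonneg _)
            ((integrable_const _).indicator measurableSet_closedBall)
            (Filter.Eventually.of_forall h1)
      _ = D ^ 2 * (densityMeasure Ω ρ).real (Metric.closedBall x (2 * ε)) := by
          rw [integral_indicator_const _ measurableSet_closedBall, smul_eq_mul, mul_comm]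
      _ ≤ D ^ 2 * (Cμ * (2 * ε) ^ d) := by
          gcongr
          exact hCμ x _ (by positivity)
      _ = D ^ 2 * (Cμ * 2 ^ d) * ε ^ d := by rw [mul_pow]; ring
      _ ≤ (D + D ^ 2 * (Cμ * 2 ^ d)) * ε ^ d := by
          gcongr
          linarith

/-! ### Events of high probability -/

/-- Multiplying the summand by cε gives mean at most -cκε^(d+2) and second moment at most
c²Cε^(d+2). For small c half of the drift survives, and this determines the exponent d + 2. -/
theorem exists_barrier_event {d : ℕ} (hd : 1 ≤ d) {Ω : Set (EuclideanSpace ℝ (Fin d))}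
    (hopen : IsOpen Ω) {ρ : EuclideanSpace ℝ (Fin d) → ℝ} (hρc : ContinuousOn ρ Ω)
    {m : ℝ} (hm : 0 < m) (hρm : ∀ x ∈ Ω, m ≤ ρ x) [IsProbabilityMeasure (densityMeasure Ω ρ)]
    {Cμ : ℝ} (hCμ : ∀ p, ∀ t : ℝ, 0 < t →
      (densityMeasure Ω ρ).real (Metric.closedBall p t) ≤ Cμ * t ^ d)
    {η : ℝ → ℝ} (hη : IsKernelProfile η) {z : EuclideanSpace ℝ (Fin d)} {R₀ : ℝ} (hR₀ : 0 < R₀)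
    (hball : Metric.ball z R₀ ⊆ Ω) {L : ℝ≥0} (hL : LipschitzOnWith L ρ (Metric.ball z R₀))
    {α β b : ℝ} (hα : 0 ≤ α) (hβ : 0 < β) (hβα : β < α + 2 - d) (hb : 0 < b) :
    ∃ K r₁ C κ : ℝ, 2 ≤ K ∧ 0 < r₁ ∧ r₁ ≤ R₀ / 4 ∧ 0 < C ∧ 0 < κ ∧
      ∀ (n : ℕ) (ε : ℝ), 0 < ε → ε ≤ 1 →
        (Measure.pi fun _ : Fin n => densityMeasure Ω ρ).real
          {x | ∃ i, K * ε ≤ ‖x i - z‖ ∧ ‖x i - z‖ ≤ r₁ ∧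
            0 ≤ ∑ j, barrierTerm η α β b ε z (x i) (x j)} ≤
          C * n * Real.exp (-(κ * n * ε ^ (d + 2))) := by
  obtain ⟨K, r₁, C, κ, hK, hr₁, hr₁R, hC, hκ, h⟩ := exists_barrierTerm_bounds hd hopen hρc hm hρm
    hCμ hη hR₀ hball hL hα hβ hβα hb
  set c := min (1 / C) (κ / (2 * C)) with hc
  have hc0 : 0 < c := by positivity
  have hcC : c * C ≤ 1 := by
    rw [← le_div_iff₀ hC]; exact min_le_left _ _
  have hcκ : c * C ≤ κ / 2 := by
    have : c ≤ κ / (2 * C) := min_le_right _ _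
    rw [le_div_iff₀ (by positivity)] at this
    linarith
  refine ⟨K, r₁, Real.exp (c * κ / 2), c * κ / 2, hK, hr₁, hr₁R, Real.exp_pos _, by positivity,
    fun n ε hε hε1 => ?_⟩
  set D : Set (EuclideanSpace ℝ (Fin d)) := {x | K * ε ≤ ‖x - z‖ ∧ ‖x - z‖ ≤ r₁} with hD
  have hDm : MeasurableSet D := by
    have h1 : Measurable fun x : EuclideanSpace ℝ (Fin d) => ‖x - z‖ := by fun_prop
    exact (h1 measurableSet_Ici).inter (h1 measurableSet_Iic)
  have hfm : Measurable (Function.uncurry fun x y => c * ε * barrierTerm η α β b ε z x y) :=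
    (measurable_barrierTerm hη α β b hε z).const_mul (c * ε)
  have hone : ∀ i : Fin n, (Measure.pi fun _ : Fin n => densityMeasure Ω ρ).real
      {x | x i ∈ D ∧ 0 ≤ ∑ j, c * ε * barrierTerm η α β b ε z (x i) (x j)} ≤
      Real.exp (c * κ / 2 * ε ^ (d + 2)) * Real.exp (-(n * (c * κ / 2 * ε ^ (d + 2)))) := by
    refine measureReal_pi_centered_sum_nonneg_le (densityMeasure Ω ρ) hfm hDm ?_ ?_ ?_ n
    · intro a _
      rw [barrierTerm_self, mul_zero]
    · intro a ha y
      rw [abs_mul, abs_of_pos (by positivity)]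
      calc c * ε * |barrierTerm η α β b ε z a y| ≤ c * 1 * C := by
            gcongr
            exact (h ε hε a ha.1 ha.2).1 y
        _ ≤ 1 := by rwa [mul_one]
    · intro a ha
      obtain ⟨_, h2, h3⟩ := h ε hε a ha.1 ha.2
      simp only [mul_pow, integral_const_mul]
      have h4 := mul_le_mul_of_nonneg_left h2 (show 0 ≤ c * ε by positivity)
      have h5 := mul_le_mul_of_nonneg_left h3 (show 0 ≤ c ^ 2 * ε ^ 2 by positivity)
      have h6 := mul_le_mul_of_nonneg_right hcκ (show 0 ≤ c * ε ^ (d + 2) by positivity)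
      have e1 : c * ε * (-κ * ε ^ (d + 1)) = -(c * κ * ε ^ (d + 2)) := by ring
      have e2 : c ^ 2 * ε ^ 2 * (C * ε ^ d) = c * C * (c * ε ^ (d + 2)) := by ring
      linarith
  calc (Measure.pi fun _ : Fin n => densityMeasure Ω ρ).real
        {x | ∃ i, K * ε ≤ ‖x i - z‖ ∧ ‖x i - z‖ ≤ r₁ ∧
            0 ≤ ∑ j, barrierTerm η α β b ε z (x i) (x j)}
      ≤ (Measure.pi fun _ : Fin n => densityMeasure Ω ρ).real (⋃ i : Fin n,
        {x | x i ∈ D ∧ 0 ≤ ∑ j, c * ε * barrierTerm η α β b ε z (x i) (x j)}) := by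
        refine measureReal_mono ?_
        rintro x ⟨i, h1, h2, h3⟩
        refine Set.mem_iUnion.2 ⟨i, ⟨h1, h2⟩, ?_⟩
        rw [← Finset.mul_sum]
        positivity
    _ ≤ ∑ i : Fin n, (Measure.pi fun _ : Fin n => densityMeasure Ω ρ).real
        {x | x i ∈ D ∧ 0 ≤ ∑ j, c * ε * barrierTerm η α β b ε z (x i) (x j)} :=
        measureReal_iUnion_fintype_le _
    _ ≤ ∑ i : Fin n, Real.exp (c * κ / 2 * ε ^ (d + 2)) *
          Real.exp (-(n * (c * κ / 2 * ε ^ (d + 2)))) := Finset.sum_le_sum fun i _ => hone i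
    _ = Real.exp (c * κ / 2 * ε ^ (d + 2)) * n *
          Real.exp (-(c * κ / 2 * n * ε ^ (d + 2))) := by
        rw [Finset.sum_const, Finset.card_univ, Fintype.card_fin, nsmul_eq_mul]
        ring_nf
    _ ≤ Real.exp (c * κ / 2) * n * Real.exp (-(c * κ / 2 * n * ε ^ (d + 2))) := by
        gcongr
        exact mul_le_of_le_one_right (by positivity) (pow_le_one₀ hε.le hε1)

/-- The factor 1/4 in the test function makes its second moment small compared with its negative
mean; the factor 1/8 plays this role in `measureReal_pi_count_ge`. -/
theorem measureReal_pi_count_le {E : Type*} [MeasurableSpace E] (μ : Measure E)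
    [IsProbabilityMeasure μ] {B : Set E} (hB : MeasurableSet B) {q : ℝ} (hq : 0 ≤ q)
    (hqB : q ≤ μ.real B) (n : ℕ) :
    (Measure.pi fun _ : Fin n => μ).real {x | ∑ j, B.indicator 1 (x j) ≤ n * q / 2} ≤
      Real.exp (-(n * (q / 32))) := by
  have hB1 : μ.real B ≤ 1 := measureReal_le_one
  have hI : Integrable (B.indicator (1 : E → ℝ)) μ := (integrable_const (1 : ℝ)).indicator hB
  have hIv : ∫ y, B.indicator (1 : E → ℝ) y ∂μ = μ.real B := integral_indicator_one hB
  have hsq : ∀ y, B.indicator (1 : E → ℝ) y ^ 2 = B.indicator 1 y := fun y => by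
    by_cases hy : y ∈ B <;> simp [hy]
  have h := measureReal_pi_sum_nonneg_le μ (f := fun y => 1 / 4 * (q / 2 - B.indicator 1 y))
    (by measurability) (fun y => by
      by_cases hy : y ∈ B
      · rw [Set.indicator_of_mem hy, Pi.one_apply, abs_le]
        constructor <;> linarith
      · rw [Set.indicator_of_notMem hy, abs_le]
        constructor <;> linarith) n (κ := q / 32) (by
      have e : ∀ y, (1 / 4 * (q / 2 - B.indicator (1 : E → ℝ) y)) ^ 2 =
          q ^ 2 / 64 + (1 - q) / 16 * B.indicator 1 y := fun y => by
        have := hsq y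
        linear_combination this / 16
      simp only [e]
      rw [integral_const_mul, integral_sub (integrable_const _) hI, integral_add
        (integrable_const _) (hI.const_mul _), integral_const_mul, hIv]
      simp only [integral_const, probReal_univ, one_smul]
      nlinarith)
  refine le_trans (measureReal_mono fun x hx => ?_) h
  have hx' : ∑ j, B.indicator 1 (x j) ≤ n * q / 2 := hx
  change 0 ≤ ∑ j, 1 / 4 * (q / 2 - B.indicator 1 (x j))
  rw [← Finset.mul_sum, Finset.sum_sub_distrib, Finset.sum_const, Finset.card_univ,
    Fintype.card_fin, nsmul_eq_mul]
  linarith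

theorem measureReal_pi_count_ge {E : Type*} [MeasurableSpace E] (μ : Measure E)
    [IsProbabilityMeasure μ] {B : Set E} (hB : MeasurableSet B) {q : ℝ} (hq : 0 < q)
    (hqB : μ.real B ≤ q) {n : ℕ} (hn : 0 < n) :
    (Measure.pi fun _ : Fin n => μ).real {x | n * (2 * q) ≤ ∑ j, B.indicator 1 (x j)} ≤
      Real.exp (-(n * (q / 32))) := by
  have hB0 : 0 ≤ μ.real B := measureReal_nonneg
  -- For q ≥ 1 the count, being at most n, never reaches 2nq. The exponential bound is needed only
  -- for q < 1, where the test function is bounded by 1.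
  rcases le_or_gt 1 q with hq1 | hq1
  · have : {x : Fin n → E | (n : ℝ) * (2 * q) ≤ ∑ j, B.indicator 1 (x j)} = ∅ := by
      refine Set.eq_empty_iff_forall_notMem.2 fun x hx => ?_
      have hx' : (n : ℝ) * (2 * q) ≤ ∑ j, B.indicator 1 (x j) := hx
      have h1 : ∑ j, B.indicator (1 : E → ℝ) (x j) ≤ ∑ _j : Fin n, (1 : ℝ) :=
        Finset.sum_le_sum fun j _ => Set.indicator_le_self' (fun _ _ => zero_le_one) _
      simp only [Finset.sum_const, Finset.card_univ, Fintype.card_fin, nsmul_eq_mul,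
        mul_one] at h1
      have hn' : (0 : ℝ) < n := by exact_mod_cast hn
      nlinarith
    rw [this, measureReal_empty]
    positivity
  have hI : Integrable (B.indicator (1 : E → ℝ)) μ := (integrable_const (1 : ℝ)).indicator hB
  have hIv : ∫ y, B.indicator (1 : E → ℝ) y ∂μ = μ.real B := integral_indicator_one hB
  have hsq : ∀ y, B.indicator (1 : E → ℝ) y ^ 2 = B.indicator 1 y := fun y => by
    by_cases hy : y ∈ B <;> simp [hy]
  have h := measureReal_pi_sum_nonneg_le μ (f := fun y => 1 / 8 * (B.indicator 1 y - 2 * q))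
    (by measurability) (fun y => by
      by_cases hy : y ∈ B
      · rw [Set.indicator_of_mem hy, Pi.one_apply, abs_le]
        constructor <;> linarith
      · rw [Set.indicator_of_notMem hy, abs_le]
        constructor <;> linarith) n (κ := q / 32) (by
      have e : ∀ y, (1 / 8 * (B.indicator (1 : E → ℝ) y - 2 * q)) ^ 2 =
          q ^ 2 / 16 + (1 - 4 * q) / 64 * B.indicator 1 y := fun y => by
        have := hsq y
        linear_combination this / 64
      simp only [e]
      rw [integral_const_mul, integral_sub hI (integrable_const _), integral_add
        (integrable_const _) (hI.const_mul _)]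
      simp only [integral_const_mul, hIv, integral_const, probReal_univ, one_smul]
      nlinarith [mul_nonneg hq.le hB0])
  refine le_trans (measureReal_mono fun x hx => ?_) h
  have hx' : (n : ℝ) * (2 * q) ≤ ∑ j, B.indicator 1 (x j) := hx
  change 0 ≤ ∑ j, 1 / 8 * (B.indicator 1 (x j) - 2 * q)
  rw [← Finset.mul_sum, Finset.sum_sub_distrib, Finset.sum_const, Finset.card_univ,
    Fintype.card_fin, nsmul_eq_mul]
  linarith

/-- At scale `ε`, every ball centred in `Ω` contains the expected number of samples up to a
constant factor. -/
def IsWellSampled {E : Type*} [PseudoMetricSpace E] (Ω : Set E) (ε l u : ℝ) {n : ℕ}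
    (x : Fin n → E) : Prop :=
  ∀ q ∈ Ω, l ≤ ((Finset.univ.filter fun j => dist (x j) q ≤ ε / 8).card : ℝ) ∧
    ((Finset.univ.filter fun j => dist (x j) q ≤ 2 * ε).card : ℝ) ≤ u

/-- It suffices to control the counts at the points of an ε/16-net: the ball of radius ε/16 about a
net point lies in the ε/8-ball of a nearby q, and the 2ε-ball of q lies in the 3ε-ball of the net
point. The net has at most a multiple of ε^(-d) ≤ n points, which gives the factor n in the union
bound. -/
theorem exists_isWellSampled_event {E : Type*} [PseudoMetricSpace E] [MeasurableSpace E]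
    [OpensMeasurableSpace E] (μ : Measure E) [IsProbabilityMeasure μ] {Ω : Set E} {d : ℕ}
    {cμ Cμ : ℝ} (hcμ0 : 0 < cμ) (hCμ0 : 0 < Cμ)
    (hcμ : ∀ p ∈ Ω, ∀ t : ℝ, 0 < t → t ≤ 1 → cμ * t ^ d ≤ μ.real (Metric.ball p t))
    (hCμ : ∀ p, ∀ t : ℝ, 0 < t → μ.real (Metric.closedBall p t) ≤ Cμ * t ^ d) :
    ∃ c₁ C₁ C κ : ℝ, 0 < c₁ ∧ 0 < C₁ ∧ 0 < C ∧ 0 < κ ∧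
      ∀ (n : ℕ) (ε : ℝ), 0 < ε → ε ≤ 1 → 1 ≤ n * ε ^ d →
        (Measure.pi fun _ : Fin n => μ).real
          {x | ¬ IsWellSampled Ω ε (c₁ * (n * ε ^ d)) (C₁ * (n * ε ^ d)) x} ≤
          C * n * Real.exp (-(κ * n * ε ^ d)) := by
  set κ := min (cμ * (1 / 16) ^ d / 32) (Cμ * 3 ^ d / 32) with hκ
  refine ⟨cμ * (1 / 16) ^ d / 2, 2 * (Cμ * 3 ^ d), 2 * (32 ^ d / cμ), κ, by positivity,
    by positivity, by positivity, by positivity, fun n ε hε hε1 hn => ?_⟩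
  have hn0 : 0 < n := by
    rcases Nat.eq_zero_or_pos n with h | h
    · rw [h] at hn; norm_num at hn
    · exact h
  obtain ⟨T, hTΩ, hTnet, hTcard⟩ := exists_net_of_le_measure_ball μ (Ω := Ω) (t := ε / 16)
    (κ := cμ * (ε / 16 / 2) ^ d) (by positivity)
    (fun p hp => hcμ p hp _ (by positivity) (by linarith))
  have hTn : (T.card : ℝ) ≤ 32 ^ d / cμ * n := by
    refine hTcard.trans ?_
    rw [show ε / 16 / 2 = ε / 32 by ring, div_pow, div_le_iff₀ (by positivity)]
    calc (1 : ℝ) ≤ n * ε ^ d := hn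
      _ = 32 ^ d / cμ * n * (cμ * (ε ^ d / 32 ^ d)) := by field_simp
  set A : E → Set (Fin n → E) := fun p =>
    {x | ∑ j, (Metric.ball p (ε / 16)).indicator 1 (x j) ≤ n * (cμ * (ε / 16) ^ d) / 2} ∪
    {x | n * (2 * (Cμ * (3 * ε) ^ d)) ≤ ∑ j, (Metric.closedBall p (3 * ε)).indicator 1 (x j)}
    with hA
  have hAm : ∀ p ∈ T, (Measure.pi fun _ : Fin n => μ).real (A p) ≤
      2 * Real.exp (-(κ * n * ε ^ d)) := by
    intro p hp
    have h1 := measureReal_pi_count_le μ (measurableSet_ball (x := p) (ε := ε / 16))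
      (q := cμ * (ε / 16) ^ d) (by positivity)
      (hcμ p (hTΩ hp) _ (by positivity) (by linarith)) n
    have h2 := measureReal_pi_count_ge μ (measurableSet_closedBall (x := p) (ε := 3 * ε))
      (q := Cμ * (3 * ε) ^ d) (by positivity) (hCμ p _ (by positivity)) hn0
    have h3 : Real.exp (-(n * (cμ * (ε / 16) ^ d / 32))) ≤ Real.exp (-(κ * n * ε ^ d)) := by
      rw [Real.exp_le_exp, neg_le_neg_iff]
      have := mul_le_mul_of_nonneg_right (min_le_left (cμ * (1 / 16) ^ d / 32) (Cμ * 3 ^ d / 32))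
        (show 0 ≤ n * ε ^ d by positivity)
      calc κ * n * ε ^ d = κ * (n * ε ^ d) := by ring
        _ ≤ _ := this
        _ = _ := by rw [div_eq_mul_one_div ε 16, mul_pow]; ring
    have h4 : Real.exp (-(n * (Cμ * (3 * ε) ^ d / 32))) ≤ Real.exp (-(κ * n * ε ^ d)) := by
      rw [Real.exp_le_exp, neg_le_neg_iff]
      have := mul_le_mul_of_nonneg_right (min_le_right (cμ * (1 / 16) ^ d / 32) (Cμ * 3 ^ d / 32))
        (show 0 ≤ n * ε ^ d by positivity)
      calc κ * n * ε ^ d = κ * (n * ε ^ d) := by ring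
        _ ≤ _ := this
        _ = _ := by rw [mul_pow]; ring
    refine (measureReal_union_le _ _).trans ?_
    linarith
  have hsub : {x : Fin n → E | ¬ IsWellSampled Ω ε (cμ * (1 / 16) ^ d / 2 * (n * ε ^ d))
      (2 * (Cμ * 3 ^ d) * (n * ε ^ d)) x} ⊆ ⋃ p ∈ T, A p := by
    intro x hx
    by_contra hcon
    simp only [Set.mem_iUnion, not_exists] at hcon
    refine hx fun q hq => ?_
    obtain ⟨p, hpT, hpq⟩ := hTnet q hq
    have hxp := hcon p hpT
    have hxl : ¬ (∑ j, (Metric.ball p (ε / 16)).indicator 1 (x j) ≤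
      (n : ℝ) * (cμ * (ε / 16) ^ d) / 2) := fun h => hxp (Or.inl h)
    have hxu : ¬ ((n : ℝ) * (2 * (Cμ * (3 * ε) ^ d)) ≤
      ∑ j, (Metric.closedBall p (3 * ε)).indicator 1 (x j)) := fun h => hxp (Or.inr h)
    rw [not_le] at hxl hxu
    constructor
    · have h1 : ∑ j, (Metric.ball p (ε / 16)).indicator (1 : E → ℝ) (x j) ≤
          ((Finset.univ.filter fun j => dist (x j) q ≤ ε / 8).card : ℝ) := by
        rw [Finset.card_filter, Nat.cast_sum]
        refine Finset.sum_le_sum fun j _ => ?_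
        by_cases hj : x j ∈ Metric.ball p (ε / 16)
        · rw [Set.indicator_of_mem hj, if_pos]
          · simp
          · have := Metric.mem_ball.1 hj
            have := dist_triangle (x j) p q
            rw [dist_comm p q] at this
            linarith
        · rw [Set.indicator_of_notMem hj]
          positivity
      have e : cμ * (1 / 16) ^ d / 2 * (n * ε ^ d) = (n : ℝ) * (cμ * (ε / 16) ^ d) / 2 := by
        rw [div_eq_mul_one_div ε 16, mul_pow]; ring
      rw [e]
      linarith
    · have h1 : ((Finset.univ.filter fun j => dist (x j) q ≤ 2 * ε).card : ℝ) ≤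
          ∑ j, (Metric.closedBall p (3 * ε)).indicator (1 : E → ℝ) (x j) := by
        rw [Finset.card_filter, Nat.cast_sum]
        refine Finset.sum_le_sum fun j _ => ?_
        by_cases hj : dist (x j) q ≤ 2 * ε
        · rw [if_pos hj, Set.indicator_of_mem]
          · simp
          · rw [Metric.mem_closedBall]
            have := dist_triangle (x j) q p
            linarith
        · rw [if_neg hj]
          simp only [Nat.cast_zero]
          exact Set.indicator_nonneg (fun _ _ => zero_le_one) _
      have e : 2 * (Cμ * 3 ^ d) * (n * ε ^ d) = (n : ℝ) * (2 * (Cμ * (3 * ε) ^ d)) := by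
        rw [mul_pow]; ring
      rw [e]
      linarith
  calc (Measure.pi fun _ : Fin n => μ).real _
      ≤ (Measure.pi fun _ : Fin n => μ).real (⋃ p ∈ T, A p) := measureReal_mono hsub (measure_ne_top _ _)
    _ ≤ ∑ p ∈ T, (Measure.pi fun _ : Fin n => μ).real (A p) := measureReal_biUnion_finset_le _ _
    _ ≤ ∑ p ∈ T, 2 * Real.exp (-(κ * n * ε ^ d)) := Finset.sum_le_sum hAm
    _ = T.card * (2 * Real.exp (-(κ * n * ε ^ d))) := by
        rw [Finset.sum_const, nsmul_eq_mul]
    _ ≤ 32 ^ d / cμ * n * (2 * Real.exp (-(κ * n * ε ^ d))) := by gcongr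
    _ = 2 * (32 ^ d / cμ) * n * Real.exp (-(κ * n * ε ^ d)) := by ring

/-! ### The random geometric graph -/

theorem mem_graphVertices_sample {d n : ℕ} (Γ : Finset (EuclideanSpace ℝ (Fin d)))
    (x : Fin n → EuclideanSpace ℝ (Fin d)) (i : Fin n) : x i ∈ graphVertices Γ x :=
  Finset.mem_union_left _ (Finset.mem_image_of_mem x (Finset.mem_univ i))

theorem eq_sample_of_mem_graphVertices {d n : ℕ} {Γ : Finset (EuclideanSpace ℝ (Fin d))}
    {x : Fin n → EuclideanSpace ℝ (Fin d)} {a : EuclideanSpace ℝ (Fin d)}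
    (ha : a ∈ graphVertices Γ x) (haΓ : a ∉ Γ) : ∃ i, x i = a := by
  rcases Finset.mem_union.1 ha with h | h
  · obtain ⟨i, _, hi⟩ := Finset.mem_image.1 h
    exact ⟨i, hi⟩
  · exact absurd h haΓ

theorem mem_of_mem_graphVertices {d n : ℕ} {Γ : Finset (EuclideanSpace ℝ (Fin d))}
    {x : Fin n → EuclideanSpace ℝ (Fin d)} {Ω : Set (EuclideanSpace ℝ (Fin d))}
    (hΓ : ∀ z ∈ Γ, z ∈ Ω) (hx : ∀ i, x i ∈ Ω) {a : EuclideanSpace ℝ (Fin d)}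
    (ha : a ∈ graphVertices Γ x) : a ∈ Ω := by
  by_cases h : a ∈ Γ
  · exact hΓ a h
  · obtain ⟨i, rfl⟩ := eq_sample_of_mem_graphVertices ha h
    exact hx i

theorem sum_graphVertices {d n : ℕ} {Γ : Finset (EuclideanSpace ℝ (Fin d))}
    {x : Fin n → EuclideanSpace ℝ (Fin d)} (hinj : Function.Injective x) (hxΓ : ∀ i, x i ∉ Γ)
    (F : graphVertices Γ x → ℝ) :
    ∑ a, F a = ∑ i, F ⟨x i, mem_graphVertices_sample Γ x i⟩ +
      ∑ z : Γ, F ⟨z, mem_graphVertices_of_mem x z.2⟩ := by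
  let e : Fin n ⊕ Γ → graphVertices Γ x := Sum.elim
    (fun i => ⟨x i, mem_graphVertices_sample Γ x i⟩)
    (fun z => ⟨z, mem_graphVertices_of_mem x z.2⟩)
  have he : Function.Bijective e := by
    constructor
    · rintro (i | z) (j | z') h
      · exact congrArg Sum.inl (hinj (congrArg Subtype.val h))
      · have h' : x i = z' := congrArg Subtype.val h
        exact absurd (h' ▸ z'.2) (hxΓ i)
      · have h' : (z : EuclideanSpace ℝ (Fin d)) = x j := congrArg Subtype.val h
        exact absurd (h' ▸ z.2) (hxΓ j)
      · have h' : (z : EuclideanSpace ℝ (Fin d)) = z' :=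
          congrArg (fun a : graphVertices Γ x => (a : EuclideanSpace ℝ (Fin d))) h
        exact congrArg Sum.inr (Subtype.ext h')
    · rintro ⟨a, ha⟩
      by_cases h : a ∈ Γ
      · exact ⟨Sum.inr ⟨a, h⟩, rfl⟩
      · obtain ⟨i, hi⟩ := eq_sample_of_mem_graphVertices ha h
        exact ⟨Sum.inl i, Subtype.ext hi⟩
  rw [← he.sum_comp F, Fintype.sum_sum_type]
  rfl

/-- The weight of the edge between `a` and `b`. -/
noncomputable def edgeWeight {d : ℕ} (Γ : Finset (EuclideanSpace ℝ (Fin d))) (η : ℝ → ℝ)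
    (γ : EuclideanSpace ℝ (Fin d) → ℝ) (ε ζ : ℝ) (a b : EuclideanSpace ℝ (Fin d)) : ℝ :=
  (truncatedWeight Γ γ ζ a + truncatedWeight Γ γ ζ b) * rescaledKernel η ε (a - b)

theorem edgeWeight_comm {d : ℕ} (Γ : Finset (EuclideanSpace ℝ (Fin d))) (η : ℝ → ℝ)
    (γ : EuclideanSpace ℝ (Fin d) → ℝ) (ε ζ : ℝ) (a b : EuclideanSpace ℝ (Fin d)) :
    edgeWeight Γ η γ ε ζ a b = edgeWeight Γ η γ ε ζ b a := by
  rw [edgeWeight, edgeWeight, rescaledKernel, rescaledKernel, norm_sub_rev, add_comm]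

theorem one_le_truncatedWeight {d : ℕ} {Ω : Set (EuclideanSpace ℝ (Fin d))}
    {Γ : Finset (EuclideanSpace ℝ (Fin d))} {r₀ α : ℝ} {γ : EuclideanSpace ℝ (Fin d) → ℝ}
    (hγ : IsSingularWeight Ω Γ r₀ α γ) {ζ : ℝ} (hζ : 1 ≤ ζ) {a : EuclideanSpace ℝ (Fin d)}
    (ha : a ∈ Ω) : 1 ≤ truncatedWeight Γ γ ζ a := by
  unfold truncatedWeight
  split_ifs with h
  · exact hζ
  · exact le_min (hγ.one_le a ⟨ha, h⟩) hζ

theorem rescaledKernel_nonneg {d : ℕ} {η : ℝ → ℝ} (hη : IsKernelProfile η) {ε : ℝ} (hε : 0 < ε)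
    (v : EuclideanSpace ℝ (Fin d)) : 0 ≤ rescaledKernel η ε v :=
  mul_nonneg (by positivity) (hη.nonneg _ (by positivity))

theorem edgeWeight_nonneg {d : ℕ} {Ω : Set (EuclideanSpace ℝ (Fin d))}
    {Γ : Finset (EuclideanSpace ℝ (Fin d))} {r₀ α : ℝ} {γ : EuclideanSpace ℝ (Fin d) → ℝ}
    (hγ : IsSingularWeight Ω Γ r₀ α γ) {η : ℝ → ℝ} (hη : IsKernelProfile η) {ε ζ : ℝ}
    (hε : 0 < ε) (hζ : 1 ≤ ζ) {a b : EuclideanSpace ℝ (Fin d)} (ha : a ∈ Ω) (hb : b ∈ Ω) :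
    0 ≤ edgeWeight Γ η γ ε ζ a b := by
  have h1 := one_le_truncatedWeight hγ hζ ha
  have h2 := one_le_truncatedWeight hγ hζ hb
  exact mul_nonneg (by linarith) (rescaledKernel_nonneg hη hε _)

theorem edgeWeight_eq_zero {d : ℕ} {Γ : Finset (EuclideanSpace ℝ (Fin d))}
    {γ : EuclideanSpace ℝ (Fin d) → ℝ} {η : ℝ → ℝ} (hη : IsKernelProfile η) {ε ζ : ℝ}
    (hε : 0 < ε) {a b : EuclideanSpace ℝ (Fin d)} (hab : 2 * ε < ‖a - b‖) :
    edgeWeight Γ η γ ε ζ a b = 0 := by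
  rw [edgeWeight, rescaledKernel, hη.eq_zero _ (by rwa [lt_div_iff₀ hε]), mul_zero, mul_zero]

theorem le_edgeWeight {d : ℕ} {Ω : Set (EuclideanSpace ℝ (Fin d))}
    {Γ : Finset (EuclideanSpace ℝ (Fin d))} {r₀ α : ℝ} {γ : EuclideanSpace ℝ (Fin d) → ℝ}
    (hγ : IsSingularWeight Ω Γ r₀ α γ) {η : ℝ → ℝ} (hη : IsKernelProfile η) {ε ζ : ℝ}
    (hε : 0 < ε) (hζ : 1 ≤ ζ) {a b : EuclideanSpace ℝ (Fin d)} (hb : b ∈ Ω)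
    (hab : ‖a - b‖ ≤ ε) {W : ℝ} (hW : 0 ≤ W) (ha : W ≤ truncatedWeight Γ γ ζ a) :
    W * (1 / ε ^ d) ≤ edgeWeight Γ η γ ε ζ a b := by
  have h1 := one_le_truncatedWeight hγ hζ hb
  have h2 : 1 ≤ η (‖a - b‖ / ε) :=
    hη.one_le _ (by positivity) (by rwa [div_le_one hε])
  rw [edgeWeight, rescaledKernel]
  refine mul_le_mul (by linarith) ?_ (by positivity) (by linarith)
  exact le_mul_of_one_le_right (by positivity) h2

theorem graphLaplacian_eq_zero_iff {d n : ℕ} {Γ : Finset (EuclideanSpace ℝ (Fin d))} {η : ℝ → ℝ}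
    {γ : EuclideanSpace ℝ (Fin d) → ℝ} {ε ζ : ℝ} (hn : 0 < n) (hε : 0 < ε)
    {x : Fin n → EuclideanSpace ℝ (Fin d)} {u : graphVertices Γ x → ℝ}
    {a : graphVertices Γ x} :
    graphLaplacian Γ η γ ε ζ x u a = 0 ↔
      ∑ b : graphVertices Γ x, edgeWeight Γ η γ ε ζ a b * (u b - u a) = 0 := by
  have h : 1 / (2 * (n : ℝ) * ε ^ 2) ≠ 0 := by positivity
  rw [graphLaplacian, mul_eq_zero_iff_left h]
  rfl

-- Puts the problem in the form of the abstract Dirichlet problem, with the labels as boundary. The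
-- value 0 off Γ is a default that the boundary condition never reads.
open Classical in
theorem isGraphSolution_iff {d n : ℕ} {Γ : Finset (EuclideanSpace ℝ (Fin d))} {g : Γ → ℝ}
    {η : ℝ → ℝ} {γ : EuclideanSpace ℝ (Fin d) → ℝ} {ε ζ : ℝ} (hn : 0 < n) (hε : 0 < ε)
    {x : Fin n → EuclideanSpace ℝ (Fin d)} {u : graphVertices Γ x → ℝ} :
    IsGraphSolution Γ g η γ ε ζ x u ↔
      (∀ a ∉ {a : graphVertices Γ x | (a : EuclideanSpace ℝ (Fin d)) ∈ Γ},
        ∑ b : graphVertices Γ x, edgeWeight Γ η γ ε ζ a b * (u b - u a) = 0) ∧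
      ∀ a ∈ {a : graphVertices Γ x | (a : EuclideanSpace ℝ (Fin d)) ∈ Γ},
        u a = if h : (a : EuclideanSpace ℝ (Fin d)) ∈ Γ then g ⟨a, h⟩ else 0 := by
  constructor
  · intro hu
    refine ⟨fun a ha => (graphLaplacian_eq_zero_iff hn hε).1 (hu.laplacian_eq_zero a ha),
      fun a ha => ?_⟩
    have ha' : (a : EuclideanSpace ℝ (Fin d)) ∈ Γ := ha
    rw [dif_pos ha']
    exact hu.eq_label ⟨a, ha'⟩
  · rintro ⟨h1, h2⟩
    refine ⟨fun a ha => (graphLaplacian_eq_zero_iff hn hε).2 (h1 a ha), fun z => ?_⟩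
    rw [h2 ⟨z, mem_graphVertices_of_mem x z.2⟩ z.2, dif_pos z.2]

/-- A well sampled graph is connected to the labels. -/
theorem exists_reflTransGen_label {d n : ℕ} {Ω : Set (EuclideanSpace ℝ (Fin d))}
    {Γ : Finset (EuclideanSpace ℝ (Fin d))} (hΓ : ∀ z ∈ Γ, z ∈ Ω)
    (hΓ_comp : ∀ y ∈ Ω, ∃ z ∈ Γ, z ∈ connectedComponentIn Ω y) {r₀ α : ℝ}
    {γ : EuclideanSpace ℝ (Fin d) → ℝ} (hγ : IsSingularWeight Ω Γ r₀ α γ) {η : ℝ → ℝ}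
    (hη : IsKernelProfile η) {ε ζ : ℝ} (hε : 0 < ε) (hζ : 1 ≤ ζ)
    {x : Fin n → EuclideanSpace ℝ (Fin d)} (hx : ∀ i, x i ∈ Ω) {l u : ℝ} (hl : 0 < l)
    (hs : IsWellSampled Ω ε l u x) (a : graphVertices Γ x) :
    ∃ z ∈ {a : graphVertices Γ x | (a : EuclideanSpace ℝ (Fin d)) ∈ Γ},
      Relation.ReflTransGen (fun a b : graphVertices Γ x => 0 < edgeWeight Γ η γ ε ζ a b) a z := by
  have haΩ := mem_of_mem_graphVertices hΓ hx a.2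
  obtain ⟨z, hz, hzc⟩ := hΓ_comp a haΩ
  refine ⟨⟨z, mem_graphVertices_of_mem x hz⟩, hz, ?_⟩
  have hdense : ∀ q ∈ Ω, ∃ v : graphVertices Γ x,
      dist (v : EuclideanSpace ℝ (Fin d)) q ≤ ε / 8 := by
    intro q hq
    have h1 : 0 < ((Finset.univ.filter fun j => dist (x j) q ≤ ε / 8).card : ℝ) :=
      hl.trans_le (hs q hq).1
    obtain ⟨j, hj⟩ := Finset.card_pos.1 (by exact_mod_cast h1)
    exact ⟨⟨x j, mem_graphVertices_sample Γ x j⟩, (Finset.mem_filter.1 hj).2⟩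
  -- Samples at density ε/8 give links of length at most ε/2, where the profile is at least 1.
  have h := reflTransGen_of_dense (fun v : graphVertices Γ x => (v : EuclideanSpace ℝ (Fin d)))
    (show 0 < ε / 8 by positivity) hdense (U := connectedComponentIn Ω a)
    isPreconnected_connectedComponentIn (connectedComponentIn_subset _ _)
    (a := a) (b := ⟨z, mem_graphVertices_of_mem x hz⟩) (mem_connectedComponentIn haΩ) hzc
  refine Relation.ReflTransGen.mono (fun v v' hvv => ?_) _ _ h
  refine lt_of_lt_of_le (show 0 < 1 * (1 / ε ^ d) by positivity)
    (le_edgeWeight hγ hη hε hζ (mem_of_mem_graphVertices hΓ hx v'.2) ?_ zero_le_one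
      (one_le_truncatedWeight hγ hζ (mem_of_mem_graphVertices hΓ hx v.2)))
  rw [← dist_eq_norm]
  linarith

/-! ### Size of the weight near and away from the labels -/

/-- The weight near a label. -/
theorem IsSingularWeight.eq_of_near {d : ℕ} {Ω : Set (EuclideanSpace ℝ (Fin d))}
    {Γ : Finset (EuclideanSpace ℝ (Fin d))} {r₀ α : ℝ} {γ : EuclideanSpace ℝ (Fin d) → ℝ}
    (hγ : IsSingularWeight Ω Γ r₀ α γ) {R₀ : ℝ}
    (hR : ENNReal.ofReal (4 * R₀) ≤ Set.einfsep (Γ : Set (EuclideanSpace ℝ (Fin d))))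
    {z y : EuclideanSpace ℝ (Fin d)} (hz : z ∈ Γ) (hy : y ∈ Ω) (hyz : y ≠ z)
    (hyR : ‖y - z‖ ≤ R₀) : y ∉ Γ ∧ γ y = 1 + (r₀ / ‖y - z‖) ^ α := by
  have hpos : 0 < ‖y - z‖ := norm_pos_iff.2 (sub_ne_zero.2 hyz)
  have hsep : ∀ z' ∈ Γ, z' ≠ z → 4 * R₀ ≤ dist z' z := by
    intro z' hz' hne
    have h1 := hR.trans (Set.einfsep_le_edist_of_mem hz' hz hne)
    rwa [edist_dist, ENNReal.ofReal_le_ofReal_iff dist_nonneg] at h1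
  -- Other labels are at least 4R₀ from z, so z is the label closest to y.
  have hfar : ∀ z' ∈ Γ, ‖y - z‖ ≤ dist y z' := by
    intro z' hz'
    by_cases hne : z' = z
    · rw [hne, dist_eq_norm]
    · have h1 := hsep z' hz' hne
      have h2 := dist_triangle z' y z
      rw [dist_eq_norm y z, dist_comm z' y] at h2
      linarith
  have hyΓ : y ∉ Γ := fun h => by
    have := hfar y h
    rw [dist_self] at this
    linarith
  refine ⟨hyΓ, ?_⟩
  have hinf : Metric.infDist y Γ = ‖y - z‖ := by
    refine le_antisymm ?_ ?_
    · rw [← dist_eq_norm]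
      exact Metric.infDist_le_dist_of_mem hz
    · exact (Metric.le_infDist ⟨z, hz⟩).2 fun z' hz' => hfar z' hz'
  rw [← hinf]
  refine hγ.eq_near y ⟨subset_closure hy, hyΓ⟩ ?_
  calc Metric.infEDist y Γ ≤ edist y z := Metric.infEDist_le_edist_of_mem hz
    _ = ENNReal.ofReal ‖y - z‖ := by rw [edist_dist, dist_eq_norm]
    _ ≤ ENNReal.ofReal R₀ := ENNReal.ofReal_le_ofReal hyR
    _ = ENNReal.ofReal (4 * R₀) / 4 := by
        rw [ENNReal.ofReal_mul (by norm_num), ENNReal.ofReal_ofNat, mul_comm,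
          ENNReal.mul_div_cancel_right (by norm_num) (by norm_num)]
    _ ≤ _ := by gcongr

/-- At z itself the value is ζ ≥ ε^(-α); at other points the singular weight is at least
(r₀/(Kε))^α, unless truncation replaces it by ζ. The minimum covers both. -/
theorem le_truncatedWeight_near {d : ℕ} {Ω : Set (EuclideanSpace ℝ (Fin d))}
    {Γ : Finset (EuclideanSpace ℝ (Fin d))} {r₀ α : ℝ} (hr₀ : 0 < r₀) (hα : 0 ≤ α)
    {γ : EuclideanSpace ℝ (Fin d) → ℝ} (hγ : IsSingularWeight Ω Γ r₀ α γ) {R₀ : ℝ}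
    (hR : ENNReal.ofReal (4 * R₀) ≤ Set.einfsep (Γ : Set (EuclideanSpace ℝ (Fin d))))
    {ε ζ K : ℝ} (hε : 0 < ε) (hζ : 1 + ε ^ (-α) ≤ ζ) (hK : 0 < K) (hKR : K * ε ≤ R₀)
    {z y : EuclideanSpace ℝ (Fin d)} (hz : z ∈ Γ) (hy : y ∈ Ω) (hyK : ‖y - z‖ ≤ K * ε) :
    min 1 ((r₀ / K) ^ α) * ε ^ (-α) ≤ truncatedWeight Γ γ ζ y := by
  have hεα : 0 < ε ^ (-α) := Real.rpow_pos_of_pos hε _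
  have h1 : min 1 ((r₀ / K) ^ α) * ε ^ (-α) ≤ ζ := by
    have := mul_le_mul_of_nonneg_right (min_le_left 1 ((r₀ / K) ^ α)) hεα.le
    linarith
  unfold truncatedWeight
  split_ifs with hyΓ
  · exact h1
  · have hyz : y ≠ z := fun h => hyΓ (h ▸ hz)
    have hpos : 0 < ‖y - z‖ := norm_pos_iff.2 (sub_ne_zero.2 hyz)
    refine le_min ?_ h1
    rw [(hγ.eq_of_near hR hz hy hyz (hyK.trans hKR)).2]
    calc min 1 ((r₀ / K) ^ α) * ε ^ (-α) ≤ (r₀ / K) ^ α * ε ^ (-α) := by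
          gcongr; exact min_le_right _ _
      _ = (r₀ / (K * ε)) ^ α := by
          rw [Real.rpow_neg hε.le, ← Real.inv_rpow hε.le, ← Real.mul_rpow (by positivity)
            (by positivity)]
          congr 1
          field_simp
      _ ≤ (r₀ / ‖y - z‖) ^ α := by gcongr
      _ ≤ _ := by linarith

/-- At distance r₀ε the weight equals 1 + ε^(-α) ≤ ζ, so from there on truncation is inactive and
the barrier computation may use γ itself. -/
theorem truncatedWeight_eq_near {d : ℕ} {Ω : Set (EuclideanSpace ℝ (Fin d))}
    {Γ : Finset (EuclideanSpace ℝ (Fin d))} {r₀ α : ℝ} (hr₀ : 0 < r₀) (hα : 0 ≤ α)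
    {γ : EuclideanSpace ℝ (Fin d) → ℝ} (hγ : IsSingularWeight Ω Γ r₀ α γ) {R₀ : ℝ}
    (hR : ENNReal.ofReal (4 * R₀) ≤ Set.einfsep (Γ : Set (EuclideanSpace ℝ (Fin d))))
    {ε ζ : ℝ} (hε : 0 < ε) (hζ : 1 + ε ^ (-α) ≤ ζ)
    {z y : EuclideanSpace ℝ (Fin d)} (hz : z ∈ Γ) (hy : y ∈ Ω) (hyr : r₀ * ε ≤ ‖y - z‖)
    (hyR : ‖y - z‖ ≤ R₀) : truncatedWeight Γ γ ζ y = 1 + (r₀ / ‖y - z‖) ^ α := by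
  have hpos : 0 < ‖y - z‖ := lt_of_lt_of_le (by positivity) hyr
  have hyz : y ≠ z := sub_ne_zero.1 (norm_pos_iff.1 hpos)
  obtain ⟨h1, h2⟩ := hγ.eq_of_near hR hz hy hyz hyR
  rw [truncatedWeight, if_neg h1, h2]
  refine min_eq_left (le_trans ?_ hζ)
  rw [Real.rpow_neg hε.le, ← Real.inv_rpow hε.le]
  gcongr
  rw [div_le_iff₀ hpos, ← one_div, div_mul_eq_mul_div, one_mul, le_div_iff₀ hε]
  exact hyr

/-- The weight is bounded away from the labels. -/
theorem IsSingularWeight.exists_le_of_far {d : ℕ} {Ω : Set (EuclideanSpace ℝ (Fin d))}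
    (hbdd : Bornology.IsBounded Ω) {Γ : Finset (EuclideanSpace ℝ (Fin d))} {r₀ α : ℝ}
    {γ : EuclideanSpace ℝ (Fin d) → ℝ} (hγ : IsSingularWeight Ω Γ r₀ α γ) {t : ℝ} (ht : 0 < t) :
    ∃ M : ℝ, 0 ≤ M ∧ ∀ y ∈ Ω, (∀ z ∈ Γ, t ≤ dist y z) → γ y ≤ M := by
  set s := closure Ω ∩ {y | ∀ z ∈ Γ, t ≤ dist y z} with hs
  have hcl : IsClosed {y : EuclideanSpace ℝ (Fin d) | ∀ z ∈ Γ, t ≤ dist y z} := by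
    have : {y : EuclideanSpace ℝ (Fin d) | ∀ z ∈ Γ, t ≤ dist y z} =
        ⋂ z ∈ Γ, (fun y => dist y z) ⁻¹' Set.Ici t := by
      ext y; simp
    rw [this]
    exact isClosed_biInter fun z _ => isClosed_Ici.preimage (by fun_prop)
  have hcomp : IsCompact s := hbdd.isCompact_closure.inter_right hcl
  have hcont : ContinuousOn γ s := hγ.smooth.continuousOn.mono fun y hy => ⟨hy.1, fun hyΓ => by
    have := hy.2 y hyΓ
    rw [dist_self] at this
    linarith⟩
  obtain ⟨M, hM⟩ := hcomp.bddAbove_image hcont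
  refine ⟨max M 0, le_max_right _ _, fun y hy hyt => le_max_of_le_left (hM ⟨y, ⟨?_, hyt⟩, rfl⟩)⟩
  exact subset_closure hy

/-! ### Energy estimate near a label -/

theorem exists_ofReal_le_einfsep {E : Type*} [MetricSpace E] (Γ : Finset E) :
    ∃ R₀ : ℝ, 0 < R₀ ∧ ENNReal.ofReal (4 * R₀) ≤ Set.einfsep (Γ : Set E) := by
  have hpos : 0 < Set.einfsep (Γ : Set E) := Γ.finite_toSet.einfsep_pos
  rcases eq_or_ne (Set.einfsep (Γ : Set E)) ∞ with h | h
  · exact ⟨1, one_pos, by rw [h]; exact le_top⟩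
  · refine ⟨(Set.einfsep (Γ : Set E)).toReal / 4, by
      have := ENNReal.toReal_pos hpos.ne' h
      positivity, ?_⟩
    rw [mul_div_cancel₀ _ (by norm_num), ENNReal.ofReal_toReal h]

theorem le_dist_of_ofReal_le_einfsep {E : Type*} [MetricSpace E] {Γ : Finset E} {R₀ : ℝ}
    (hR : ENNReal.ofReal (4 * R₀) ≤ Set.einfsep (Γ : Set E)) {z z' : E} (hz : z ∈ Γ)
    (hz' : z' ∈ Γ) (hne : z ≠ z') : 4 * R₀ ≤ dist z z' := by
  have h1 := hR.trans (Set.einfsep_le_edist_of_mem hz hz' hne)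
  rwa [edist_dist, ENNReal.ofReal_le_ofReal_iff dist_nonneg] at h1

/-- A Lipschitz extension of the labels which is constant near each label. -/
theorem exists_lipschitz_locally_constant_extension {E : Type*} [MetricSpace E] (Γ : Finset E)
    (g : Γ → ℝ) {R₀ : ℝ} (hR₀ : 0 < R₀)
    (hR : ENNReal.ofReal (4 * R₀) ≤ Set.einfsep (Γ : Set E)) :
    ∃ (G : E → ℝ) (L : ℝ), 0 ≤ L ∧ (∀ a b, |G a - G b| ≤ L * dist a b) ∧
      ∀ (z : Γ) (y : E), dist y z ≤ R₀ → G y = g z := by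
  -- A plateau function: 1 within R₀ of z and 0 beyond 2R₀. Since labels are 4R₀ apart, only one
  -- summand is active near each label.
  set t : E → E → ℝ := fun z y => max (min (2 - dist y z / R₀) 1) 0 with ht
  refine ⟨fun y => ∑ z : Γ, g z * t z y, ∑ z : Γ, |g z| / R₀, by positivity,
    fun a b => ?_, fun z y hy => ?_⟩
  · rw [← Finset.sum_sub_distrib, Finset.sum_mul]
    refine (Finset.abs_sum_le_sum_abs _ _).trans (Finset.sum_le_sum fun z _ => ?_)
    rw [← mul_sub, abs_mul, div_mul_eq_mul_div, mul_div_assoc]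
    refine mul_le_mul_of_nonneg_left ?_ (abs_nonneg _)
    calc |t z a - t z b| ≤ |min (2 - dist a (z : E) / R₀) 1 - min (2 - dist b (z : E) / R₀) 1| :=
          abs_max_sub_max_le_abs _ _ _
      _ ≤ |(2 - dist a (z : E) / R₀) - (2 - dist b (z : E) / R₀)| := by
          have := abs_min_sub_min_le_max (2 - dist a (z : E) / R₀) 1 (2 - dist b (z : E) / R₀) 1
          simpa using this
      _ = |dist b (z : E) - dist a (z : E)| / R₀ := by
          rw [show (2 - dist a (z : E) / R₀) - (2 - dist b (z : E) / R₀) =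
            (dist b (z : E) - dist a (z : E)) / R₀ by ring, abs_div, abs_of_pos hR₀]
      _ ≤ dist a b / R₀ := by
          gcongr
          rw [dist_comm a b]
          exact abs_dist_sub_le _ _ _
  · have h1 : t z y = 1 := by
      have : dist y (z : E) / R₀ ≤ 1 := by rwa [div_le_one hR₀]
      rw [ht]
      simp only
      rw [min_eq_right (by linarith), max_eq_left zero_le_one]
    have h0 : ∀ z' : Γ, z' ≠ z → t z' y = 0 := by
      intro z' hne
      have hsep := le_dist_of_ofReal_le_einfsep hR z.2 z'.2 fun h => hne (Subtype.ext h.symm)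
      have htri := dist_triangle (z : E) y z'
      rw [dist_comm (z : E) y] at htri
      have : 2 ≤ dist y (z' : E) / R₀ := by
        rw [le_div_iff₀ hR₀]; linarith
      rw [ht]
      simp only
      rw [max_eq_right]
      exact (min_le_left _ _).trans (by linarith)
    change ∑ z' : Γ, g z' * t z' y = g z
    rw [Finset.sum_eq_single z (fun z' _ hne => by rw [h0 z' hne, mul_zero])
      (fun h => absurd (Finset.mem_univ _) h), h1, mul_one]

/-- The competitor is constant within R₀ of each label and edges have length at most 2ε ≤ R₀/2, so
edges with an endpoint within R₀/2 of a label cost nothing. On the others the weight is bounded and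
each contributes O(ε^(2-d)), with O(nε^d) neighbours for each of the n samples. -/
theorem exists_energy_le {d : ℕ} {Ω : Set (EuclideanSpace ℝ (Fin d))}
    (hbdd : Bornology.IsBounded Ω) {Γ : Finset (EuclideanSpace ℝ (Fin d))}
    (hΓ : ∀ z ∈ Γ, z ∈ Ω) (g : Γ → ℝ) {r₀ α : ℝ} {γ : EuclideanSpace ℝ (Fin d) → ℝ}
    (hγ : IsSingularWeight Ω Γ r₀ α γ) {η : ℝ → ℝ} (hη : IsKernelProfile η) {R₀ : ℝ}
    (hR₀ : 0 < R₀) (hR : ENNReal.ofReal (4 * R₀) ≤ Set.einfsep (Γ : Set (EuclideanSpace ℝ (Fin d))))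
    {C₁ : ℝ} (hC₁ : 0 < C₁) :
    ∃ C : ℝ, 0 < C ∧ ∀ (n : ℕ) (ε ζ l : ℝ) (x : Fin n → EuclideanSpace ℝ (Fin d))
      (u : graphVertices Γ x → ℝ), 0 < n → 0 < ε → ε ≤ R₀ / 4 → 1 ≤ ζ → Function.Injective x →
      (∀ i, x i ∈ Ω) → (∀ i, x i ∉ Γ) → IsWellSampled Ω ε l (C₁ * (n * ε ^ d)) x →
      IsGraphSolution Γ g η γ ε ζ x u →
      ∑ a : graphVertices Γ x, ∑ b : graphVertices Γ x,
        edgeWeight Γ η γ ε ζ a b * (u b - u a) ^ 2 ≤ C * (n ^ 2 * ε ^ 2) := by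
  obtain ⟨G, L, hL, hGL, hGg⟩ := exists_lipschitz_locally_constant_extension Γ g hR₀ hR
  obtain ⟨M, hM, hγM⟩ := hγ.exists_le_of_far hbdd (half_pos hR₀)
  have hη0 : 0 < η 0 := by linarith [hη.one_le_zero_value]
  refine ⟨2 * M * η 0 * (4 * L ^ 2) * C₁ + 1, by positivity,
    fun n ε ζ l x u hn hε hεR hζ hinj hxΩ hxΓ hs hu => ?_⟩
  have hV : ∀ a : graphVertices Γ x, (a : EuclideanSpace ℝ (Fin d)) ∈ Ω := fun a =>
    mem_of_mem_graphVertices hΓ hxΩ a.2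
  have hu' := (isGraphSolution_iff hn hε).1 hu
  have hdir := graph_energy_le (fun a b : graphVertices Γ x => edgeWeight_comm Γ η γ ε ζ a b)
    (fun a b => edgeWeight_nonneg hγ hη hε hζ (hV a) (hV b))
    (G := fun a : graphVertices Γ x => G a) hu'.1 (fun a ha => by
      have ha' : (a : EuclideanSpace ℝ (Fin d)) ∈ Γ := ha
      have := hu.eq_label ⟨a, ha'⟩
      rw [hGg ⟨a, ha'⟩ a (by simpa using hR₀.le)]
      exact this.symm)
  refine hdir.trans ?_
  set B := 2 * M * (1 / ε ^ d * η 0) * (L * (2 * ε)) ^ 2 with hB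
  have hB0 : 0 ≤ B := by positivity
  have hzero : ∀ a b : EuclideanSpace ℝ (Fin d), (∃ z ∈ Γ, dist a z ≤ R₀ / 2) →
      edgeWeight Γ η γ ε ζ a b * (G b - G a) ^ 2 = 0 := by
    rintro a b ⟨z, hz, haz⟩
    rcases lt_or_ge (2 * ε) ‖a - b‖ with h | h
    · rw [edgeWeight_eq_zero hη hε h, zero_mul]
    · have hbz : dist b z ≤ R₀ := by
        have := dist_triangle b a z
        rw [dist_eq_norm b a, norm_sub_rev] at this
        linarith
      rw [hGg ⟨z, hz⟩ a (by simp only; linarith), hGg ⟨z, hz⟩ b hbz, sub_self]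
      simp
  have hzero' : ∀ a b : EuclideanSpace ℝ (Fin d), (∃ z ∈ Γ, dist b z ≤ R₀ / 2) →
      edgeWeight Γ η γ ε ζ a b * (G b - G a) ^ 2 = 0 := by
    intro a b h
    rw [edgeWeight_comm, ← hzero b a h, ← neg_sq (G b - G a), neg_sub]
  have hpair : ∀ i j, edgeWeight Γ η γ ε ζ (x i) (x j) * (G (x j) - G (x i)) ^ 2 ≤
      if dist (x j) (x i) ≤ 2 * ε then B else 0 := by
    intro i j
    split_ifs with hij
    · by_cases hi : ∃ z ∈ Γ, dist (x i) z ≤ R₀ / 2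
      · rw [hzero _ _ hi]; exact hB0
      by_cases hj : ∃ z ∈ Γ, dist (x j) z ≤ R₀ / 2
      · rw [hzero' _ _ hj]; exact hB0
      push Not at hi hj
      have hwi : truncatedWeight Γ γ ζ (x i) ≤ M := by
        rw [truncatedWeight, if_neg (hxΓ i)]
        exact (min_le_left _ _).trans (hγM _ (hxΩ i) fun z hz => (hi z hz).le)
      have hwj : truncatedWeight Γ γ ζ (x j) ≤ M := by
        rw [truncatedWeight, if_neg (hxΓ j)]
        exact (min_le_left _ _).trans (hγM _ (hxΩ j) fun z hz => (hj z hz).le)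
      have hk : rescaledKernel η ε (x i - x j) ≤ 1 / ε ^ d * η 0 := by
        rw [rescaledKernel]
        gcongr
        exact hη.le_zero_value (by positivity)
      have hsq : (G (x j) - G (x i)) ^ 2 ≤ (L * (2 * ε)) ^ 2 := by
        rw [← sq_abs]
        refine pow_le_pow_left₀ (abs_nonneg _) ((hGL _ _).trans ?_) 2
        gcongr
      rw [edgeWeight, hB]
      exact mul_le_mul (mul_le_mul (by linarith) hk (rescaledKernel_nonneg hη hε _)
        (by positivity)) hsq (sq_nonneg _) (by positivity)
    · rw [edgeWeight_eq_zero hη hε, zero_mul]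
      rw [← dist_eq_norm, dist_comm]
      exact not_le.1 hij
  have hself : ∀ z : Γ, ∃ z' ∈ Γ, dist (z : EuclideanSpace ℝ (Fin d)) z' ≤ R₀ / 2 := fun z =>
    ⟨z, z.2, by rw [dist_self]; positivity⟩
  calc ∑ a : graphVertices Γ x, ∑ b : graphVertices Γ x,
        edgeWeight Γ η γ ε ζ a b * (G b - G a) ^ 2
      = ∑ i, ∑ j, edgeWeight Γ η γ ε ζ (x i) (x j) * (G (x j) - G (x i)) ^ 2 := by
        rw [sum_graphVertices hinj hxΓ]
        rw [Finset.sum_eq_zero (s := Finset.univ (α := Γ)) fun z _ =>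
          Finset.sum_eq_zero fun b _ => hzero _ _ (hself z), add_zero]
        refine Finset.sum_congr rfl fun i _ => ?_
        rw [sum_graphVertices hinj hxΓ]
        rw [Finset.sum_eq_zero (s := Finset.univ (α := Γ)) fun z _ => hzero' _ _ (hself z),
          add_zero]
    _ ≤ ∑ i : Fin n, ∑ j, if dist (x j) (x i) ≤ 2 * ε then B else 0 :=
        Finset.sum_le_sum fun i _ => Finset.sum_le_sum fun j _ => hpair i j
    _ ≤ ∑ _i : Fin n, C₁ * (n * ε ^ d) * B := by
        refine Finset.sum_le_sum fun i _ => ?_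
        rw [← Finset.sum_filter, Finset.sum_const, nsmul_eq_mul]
        exact mul_le_mul_of_nonneg_right (hs (x i) (hxΩ i)).2 hB0
    _ = 2 * M * η 0 * (4 * L ^ 2) * C₁ * (n ^ 2 * ε ^ 2) := by
        rw [Finset.sum_const, Finset.card_univ, Fintype.card_fin, nsmul_eq_mul, hB]
        field_simp
        ring
    _ ≤ _ := by
        gcongr
        linarith

/-- Nearby vertices with large weights have many common neighbours, so the energy controls the
difference of the values there. -/
theorem sq_sub_le_of_energy {d n : ℕ} {Ω : Set (EuclideanSpace ℝ (Fin d))}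
    {Γ : Finset (EuclideanSpace ℝ (Fin d))} (hΓ : ∀ z ∈ Γ, z ∈ Ω) {r₀ α : ℝ}
    {γ : EuclideanSpace ℝ (Fin d) → ℝ} (hγ : IsSingularWeight Ω Γ r₀ α γ) {η : ℝ → ℝ}
    (hη : IsKernelProfile η) {ε ζ : ℝ} (hε : 0 < ε) (hζ : 1 ≤ ζ)
    {x : Fin n → EuclideanSpace ℝ (Fin d)} (hinj : Function.Injective x) (hx : ∀ i, x i ∈ Ω)
    {l l' : ℝ} (hs : IsWellSampled Ω ε l l' x) (u : graphVertices Γ x → ℝ) {W : ℝ} (hW : 0 ≤ W)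
    {a b : graphVertices Γ x} (ha : W ≤ truncatedWeight Γ γ ζ a)
    (hb : W ≤ truncatedWeight Γ γ ζ b)
    (hab : ‖(a : EuclideanSpace ℝ (Fin d)) - b‖ ≤ ε / 2) :
    W * (1 / ε ^ d) * l * (u a - u b) ^ 2 ≤ 4 * ∑ a : graphVertices Γ x, ∑ b : graphVertices Γ x,
        edgeWeight Γ η γ ε ζ a b * (u b - u a) ^ 2 := by
  have hV : ∀ a : graphVertices Γ x, (a : EuclideanSpace ℝ (Fin d)) ∈ Ω := fun a =>
    mem_of_mem_graphVertices hΓ hx a.2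
  have hnn : ∀ a b : graphVertices Γ x, 0 ≤ edgeWeight Γ η γ ε ζ a b * (u b - u a) ^ 2 :=
    fun a b => mul_nonneg (edgeWeight_nonneg hγ hη hε hζ (hV a) (hV b)) (sq_nonneg _)
  set En := ∑ a : graphVertices Γ x, ∑ b : graphVertices Γ x,
        edgeWeight Γ η γ ε ζ a b * (u b - u a) ^ 2 with hEn
  set s := Finset.univ.filter fun j => dist (x j) (a : EuclideanSpace ℝ (Fin d)) ≤ ε / 8 with hsdef
  let vx : Fin n → graphVertices Γ x := fun j => ⟨x j, mem_graphVertices_sample Γ x j⟩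
  have hvx : Function.Injective vx := fun i j h =>
    hinj (congrArg (fun a : graphVertices Γ x => (a : EuclideanSpace ℝ (Fin d))) h)
  -- The row of c alone, restricted to the samples near a, is bounded by the whole energy. The rows
  -- of a and b share these samples, so (A - B)² ≤ 2A² + 2B² compares u a with u b.
  have hrow : ∀ c : graphVertices Γ x, W ≤ truncatedWeight Γ γ ζ c →
      (∀ j ∈ s, ‖(c : EuclideanSpace ℝ (Fin d)) - x j‖ ≤ ε) →
      ∑ j ∈ s, W * (1 / ε ^ d) * (u (vx j) - u c) ^ 2 ≤ En := by
    intro c hc hcs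
    calc ∑ j ∈ s, W * (1 / ε ^ d) * (u (vx j) - u c) ^ 2
        ≤ ∑ j ∈ s, edgeWeight Γ η γ ε ζ c (vx j) * (u (vx j) - u c) ^ 2 := by
          refine Finset.sum_le_sum fun j hj => mul_le_mul_of_nonneg_right ?_ (sq_nonneg _)
          exact le_edgeWeight hγ hη hε hζ (hx j) (hcs j hj) hW hc
      _ = ∑ v ∈ s.map ⟨vx, hvx⟩, edgeWeight Γ η γ ε ζ c v * (u v - u c) ^ 2 := by
          rw [Finset.sum_map]; rfl
      _ ≤ ∑ v : graphVertices Γ x, edgeWeight Γ η γ ε ζ c v * (u v - u c) ^ 2 :=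
          Finset.sum_le_sum_of_subset_of_nonneg (Finset.subset_univ _) fun v _ _ => hnn c v
      _ ≤ En := Finset.single_le_sum
          (f := fun c : graphVertices Γ x =>
            ∑ v : graphVertices Γ x, edgeWeight Γ η γ ε ζ c v * (u v - u c) ^ 2)
          (fun c _ => Finset.sum_nonneg fun v _ => hnn c v) (Finset.mem_univ c)
  have hsa : ∀ j ∈ s, ‖(a : EuclideanSpace ℝ (Fin d)) - x j‖ ≤ ε / 8 := by
    intro j hj
    rw [← dist_eq_norm, dist_comm]
    exact (Finset.mem_filter.1 hj).2
  have h1 := hrow a ha fun j hj => (hsa j hj).trans (by linarith)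
  have h2 := hrow b hb fun j hj => by
    have e : (b : EuclideanSpace ℝ (Fin d)) - x j =
        ((a : EuclideanSpace ℝ (Fin d)) - x j) - ((a : EuclideanSpace ℝ (Fin d)) - b) := by abel
    rw [e]
    refine (norm_sub_le _ _).trans ?_
    linarith [hsa j hj]
  have hl : l ≤ s.card := (hs a (hV a)).1
  calc W * (1 / ε ^ d) * l * (u a - u b) ^ 2
      ≤ W * (1 / ε ^ d) * s.card * (u a - u b) ^ 2 := by gcongr
    _ = ∑ j ∈ s, W * (1 / ε ^ d) * (u a - u b) ^ 2 := by
        rw [Finset.sum_const, nsmul_eq_mul]; ring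
    _ ≤ ∑ j ∈ s, 2 * (W * (1 / ε ^ d) * (u (vx j) - u a) ^ 2 +
          W * (1 / ε ^ d) * (u (vx j) - u b) ^ 2) := by
        refine Finset.sum_le_sum fun j _ => ?_
        rw [← mul_add, mul_left_comm]
        refine mul_le_mul_of_nonneg_left ?_ (by positivity)
        nlinarith [sq_nonneg (u (vx j) - u a + (u (vx j) - u b))]
    _ = 2 * (∑ j ∈ s, W * (1 / ε ^ d) * (u (vx j) - u a) ^ 2 +
          ∑ j ∈ s, W * (1 / ε ^ d) * (u (vx j) - u b) ^ 2) := by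
        rw [← Finset.mul_sum, Finset.sum_add_distrib]
    _ ≤ 4 * En := by linarith

/-- Chaining short steps from a vertex to the label `z`. -/
theorem abs_sub_le_of_chain {d n : ℕ} {Ω : Set (EuclideanSpace ℝ (Fin d))}
    {Γ : Finset (EuclideanSpace ℝ (Fin d))} {ε K δ l l' : ℝ} (hε : 0 < ε) (hδ : 0 ≤ δ)
    {x : Fin n → EuclideanSpace ℝ (Fin d)} (hl : 0 < l) (hs : IsWellSampled Ω ε l l' x)
    {u : graphVertices Γ x → ℝ} (z : graphVertices Γ x)
    (hball : Metric.closedBall (z : EuclideanSpace ℝ (Fin d)) (K * ε) ⊆ Ω)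
    (hstep : ∀ a b : graphVertices Γ x, ‖(a : EuclideanSpace ℝ (Fin d)) - z‖ ≤ K * ε →
      ‖(b : EuclideanSpace ℝ (Fin d)) - z‖ ≤ K * ε →
      ‖(a : EuclideanSpace ℝ (Fin d)) - b‖ ≤ ε / 2 → |u a - u b| ≤ δ) (k : ℕ) :
    ∀ a : graphVertices Γ x, ‖(a : EuclideanSpace ℝ (Fin d)) - z‖ ≤ K * ε →
      ‖(a : EuclideanSpace ℝ (Fin d)) - z‖ ≤ k * (ε / 4) → |u a - u z| ≤ k * δ := by
  induction k with
  | zero =>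
    intro a _ ha
    have h0 : (a : EuclideanSpace ℝ (Fin d)) = z := by
      simp only [CharP.cast_eq_zero, zero_mul, norm_le_zero_iff] at ha
      exact sub_eq_zero.1 ha
    rw [Subtype.ext h0]
    simp
  | succ k ih =>
    intro a haK ha
    push_cast at ha ⊢
    set r := ‖(a : EuclideanSpace ℝ (Fin d)) - z‖ with hr
    have hKε : 0 ≤ K * ε := (norm_nonneg _).trans haK
    rcases le_or_gt r (ε / 2) with h | h
    · have := hstep a z haK (by simpa using hKε) h
      have : 0 ≤ (k : ℝ) * δ := by positivity
      linarith
    · have hr0 : 0 < r := by linarith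
      -- The target q lies on the segment towards z at distance 3ε/8 from a. A sample within ε/8 of
      -- q is within ε/2 of a and at least ε/4 closer to z.
      set t := 3 * ε / 8 / r with ht
      have ht1 : t ≤ 1 := by rw [ht, div_le_one hr0]; linarith
      have ht0 : 0 ≤ t := by positivity
      have htr : t * r = 3 * ε / 8 := by rw [ht]; field_simp
      set q : EuclideanSpace ℝ (Fin d) := z + (1 - t) • ((a : EuclideanSpace ℝ (Fin d)) - z) with hq
      have hqz : ‖q - z‖ = r - 3 * ε / 8 := by
        rw [hq, add_sub_cancel_left, norm_smul, Real.norm_of_nonneg (by linarith), ← hr]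
        linarith
      have hqa : ‖q - a‖ = 3 * ε / 8 := by
        have : q - a = (-t) • ((a : EuclideanSpace ℝ (Fin d)) - z) := by
          rw [hq, sub_smul, one_smul, neg_smul]; abel
        rw [this, norm_smul, norm_neg, Real.norm_of_nonneg ht0, ← hr, htr]
      have hqΩ : q ∈ Ω := hball (by
        rw [Metric.mem_closedBall, dist_eq_norm, hqz]; linarith)
      have h1 := hl.trans_le (hs q hqΩ).1
      obtain ⟨j, hj⟩ := Finset.card_pos.1 (by exact_mod_cast h1)
      have hjq : ‖x j - q‖ ≤ ε / 8 := by
        rw [← dist_eq_norm]; exact (Finset.mem_filter.1 hj).2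
      have hjz : ‖x j - z‖ ≤ r - ε / 4 := by
        rw [show x j - (z : EuclideanSpace ℝ (Fin d)) = (x j - q) + (q - z) by abel]
        refine (norm_add_le _ _).trans ?_
        linarith
      have hja : ‖(a : EuclideanSpace ℝ (Fin d)) - x j‖ ≤ ε / 2 := by
        rw [norm_sub_rev, show x j - (a : EuclideanSpace ℝ (Fin d)) = (x j - q) + (q - a) by abel]
        refine (norm_add_le _ _).trans ?_
        linarith
      have h2 := hstep a ⟨x j, mem_graphVertices_sample Γ x j⟩ haK
        (by change ‖x j - z‖ ≤ _; linarith) hja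
      have h3 := ih ⟨x j, mem_graphVertices_sample Γ x j⟩ (by change ‖x j - z‖ ≤ _; linarith)
        (by change ‖x j - z‖ ≤ _; linarith)
      have h4 := abs_sub_le (u a) (u ⟨x j, mem_graphVertices_sample Γ x j⟩) (u z)
      linarith

/-! ### Comparison with the barrier -/

/-- Transfers the sign of the normalised sums to the graph. With K ≥ r₀ + 2 all neighbours, at
distance at most 2ε, stay beyond r₀ε from z, where truncation is inactive; no label is a neighbour,
so only sample terms remain. -/
theorem barrier_strict_supersolution {d n : ℕ} {Ω : Set (EuclideanSpace ℝ (Fin d))}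
    {Γ : Finset (EuclideanSpace ℝ (Fin d))} {r₀ α β : ℝ} (hr₀ : 0 < r₀) (hα : 0 ≤ α)
    {γ : EuclideanSpace ℝ (Fin d) → ℝ} (hγ : IsSingularWeight Ω Γ r₀ α γ) {η : ℝ → ℝ}
    (hη : IsKernelProfile η) {R₀ : ℝ}
    (hR : ENNReal.ofReal (4 * R₀) ≤ Set.einfsep (Γ : Set (EuclideanSpace ℝ (Fin d))))
    {ε ζ K r₁ : ℝ} (hε : 0 < ε) (hζ : 1 + ε ^ (-α) ≤ ζ) (hK : r₀ + 2 ≤ K) (hr₁ : r₁ ≤ R₀ / 4)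
    {x : Fin n → EuclideanSpace ℝ (Fin d)} (hinj : Function.Injective x) (hx : ∀ i, x i ∈ Ω)
    (hxΓ : ∀ i, x i ∉ Γ) {z : EuclideanSpace ℝ (Fin d)} (hz : z ∈ Γ)
    (hbar : ∀ i, K * ε ≤ ‖x i - z‖ → ‖x i - z‖ ≤ r₁ →
      ∑ j, barrierTerm η α β (r₀ ^ α) ε z (x i) (x j) < 0)
    (a : graphVertices Γ x) (ha : K * ε < ‖(a : EuclideanSpace ℝ (Fin d)) - z‖)
    (ha' : ‖(a : EuclideanSpace ℝ (Fin d)) - z‖ < r₁) :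
    (a : EuclideanSpace ℝ (Fin d)) ∉ Γ ∧ ∑ b : graphVertices Γ x, edgeWeight Γ η γ ε ζ a b *
      (‖(b : EuclideanSpace ℝ (Fin d)) - z‖ ^ β - ‖(a : EuclideanSpace ℝ (Fin d)) - z‖ ^ β) < 0 := by
  have hKε : (r₀ + 2) * ε ≤ K * ε := by gcongr
  have hr₀ε : 0 < r₀ * ε := by positivity
  have haΓ : (a : EuclideanSpace ℝ (Fin d)) ∉ Γ := by
    intro haΓ
    have hne : (a : EuclideanSpace ℝ (Fin d)) ≠ z := by
      rw [← sub_ne_zero, ← norm_pos_iff]; linarith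
    have := le_dist_of_ofReal_le_einfsep hR haΓ hz hne
    rw [dist_eq_norm] at this
    linarith
  refine ⟨haΓ, ?_⟩
  obtain ⟨i, hi⟩ := eq_sample_of_mem_graphVertices a.2 haΓ
  rw [← hi] at ha ha' ⊢
  have hr0 : 0 < ‖x i - z‖ := by linarith
  have hxz : x i ≠ z := sub_ne_zero.1 (norm_pos_iff.1 hr0)
  set N := ‖x i - z‖ ^ (α - β) * (‖x i - z‖ / ε) with hN
  have hN0 : 0 < N := by positivity
  have hlab : ∀ z' : Γ, edgeWeight Γ η γ ε ζ (x i) z' = 0 := by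
    intro z'
    refine edgeWeight_eq_zero hη hε ?_
    by_cases hne : (z' : EuclideanSpace ℝ (Fin d)) = z
    · rw [hne]; linarith
    · have h1 := le_dist_of_ofReal_le_einfsep hR z'.2 hz hne
      have h2 := dist_triangle (z' : EuclideanSpace ℝ (Fin d)) (x i) z
      rw [dist_eq_norm (x i) z, dist_comm _ (x i), dist_eq_norm (x i)] at h2
      linarith
  have hterm : ∀ j, edgeWeight Γ η γ ε ζ (x i) (x j) * (‖x j - z‖ ^ β - ‖x i - z‖ ^ β) * N =
      1 / ε ^ d * barrierTerm η α β (r₀ ^ α) ε z (x i) (x j) := by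
    intro j
    rcases lt_or_ge (2 * ε) ‖x i - x j‖ with h | h
    · rw [edgeWeight_eq_zero hη hε h, barrierTerm, norm_sub_rev (x j) (x i),
        hη.eq_zero _ (by rwa [lt_div_iff₀ hε])]
      ring
    · have h1 : ‖x i - z‖ ≤ ‖x j - z‖ + ‖x i - x j‖ := by
        rw [show x i - z = (x j - z) + (x i - x j) by abel]
        exact norm_add_le _ _
      have h2 : ‖x j - z‖ ≤ ‖x i - z‖ + ‖x i - x j‖ := by
        rw [show x j - z = (x i - z) - (x i - x j) by abel]
        exact norm_sub_le _ _
      have h3 : 0 < ‖x j - z‖ := by linarith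
      have hjz : x j ≠ z := sub_ne_zero.1 (norm_pos_iff.1 h3)
      rw [← barrierTerm_eq η α β ε hr₀ hxz hjz, edgeWeight, rescaledKernel,
        truncatedWeight_eq_near hr₀ hα hγ hR hε hζ hz (hx i) (by linarith) (by linarith),
        truncatedWeight_eq_near hr₀ hα hγ hR hε hζ hz (hx j) (by linarith) (by linarith),
        norm_sub_rev (x i) (x j)]
      ring
  have hsum := hbar i ha.le ha'.le
  rw [sum_graphVertices hinj hxΓ]
  rw [Finset.sum_eq_zero (s := Finset.univ (α := Γ)) fun z' _ => by
    rw [hlab z', zero_mul], add_zero]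
  refine neg_of_mul_neg_left (b := N) ?_ hN0.le
  rw [Finset.sum_mul, Finset.sum_congr rfl fun j _ => hterm j, ← Finset.mul_sum]
  exact mul_neg_of_pos_of_neg (by positivity) hsum

/-- Hölder bound from a bound near the label and the barrier. -/
theorem abs_sub_le_of_barrier {V : Type*} [Fintype V] {w : V → V → ℝ} (hw0 : ∀ a b, 0 ≤ w a b)
    {u r : V → ℝ} {z : V} {β r₁ r₂ δ M A : ℝ} (hβ : 0 < β) (hr₁ : 0 < r₁) (hr : ∀ a, 0 ≤ r a)
    (hu : ∀ a, r₂ < r a → r a < r₁ → ∑ b, w a b * (u b - u a) = 0)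
    (hv : ∀ a, r₂ < r a → r a < r₁ → ∑ b, w a b * (r b ^ β - r a ^ β) < 0)
    (hnear : ∀ a, r a ≤ r₂ → |u a - u z| ≤ δ) (hδ : 0 ≤ δ) (hM : ∀ a, |u a| ≤ M) (hA : 0 < A)
    (hAM : 2 * M ≤ A * r₁ ^ β) (a : V) : |u a - u z| ≤ δ + A * r a ^ β := by
  -- Stated for a general f so that it applies to both u and -u. Outside the annulus the comparison
  -- function wins through δ near z and through A r₁^β ≥ 2M far away.
  have key : ∀ f : V → ℝ, (∀ a, r₂ < r a → r a < r₁ → ∑ b, w a b * (f b - f a) = 0) →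
      (∀ a, r a ≤ r₂ → f a - f z ≤ δ) → (∀ a, f a - f z ≤ 2 * M) →
      f a ≤ f z + δ + A * r a ^ β := by
    intro f hf hfn hfM
    refine graph_comparison hw0 (D := {a | r₂ < r a ∧ r a < r₁}) (u := f)
      (v := fun a => f z + δ + A * r a ^ β) (fun a ha => hf a ha.1 ha.2) (fun a ha => ?_)
      (fun a ha => ?_) a
    · have h1 : ∑ b, w a b * ((f z + δ + A * r b ^ β) - (f z + δ + A * r a ^ β)) =
          A * ∑ b, w a b * (r b ^ β - r a ^ β) := by
        rw [Finset.mul_sum]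
        exact Finset.sum_congr rfl fun b _ => by ring
      rw [h1]
      exact mul_neg_of_pos_of_neg hA (hv a ha.1 ha.2)
    · have h0 : 0 ≤ r a ^ β := Real.rpow_nonneg (hr a) β
      rcases le_or_gt (r a) r₂ with h | h
      · have := hfn a h
        have : 0 ≤ A * r a ^ β := by positivity
        linarith
      · have h2 : r₁ ≤ r a := by
          by_contra! hcon
          exact ha ⟨h, hcon⟩
        have h3 : r₁ ^ β ≤ r a ^ β := Real.rpow_le_rpow hr₁.le h2 hβ.le
        have h4 := mul_le_mul_of_nonneg_left h3 hA.le
        linarith [hfM a]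
  have h1 := key u hu (fun a ha => (le_abs_self _).trans (hnear a ha)) fun a => by
    linarith [le_abs_self (u a), neg_abs_le (u z), hM a, hM z]
  have h2 := key (fun a => - u a) (fun a ha ha' => by
    rw [← neg_eq_zero, ← Finset.sum_neg_distrib, ← hu a ha ha']
    exact Finset.sum_congr rfl fun b _ => by ring)
    (fun a ha => by
      have := (neg_le_abs _).trans (hnear a ha)
      linarith) fun a => by
    linarith [neg_abs_le (u a), le_abs_self (u z), hM a, hM z]
  rw [abs_le]
  constructor <;> linarith

/-! ### The Hölder estimate -/

theorem densityMeasure_nullSingletonClass {d : ℕ} (hd : 1 ≤ d)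
    (Ω : Set (EuclideanSpace ℝ (Fin d))) (ρ : EuclideanSpace ℝ (Fin d) → ℝ) :
    NullSingletonClass (densityMeasure Ω ρ) := by
  have : Nonempty (Fin d) := ⟨⟨0, hd⟩⟩
  have hac : densityMeasure Ω ρ ≪ volume :=
    (withDensity_absolutelyContinuous _ _).trans Measure.restrict_le_self.absolutelyContinuous
  exact ⟨fun y => hac (measure_singleton y)⟩

theorem ae_pi_sample {d : ℕ} (hd : 1 ≤ d) {Ω : Set (EuclideanSpace ℝ (Fin d))}
    (hopen : IsOpen Ω) (Γ : Finset (EuclideanSpace ℝ (Fin d)))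
    (ρ : EuclideanSpace ℝ (Fin d) → ℝ) [IsProbabilityMeasure (densityMeasure Ω ρ)] (n : ℕ) :
    ∀ᵐ x ∂(Measure.pi fun _ : Fin n => densityMeasure Ω ρ),
      Function.Injective x ∧ ∀ i, x i ∈ Ω ∧ x i ∉ Γ := by
  have := densityMeasure_nullSingletonClass hd Ω ρ
  have h1 : ∀ᵐ y ∂(densityMeasure Ω ρ), y ∈ Ω :=
    (withDensity_absolutelyContinuous _ _).ae_le (ae_restrict_mem hopen.measurableSet)
  have h2 : ∀ᵐ y ∂(densityMeasure Ω ρ), y ∉ Γ := by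
    filter_upwards [compl_mem_ae_iff.2 (Γ.countable_toSet.measure_zero (densityMeasure Ω ρ))]
      with y hy
    simpa using hy
  have h3 : ∀ i, ∀ᵐ x ∂(Measure.pi fun _ : Fin n => densityMeasure Ω ρ), x i ∈ Ω ∧ x i ∉ Γ :=
    fun i => (measurePreserving_eval (fun _ : Fin n => densityMeasure Ω ρ)
      i).quasiMeasurePreserving.ae (h1.and h2)
  exact (ae_pi_injective _ n).and (ae_all_iff.2 h3)

/-- Existence, uniqueness and boundedness of the solution on a well sampled graph. -/
theorem existsUnique_isGraphSolution {d n : ℕ} {Ω : Set (EuclideanSpace ℝ (Fin d))}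
    {Γ : Finset (EuclideanSpace ℝ (Fin d))} (hΓ : ∀ z ∈ Γ, z ∈ Ω)
    (hΓ_comp : ∀ y ∈ Ω, ∃ z ∈ Γ, z ∈ connectedComponentIn Ω y) (g : Γ → ℝ) {r₀ α : ℝ}
    {γ : EuclideanSpace ℝ (Fin d) → ℝ} (hγ : IsSingularWeight Ω Γ r₀ α γ) {η : ℝ → ℝ}
    (hη : IsKernelProfile η) {ε ζ : ℝ} (hn : 0 < n) (hε : 0 < ε) (hζ : 1 ≤ ζ)
    {x : Fin n → EuclideanSpace ℝ (Fin d)} (hx : ∀ i, x i ∈ Ω) {l l' : ℝ} (hl : 0 < l)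
    (hs : IsWellSampled Ω ε l l' x) :
    (∃! u : graphVertices Γ x → ℝ, IsGraphSolution Γ g η γ ε ζ x u) ∧
      ∀ u : graphVertices Γ x → ℝ, IsGraphSolution Γ g η γ ε ζ x u →
        ∀ a, |u a| ≤ ∑ z : Γ, |g z| := by
  have hV : ∀ a : graphVertices Γ x, (a : EuclideanSpace ℝ (Fin d)) ∈ Ω := fun a =>
    mem_of_mem_graphVertices hΓ hx a.2
  have hsymm := fun a b : graphVertices Γ x => edgeWeight_comm Γ η γ ε ζ a b
  have hw0 := fun a b : graphVertices Γ x => edgeWeight_nonneg hγ hη hε hζ (hV a) (hV b)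
  have hconn := exists_reflTransGen_label hΓ hΓ_comp hγ hη hε hζ hx hl hs
  constructor
  · simp only [isGraphSolution_iff hn hε]
    exact graph_existsUnique hsymm hw0 hconn _
  · intro u hu
    refine graph_abs_le_of_boundary hsymm hw0 hconn ((isGraphSolution_iff hn hε).1 hu).1
      fun a ha => ?_
    have ha' : (a : EuclideanSpace ℝ (Fin d)) ∈ Γ := ha
    have h1 : u a = g ⟨a, ha'⟩ := hu.eq_label ⟨a, ha'⟩
    rw [h1]
    exact Finset.single_le_sum (f := fun z : Γ => |g z|) (fun z _ => abs_nonneg _)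
      (Finset.mem_univ _)

/-- The conclusion at the label `z`, for the law of the sample on the product space. -/
def HolderEstimateAt {d : ℕ} (Ω : Set (EuclideanSpace ℝ (Fin d)))
    (Γ : Finset (EuclideanSpace ℝ (Fin d))) (g : Γ → ℝ) (ρ : EuclideanSpace ℝ (Fin d) → ℝ)
    (η : ℝ → ℝ) (α β : ℝ) (γ : EuclideanSpace ℝ (Fin d) → ℝ) (z : EuclideanSpace ℝ (Fin d))
    (C c : ℝ) : Prop :=
  ∀ (hz : z ∈ Γ) (n : ℕ) (ε ζ : ℝ), 0 < ε → ε ≤ 1 → 1 ≤ (n : ℝ) * ε ^ d → 1 + ε ^ (-α) ≤ ζ →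
    ∃ B : Set (Fin n → EuclideanSpace ℝ (Fin d)),
      (Measure.pi fun _ : Fin n => densityMeasure Ω ρ).real B ≤
        C * n * Real.exp (-(c * n * ε ^ (d + 4))) ∧
      ∀ x ∉ B, (∃! u : graphVertices Γ x → ℝ, IsGraphSolution Γ g η γ ε ζ x u) ∧
        ∀ u : graphVertices Γ x → ℝ, IsGraphSolution Γ g η γ ε ζ x u →
          ∀ a : graphVertices Γ x, |u a - u ⟨z, mem_graphVertices_of_mem x hz⟩| ≤
            C * ‖(a : EuclideanSpace ℝ (Fin d)) - z‖ ^ β + C * Real.sqrt n * ε ^ (1 + α / 2)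

theorem HolderEstimateAt.mono {d : ℕ} {Ω : Set (EuclideanSpace ℝ (Fin d))}
    {Γ : Finset (EuclideanSpace ℝ (Fin d))} {g : Γ → ℝ} {ρ : EuclideanSpace ℝ (Fin d) → ℝ}
    {η : ℝ → ℝ} {α β : ℝ} {γ : EuclideanSpace ℝ (Fin d) → ℝ} {z : EuclideanSpace ℝ (Fin d)}
    {C C' c c' : ℝ} (h : HolderEstimateAt Ω Γ g ρ η α β γ z C c) (hC0 : 0 ≤ C) (hC : C ≤ C')
    (hc : c' ≤ c) : HolderEstimateAt Ω Γ g ρ η α β γ z C' c' := by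
  intro hz n ε ζ hε hε1 hn hζ
  obtain ⟨B, hB, hx⟩ := h hz n ε ζ hε hε1 hn hζ
  refine ⟨B, hB.trans ?_, fun x hxB => ⟨(hx x hxB).1, fun u hu a => ((hx x hxB).2 u hu a).trans ?_⟩⟩
  · have : 0 ≤ C' := hC0.trans hC
    gcongr
  · gcongr

/-- Off three bad events the argument is deterministic: the barrier fails at some sample, the
sampling is uneven, or the points are degenerate, the last having probability zero. -/
theorem exists_holderEstimateAt {d : ℕ} (hd : 1 ≤ d)
    {Ω : Set (EuclideanSpace ℝ (Fin d))} (hopen : IsOpen Ω)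
    (hbdd : Bornology.IsBounded Ω) (hlip : HasLipschitzBoundary Ω)
    {Γ : Finset (EuclideanSpace ℝ (Fin d))} (hΓ : ∀ z ∈ Γ, z ∈ Ω)
    (hΓ_comp : ∀ y ∈ Ω, ∃ z ∈ Γ, z ∈ connectedComponentIn Ω y) (g : Γ → ℝ) {σ : ℝ≥0}
    {ρ : EuclideanSpace ℝ (Fin d) → ℝ} (hρ : IsHolderDensity Ω σ ρ)
    [IsProbabilityMeasure (densityMeasure Ω ρ)] {η : ℝ → ℝ} (hη : IsKernelProfile η) {r₀ : ℝ}
    (hr₀ : 0 < r₀) {α : ℝ} (hα : 0 ≤ α) {γ : EuclideanSpace ℝ (Fin d) → ℝ}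
    (hγ : IsSingularWeight Ω Γ r₀ α γ) {β : ℝ} (hβ : 0 < β) (hβα : β < α + 2 - d)
    {z : EuclideanSpace ℝ (Fin d)} (hz : z ∈ Γ) :
    ∃ C c : ℝ, 0 < C ∧ 0 < c ∧ HolderEstimateAt Ω Γ g ρ η α β γ z C c := by
  obtain ⟨m, M, hm, hmM⟩ := hρ.bounds
  have hzΩ := hΓ z hz
  have hM : 0 ≤ M := by linarith [hmM z hzΩ]
  obtain ⟨cμ, hcμ0, hcμ⟩ := exists_le_densityMeasure_ball hlip hopen hbdd hm
    (fun x hx => (hmM x hx).1) (ρ := ρ)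
  obtain ⟨Cμ, hCμ0, hCμ⟩ := exists_densityMeasure_closedBall_le hopen hM
    (fun x hx => (hmM x hx).2) (ρ := ρ)
  obtain ⟨Rs, hRs, hRsep⟩ := exists_ofReal_le_einfsep Γ
  obtain ⟨L, t, ht, hLt⟩ :=
    (hρ.contDiffOn.contDiffAt (hopen.mem_nhds hzΩ)).exists_lipschitzOnWith
  obtain ⟨Rt, hRt, hballt⟩ := Metric.mem_nhds_iff.1 (Filter.inter_mem ht (hopen.mem_nhds hzΩ))
  set R₀ := min Rs Rt with hR₀def
  have hR₀ : 0 < R₀ := lt_min hRs hRt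
  have hR : ENNReal.ofReal (4 * R₀) ≤ Set.einfsep (Γ : Set (EuclideanSpace ℝ (Fin d))) :=
    (ENNReal.ofReal_le_ofReal (by linarith [min_le_left Rs Rt])).trans hRsep
  have hball : Metric.ball z R₀ ⊆ Ω := fun y hy =>
    (hballt (Metric.ball_subset_ball (min_le_right _ _) hy)).2
  have hL : LipschitzOnWith L ρ (Metric.ball z R₀) := hLt.mono fun y hy =>
    (hballt (Metric.ball_subset_ball (min_le_right _ _) hy)).1
  obtain ⟨K₀, r₁, Cb, κb, hK₀, hr₁, hr₁R, hCb, hκb, hbar⟩ := exists_barrier_event hd hopen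
    hρ.contDiffOn.continuousOn hm (fun x hx => (hmM x hx).1) hCμ hη hR₀ hball hL hα hβ hβα
    (Real.rpow_pos_of_pos hr₀ α)
  obtain ⟨c₁, C₁, Cs, κs, hc₁, hC₁, hCs, hκs, hws⟩ := exists_isWellSampled_event
    (densityMeasure Ω ρ) hcμ0 hCμ0 hcμ hCμ
  obtain ⟨Ce, hCe, hen⟩ := exists_energy_le hbdd hΓ g hγ hη hR₀ hR hC₁
  -- The first entry serves the drift estimate, the second keeps truncation inactive at neighbours.
  set K := max K₀ (r₀ + 2) with hK
  have hK0 : 0 < K := lt_of_lt_of_le (by linarith) (le_max_left _ _)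
  -- The first bound is required by the energy estimate; the second keeps the Kε-ball about z inside
  -- the ball of radius R₀.
  set ε₀ := min (R₀ / 4) (R₀ / (2 * K)) with hε₀
  have hε₀0 : 0 < ε₀ := by positivity
  set M₀ := ∑ z : Γ, |g z| with hM₀
  have hM₀0 : 0 ≤ M₀ := Finset.sum_nonneg fun _ _ => abs_nonneg _
  set w₀ := min 1 ((r₀ / K) ^ α) with hw₀
  have hw₀0 : 0 < w₀ := by positivity
  -- Each chain step advances by ε/4, so k steps cover the distance Kε.
  set k := ⌈4 * K⌉₊ with hk
  set D := Real.sqrt (4 * Ce / (w₀ * c₁)) with hD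
  have hD0 : 0 ≤ D := Real.sqrt_nonneg _
  set A := 2 * M₀ / r₁ ^ β + 1 with hA
  have hr₁β : 0 < r₁ ^ β := Real.rpow_pos_of_pos hr₁ β
  have hA0 : 0 < A := by positivity
  have hε₀p : 0 < ε₀ ^ (1 + α / 2) := Real.rpow_pos_of_pos hε₀0 _
  -- Barrier height, chaining error and probability constants. The third summand makes the additive
  -- error exceed the trivial bound 2M₀ when ε > ε₀.
  set C := A + k * D + 2 * M₀ / ε₀ ^ (1 + α / 2) + Cb + Cs with hC
  have hT : 0 ≤ 2 * M₀ / ε₀ ^ (1 + α / 2) := by positivity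
  have hkD : 0 ≤ k * D := by positivity
  have hC0 : 0 < C := by linarith
  refine ⟨C, min κb κs, hC0, by positivity, ?_⟩
  intro _ n ε ζ hε hε1 hn hζ
  have hn0 : 0 < n := by
    rcases Nat.eq_zero_or_pos n with h | h
    · rw [h] at hn; norm_num at hn
    · exact h
  have hn1 : (1 : ℝ) ≤ n := by exact_mod_cast hn0
  have hεα : 0 < ε ^ (-α) := Real.rpow_pos_of_pos hε _
  have hζ1 : 1 ≤ ζ := by linarith
  set π := Measure.pi fun _ : Fin n => densityMeasure Ω ρ with hπ
  set B₁ : Set (Fin n → EuclideanSpace ℝ (Fin d)) :=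
    {x | ∃ i, K₀ * ε ≤ ‖x i - z‖ ∧ ‖x i - z‖ ≤ r₁ ∧
            0 ≤ ∑ j, barrierTerm η α β (r₀ ^ α) ε z (x i) (x j)} with hB₁
  set B₂ : Set (Fin n → EuclideanSpace ℝ (Fin d)) :=
    {x | ¬ IsWellSampled Ω ε (c₁ * (n * ε ^ d)) (C₁ * (n * ε ^ d)) x} with hB₂
  set B₃ : Set (Fin n → EuclideanSpace ℝ (Fin d)) :=
    {x | ¬ (Function.Injective x ∧ ∀ i, x i ∈ Ω ∧ x i ∉ Γ)} with hB₃
  refine ⟨B₁ ∪ B₂ ∪ B₃, ?_, fun x hx => ?_⟩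
  · have h3 : π.real B₃ = 0 := by
      rw [Measure.real, ae_iff.1 (ae_pi_sample hd hopen Γ ρ n), ENNReal.toReal_zero]
    have hexp : ∀ (κ : ℝ) (e : ℕ), 0 < κ → min κb κs ≤ κ → e ≤ d + 4 →
        Real.exp (-(κ * n * ε ^ e)) ≤ Real.exp (-(min κb κs * n * ε ^ (d + 4))) := by
      intro κ e hκ hle he
      have := pow_le_pow_of_le_one hε.le hε1 he
      rw [Real.exp_le_exp, neg_le_neg_iff]
      gcongr
    have e1 := hexp κb (d + 2) hκb (min_le_left _ _) (by omega)
    have e2 := hexp κs d hκs (min_le_right _ _) (by omega)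
    have h1 := hbar n ε hε hε1
    have h2 := hws n ε hε hε1 hn
    have hE := Real.exp_pos (-(min κb κs * n * ε ^ (d + 4)))
    calc π.real (B₁ ∪ B₂ ∪ B₃) ≤ π.real B₁ + π.real B₂ + π.real B₃ :=
          (measureReal_union_le _ _).trans (by gcongr; exact measureReal_union_le _ _)
      _ ≤ Cb * n * Real.exp (-(min κb κs * n * ε ^ (d + 4))) +
          Cs * n * Real.exp (-(min κb κs * n * ε ^ (d + 4))) := by
          rw [h3, add_zero]
          exact add_le_add (h1.trans (by gcongr)) (h2.trans (by gcongr))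
      _ = (Cb + Cs) * n * Real.exp (-(min κb κs * n * ε ^ (d + 4))) := by ring
      _ ≤ C * n * Real.exp (-(min κb κs * n * ε ^ (d + 4))) := by
          gcongr
          linarith
  · have hx1 : x ∉ B₁ := fun h => hx (Or.inl (Or.inl h))
    have hs : IsWellSampled Ω ε (c₁ * (n * ε ^ d)) (C₁ * (n * ε ^ d)) x := by
      by_contra h
      exact hx (Or.inl (Or.inr h))
    obtain ⟨hinj, hxx⟩ : Function.Injective x ∧ ∀ i, x i ∈ Ω ∧ x i ∉ Γ := by
      by_contra h
      exact hx (Or.inr h)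
    have hxΩ := fun i => (hxx i).1
    have hxΓ := fun i => (hxx i).2
    have hl : 0 < c₁ * (n * ε ^ d) := by positivity
    obtain ⟨hex, hmax⟩ := existsUnique_isGraphSolution hΓ hΓ_comp g hγ hη hn0 hε hζ1 hxΩ hl hs
    refine ⟨hex, fun u hu a => ?_⟩
    have huM : ∀ a, |u a| ≤ M₀ := hmax u hu
    set vz : graphVertices Γ x := ⟨z, mem_graphVertices_of_mem x hz⟩ with hvz
    have hβa : 0 ≤ ‖(a : EuclideanSpace ℝ (Fin d)) - z‖ ^ β := by positivity
    have hεp : 0 < ε ^ (1 + α / 2) := Real.rpow_pos_of_pos hε _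
    have hsn : 1 ≤ Real.sqrt n := Real.one_le_sqrt.2 hn1
    rcases le_or_gt ε ε₀ with hle | hgt
    · have hεR : ε ≤ R₀ / 4 := hle.trans (min_le_left _ _)
      have hKR : K * ε ≤ R₀ / 2 := by
        have := hle.trans (min_le_right _ _)
        rw [le_div_iff₀ (by positivity)] at this
        linarith
      set δ := D * (Real.sqrt n * ε ^ (1 + α / 2)) with hδ
      have hδ0 : 0 ≤ δ := by positivity
      have hstep : ∀ a b : graphVertices Γ x, ‖(a : EuclideanSpace ℝ (Fin d)) - z‖ ≤ K * ε →
          ‖(b : EuclideanSpace ℝ (Fin d)) - z‖ ≤ K * ε →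
          ‖(a : EuclideanSpace ℝ (Fin d)) - b‖ ≤ ε / 2 → |u a - u b| ≤ δ := by
        intro a b ha hb hab
        have hW : ∀ v : graphVertices Γ x, ‖(v : EuclideanSpace ℝ (Fin d)) - z‖ ≤ K * ε →
            w₀ * ε ^ (-α) ≤ truncatedWeight Γ γ ζ v := fun v hv =>
          le_truncatedWeight_near hr₀ hα hγ hR hε hζ hK0 (by linarith) hz
            (mem_of_mem_graphVertices hΓ hxΩ v.2) hv
        have h1 := sq_sub_le_of_energy hΓ hγ hη hε hζ1 hinj hxΩ hs u (W := w₀ * ε ^ (-α))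
          (by positivity) (hW a ha) (hW b hb) hab
        have h2 := hen n ε ζ _ x u hn0 hε hεR hζ1 hinj hxΩ hxΓ hs hu
        refine abs_le_of_sq_le_sq ?_ hδ0
        have hpow : (ε ^ (1 + α / 2)) ^ 2 = ε ^ 2 * ε ^ α := by
          rw [← Real.rpow_natCast, ← Real.rpow_mul hε.le, ← Real.rpow_natCast ε 2,
            ← Real.rpow_add hε]
          congr 1
          push_cast
          ring
        have hδsq : δ ^ 2 = 4 * Ce / (w₀ * c₁) * (n * (ε ^ 2 * ε ^ α)) := by
          rw [hδ, mul_pow, mul_pow, hD, Real.sq_sqrt (by positivity),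
            Real.sq_sqrt (by positivity), hpow]
        have hεα' : 0 < ε ^ α := Real.rpow_pos_of_pos hε _
        have h3 : w₀ * ε ^ (-α) * (1 / ε ^ d) * (c₁ * (n * ε ^ d)) * (u a - u b) ^ 2 =
            (w₀ * c₁) * n * (u a - u b) ^ 2 / ε ^ α := by
          rw [Real.rpow_neg hε.le]
          field_simp
        rw [h3] at h1
        have h4 := h1.trans (mul_le_mul_of_nonneg_left h2 (by norm_num : (0 : ℝ) ≤ 4))
        rw [div_le_iff₀ hεα'] at h4
        rw [hδsq, div_mul_eq_mul_div, le_div_iff₀ (by positivity)]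
        refine le_of_mul_le_mul_left ?_ (show (0 : ℝ) < n by positivity)
        linarith
      have hnear : ∀ a : graphVertices Γ x, ‖(a : EuclideanSpace ℝ (Fin d)) - z‖ ≤ K * ε →
          |u a - u vz| ≤ k * δ := by
        intro a ha
        refine abs_sub_le_of_chain hε hδ0 hl hs vz (K := K) ?_ hstep k a ha (ha.trans ?_)
        · refine Set.Subset.trans (fun y hy => ?_) hball
          rw [Metric.mem_closedBall] at hy
          rw [Metric.mem_ball]
          have : dist y z ≤ K * ε := hy
          linarith
        · have := mul_le_mul_of_nonneg_right (Nat.le_ceil (4 * K)) (show 0 ≤ ε / 4 by positivity)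
          linarith
      have hsup := fun v : graphVertices Γ x => barrier_strict_supersolution (β := β) hr₀ hα hγ hη hR
        hε hζ (le_max_right K₀ (r₀ + 2)) hr₁R hinj hxΩ hxΓ hz (fun i hi1 hi2 => by
          by_contra! hcon
          refine hx1 ⟨i, le_trans ?_ hi1, hi2, hcon⟩
          gcongr
          exact le_max_left _ _) v
      have hfin := abs_sub_le_of_barrier
        (w := fun a b : graphVertices Γ x => edgeWeight Γ η γ ε ζ a b)
        (fun a b => edgeWeight_nonneg hγ hη hε hζ1 (mem_of_mem_graphVertices hΓ hxΩ a.2)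
          (mem_of_mem_graphVertices hΓ hxΩ b.2))
        (u := u) (r := fun a => ‖(a : EuclideanSpace ℝ (Fin d)) - z‖) (z := vz) (β := β)
        (r₁ := r₁) (r₂ := K * ε) (δ := k * δ) (M := M₀) (A := A) hβ hr₁
        (fun a => norm_nonneg _)
        (fun a h1 h2 => ((isGraphSolution_iff hn0 hε).1 hu).1 a (hsup a h1 h2).1)
        (fun a h1 h2 => (hsup a h1 h2).2) hnear (by positivity) huM hA0
        (by
          rw [hA, add_mul, div_mul_cancel₀ _ hr₁β.ne']
          linarith) a
      refine hfin.trans ?_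
      rw [add_comm]
      refine add_le_add ?_ ?_
      · gcongr
        linarith
      · rw [hδ, ← mul_assoc, ← mul_assoc]
        gcongr
        linarith
    · have h1 : |u a - u vz| ≤ 2 * M₀ := by
        have := abs_sub (u a) (u vz)
        linarith [huM a, huM vz]
      have h2 : 2 * M₀ ≤ C * Real.sqrt n * ε ^ (1 + α / 2) := by
        calc 2 * M₀ = 2 * M₀ / ε₀ ^ (1 + α / 2) * 1 * ε₀ ^ (1 + α / 2) := by field_simp
          _ ≤ C * Real.sqrt n * ε ^ (1 + α / 2) := by
            gcongr
            linarith
      have h3 : 0 ≤ C * ‖(a : EuclideanSpace ℝ (Fin d)) - z‖ ^ β := by positivity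
      linarith

/-- Finitely many estimates that are monotone in their constants hold with common constants. -/
theorem exists_common_constants {ι : Type*} (s : Finset ι) {Q : ι → ℝ → ℝ → Prop}
    (hmono : ∀ i C C' c c', 0 ≤ C → C ≤ C' → c' ≤ c → Q i C c → Q i C' c')
    (h : ∀ i ∈ s, ∃ C c : ℝ, 0 < C ∧ 0 < c ∧ Q i C c) :
    ∃ C c : ℝ, 0 < C ∧ 0 < c ∧ ∀ i ∈ s, Q i C c := by
  classical
  induction s using Finset.induction_on with
  | empty => exact ⟨1, 1, one_pos, one_pos, by simp⟩
  | insert i s _ ih =>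
    obtain ⟨C, c, hC, hc, hs⟩ := ih fun j hj => h j (Finset.mem_insert_of_mem hj)
    obtain ⟨C', c', hC', hc', hi⟩ := h i (Finset.mem_insert_self i s)
    refine ⟨max C C', min c c', lt_max_of_lt_left hC, lt_min hc hc', fun j hj => ?_⟩
    rcases Finset.mem_insert.1 hj with rfl | hj
    · exact hmono _ _ _ _ _ hC'.le (le_max_right _ _) (min_le_right _ _) hi
    · exact hmono _ _ _ _ _ hC.le (le_max_left _ _) (min_le_left _ _) (hs j hj)

theorem mainTheorem3
    (d : ℕ) (hd : 1 ≤ d)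
    (Ω : Set (EuclideanSpace ℝ (Fin d))) (hΩ_open : IsOpen Ω)
    (hΩ_bdd : Bornology.IsBounded Ω) (hΩ_lip : HasLipschitzBoundary Ω)
    (Γ : Finset (EuclideanSpace ℝ (Fin d))) (hΓ : ∀ z ∈ Γ, z ∈ Ω)
    (hΓ_comp : ∀ y ∈ Ω, ∃ z ∈ Γ, z ∈ connectedComponentIn Ω y)
    (g : Γ → ℝ)
    (σ : ℝ≥0) (hσ : 0 < σ) (hσ_one : σ ≤ 1)
    (ρ : EuclideanSpace ℝ (Fin d) → ℝ) (hρ : IsHolderDensity Ω σ ρ)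
    (hρ_prob : IsProbabilityMeasure (densityMeasure Ω ρ))
    (η : ℝ → ℝ) (hη : IsKernelProfile η)
    (r₀ : ℝ) (hr₀ : 0 < r₀) (α : ℝ) (hα_nonneg : 0 ≤ α) (hα : (d : ℝ) - 2 < α)
    (γ : EuclideanSpace ℝ (Fin d) → ℝ) (hγ : IsSingularWeight Ω Γ r₀ α γ)
    (β : ℝ) (hβ : 0 < β) (hβ_lt : β < α + 2 - d) :
    ∃ C c : ℝ, 0 < C ∧ 0 < c ∧
      ∀ (n : ℕ) (ε ζ : ℝ), 0 < ε → ε ≤ 1 → 1 ≤ (n : ℝ) * ε ^ d → 1 + ε ^ (-α) ≤ ζ →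
      ∀ (S : Type*) [MeasurableSpace S] (P : Measure S) [IsProbabilityMeasure P]
        (X : Fin n → S → EuclideanSpace ℝ (Fin d)),
        (∀ i, Measurable (X i)) → iIndepFun X P →
        (∀ i, P.map (X i) = densityMeasure Ω ρ) →
      ∀ (z : EuclideanSpace ℝ (Fin d)) (hz : z ∈ Γ),
        ∃ A : Set S, MeasurableSet A ∧
          1 - C * Real.exp (-(c * (n : ℝ) * ε ^ (d + 4)) + Real.log n) ≤ P.real A ∧
          ∀ s ∈ A,
            (∃! u : graphVertices Γ (fun i => X i s) → ℝ,
              IsGraphSolution Γ g η γ ε ζ (fun i => X i s) u) ∧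
            ∀ u : graphVertices Γ (fun i => X i s) → ℝ,
              IsGraphSolution Γ g η γ ε ζ (fun i => X i s) u →
              ∀ a : graphVertices Γ (fun i => X i s),
                |u a - u ⟨z, mem_graphVertices_of_mem (fun i => X i s) hz⟩| ≤
                  C * ‖(a : EuclideanSpace ℝ (Fin d)) - z‖ ^ β +
                    C * Real.sqrt n * ε ^ (1 + α / 2) := by
  obtain ⟨C, c, hC, hc, h⟩ := exists_common_constants Γ
    (fun z C C' c c' hC hCC hcc (h : HolderEstimateAt Ω Γ g ρ η α β γ z C c) => h.mono hC hCC hcc)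
    fun z hz => exists_holderEstimateAt hd hΩ_open hΩ_bdd hΩ_lip hΓ hΓ_comp g hρ hη hr₀ hα_nonneg
      hγ hβ hβ_lt hz
  refine ⟨C, c, hC, hc, fun n ε ζ hε hε1 hn hζ S _ P _ X hX hindep hlaw z hz => ?_⟩
  obtain ⟨B, hB, hgood⟩ := h z hz hz n ε ζ hε hε1 hn hζ
  set π := Measure.pi fun _ : Fin n => densityMeasure Ω ρ with hπ
  have hXm : Measurable fun s i => X i s := measurable_pi_lambda _ hX
  have hmap : P.map (fun s i => X i s) = π := by
    rw [(iIndepFun_iff_map_fun_eq_pi_map fun i => (hX i).aemeasurable).1 hindep]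
    simp only [hlaw, hπ]
  have hTm : MeasurableSet (toMeasurable π B) := measurableSet_toMeasurable π B
  -- The bad set is not known to be measurable; its measurable hull has the same measure and yields
  -- a measurable good event.
  refine ⟨(fun s i => X i s) ⁻¹' (toMeasurable π B)ᶜ, hXm hTm.compl, ?_, fun s hs =>
    hgood _ fun hsB => hs (subset_toMeasurable π B hsB)⟩
  have hn0 : (0 : ℝ) < n := by
    rcases Nat.eq_zero_or_pos n with h0 | h0
    · rw [h0] at hn; norm_num at hn
    · exact_mod_cast h0
  rw [← map_measureReal_apply hXm hTm.compl, hmap, probReal_compl_eq_one_sub hTm,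
    Real.exp_add, Real.exp_log hn0, Measure.real, measure_toMeasurable]
  have : π.real B ≤ C * n * Real.exp (-(c * n * ε ^ (d + 4))) := hB
  rw [Measure.real] at this
  linarith
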